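/- **Conventions.** Rings are associative with $1$. A pseudo-involution on a ring $R$ is an additive map $r\mapsto\bar r$ with $\bar 1=1$, $\overline{rr'}=\bar r'\bar r$ and $\bar{\bar r}=\lambda_R r\bar\lambda_R$ for a fixed $\lambda_R\in R^*$. A quadratic structure on $R$ is an abelian group $A_R$ with a right action $(a,r)\mapsto a\cdot r$ of the multiplicative monoid of $R$ by endomorphisms, together with additive maps $\phi:R\to A_R$, $\mathrm{tr}:A_R\to R$ that are equivariant (for the action $r\cdot r'=\bar r'rr'$ on $R$) and satisfy $\phi(r)=\phi(\bar r\lambda_R)$, $\mathrm{tr}(\phi(r))=r+\bar r\lambda_R$, $\mathrm{tr}(a)=\overline{\mathrm{tr}(a)}\lambda_R$, $a\cdot(r+r')=a\cdot r+\phi(\bar r'\,\mathrm{tr}(a)\,r)+a\cdot r'$. A quadratic ring $(K,A_K)$ is a commutative ring $K$ with involution ($\lambda_K=1$) and a quadratic structure $A_K$ that is itself a commutative ring, with $a(a'\cdot k)=(aa')\cdot k$, $a\phi(k)=\phi(\mathrm{tr}(a)k)$, $\mathrm{tr}(1)=1$, $\mathrm{tr}(aa')=\mathrm{tr}(a)\mathrm{tr}(a')$.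 A quadratic algebra over $(K,A_K)$ is a $K$-algebra $R$ with a pseudo-involution extending that of $K$ and a quadratic structure $A_R$ that is an $A_K$-module, with $a(b\cdot r)=(ab)\cdot r$, $(a\cdot k)b=(ab)\cdot k$, $a\phi(r)=\phi(\mathrm{tr}(a)r)$, $\phi(k)b=\phi(k\,\mathrm{tr}(b))$, $\mathrm{tr}(ab)=\mathrm{tr}(a)\mathrm{tr}(b)$ for $a\in A_K$, $b\in A_R$, $k\in K$, $r\in R$. **The space.** Let $(T,A_T)$, $(R,A_R)$ be quadratic algebras over a quadratic ring $(K,A_K)$. Let $P$ be a $T$-$R$-bimodule (with equal left and right $K$-structures), finitely generated projective over $R$, with a biadditive form $B:P\times P\to R$ such that $B(pr,p'r')=\bar rB(p,p')r'$, $B(tp,p')=B(p,\bar tp')$, $B(p,\lambda_Tp')=\overline{B(p',p)}\lambda_R$ and $p\mapsto B(p,-)$ is a bijection $P\to\mathrm{Hom}_R(P,R)$, and with a quadratic form $q:A_T\times P\to A_R$, that is: $q$ is additive and $A_K$-linear in the first variable, $q(a\cdot t,p)=q(a,tp)$, $q(\phi(t),p)=\phi(B(p,tp))$, $q(a,pr)=q(a,p)\cdot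 r$, $q(a,p+p')=q(a,p)+\phi(B(p,\mathrm{tr}(a)p'))+q(a,p')$, $\mathrm{tr}(q(a,p))=B(p,\mathrm{tr}(a)p)$. Let $C$ be the $K$-algebra of bimodule endomorphisms of $P$, with the involution defined by $B(cp,p')=B(p,\bar cp')$, let $GL(P)=C^*$, and let $U(P)\le GL(P)$ be the subgroup preserving $B$ and $q$. Assume that $P=P_0\perp H(P_1)\perp\dots\perp H(P_l)$ with hyperbolic spaces $H(P_i)$; equivalently, there is a complete family of pairwise orthogonal idempotents $e_i\in C$, $-l\le i\le l$, with $P_i=e_iP$, $\bar e_i=e_{-i}$, and $q(A_T,e_iP)=0$ for $i\ne0$. Assume also that for all $i,j\ne0$ the bimodule $P_i$ is isomorphic to a direct summand of $P_j^N$ for some $N$. **Elementary transvections.** Let $\mathcal A=C\times C$ with $\overline{(x,y)}=(\bar y,\bar x)$ and $C\subseteq\mathcal A$ diagonally. Let $\mathcal H=e_0C\times C\times Ce_0$ be the group with $(x,y,z)\dotplus(x',y',z')=(x+x',\,y+zx'+y',\,z+z')$ and the right action $(x,y,z)\cdot(p,s)=(xp,\bar syp,\bar sz)$ of the multiplicative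 monoid of $\mathcal A$; put $\pi(x,y,z)=(x,-\bar z)$, $\phi(x,y)=(0,x-\bar y,0)$, $\mathrm{tr}(x,y,z)=(y,\overline{zx-y})$. For $i,j\ne0$, $i\ne\pm j$, put $\tau_{i,j}(x,y)=1+x-\bar y$ for $(x,y)\in e_i\mathcal Ae_j$, and put $\tau_i(x,y,z)=1+x+y+z$ for $(x,y,z)\in\mathcal H\cdot e_i$. $EU(P)$ is the group generated by all those $\tau_{i,j}(a)$, $\tau_i(h)$ that lie in $U(P)$. Put $\Lambda_i=\{h\in\mathcal H\cdot e_i:\tau_i(h)\in U(P)\}$ for $i\neq 0$, and let $\Lambda\le\mathcal H$ be generated by all $\Lambda_i$ and $\phi(C)\cdot(1-e_0)$. **Levels.** An augmented level $L=(I,\Gamma)$ consists of an additive subgroup $I=\bar I\le\mathcal A$ and a subgroup $\Gamma\le\mathcal H$ such that, with $M=I+K+(1-e_0)C(1-e_0)+\pi(\Lambda)+\overline{\pi(\Lambda)}$, one has $IM\subseteq I$, $\pi(\Gamma)\subseteq I$, $\mathrm{tr}(\Gamma)+\overline{\pi(\Gamma)}\pi(\Gamma)\subseteq I$, $\Gamma\cdot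 M\dotplus\Lambda\cdot I\dotplus\phi(I)\subseteq\Gamma$ and $e_0I(1-e_0)=\pi(\Gamma\cdot(1-e_0))$. Let $E(L)$ be generated by all $\tau_{i,j}(a)$, $a\in e_iIe_j$, and $\tau_i(h)$, $h\in\Gamma\cdot e_i$ (with $i,j\ne0$, $i\ne\pm j$), and let $EU(P,L)$ be the group generated by the $EU(P)$-conjugates of $E(L)$. These groups depend only on $I(1-e_0)$ and $\Gamma\cdot(1-e_0)$; the enveloping level $\widehat L$ is given by $\widehat I(1-e_0)=I(1-e_0)+(1-e_0)C(1-e_0)+\pi(\Lambda)$ and $\widehat\Gamma\cdot(1-e_0)=\Gamma\cdot(1-e_0)\dotplus\Lambda$, and $EU(P,\widehat L)$ is defined in the same way. Let $\alpha(g)=(g,\overline{g^{-1}})$ for $g\in GL(P)$, $\varepsilon=(e_0,\sum_{i>0}e_i,-e_0)\in\mathcal H$, and $$U(P,L)=\{g\in GL(P):\alpha(g)-1\in I,\ \varepsilon\cdot\alpha(g)\mathbin{\dot-}\varepsilon\in\Gamma\},$$ $$GU'(P,L)=\{g\in GL(P): [g,f],[g^{-1},f]\in U(P,L)\text{ for all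 }f\in EU(P,\widehat L)\},$$ $$GU'_{\hat k}(P,L)=\{g\in GU'(P,L): e_k\alpha(g)=e_k\alpha(g)e_k=\alpha(g)e_k\}\qquad(0<|k|\le l),$$ where $[x,y]=xyx^{-1}y^{-1}$. **Proposition.** Suppose that $l\ge3$, $K$ is a local ring, $C$ is a finite $K$-algebra (finitely generated as a $K$-module), and $e_0Ce_0$ is generated by fewer than $4l^2$ elements as a $K$-module. Then for every augmented level $L$ and every $k$ with $0<|k|\le l$, $$GU'(P,L)=EU(P,L)\cdot GU'_{\hat k}(P,L)=\{fg: f\in EU(P,L),\ g\in GU'_{\hat k}(P,L)\}.$$ -/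

import Mathlib

open scoped Pointwise

namespace OddUnitary

/-! ### Pseudo-involutions and quadratic structures -/

/-- A pseudo-involution `r ↦ bar r` on a ring, with symmetry `lam`. -/
class PInv (R : Type*) [Ring R] where
  bar : R → R
  lam : Rˣ
  bar_add : ∀ r r' : R, bar (r + r') = bar r + bar r'
  bar_one : bar 1 = 1
  bar_mul : ∀ r r' : R, bar (r * r') = bar r' * bar r
  bar_bar : ∀ r : R, bar (bar r) = (lam : R) * r * bar (lam : R)

open PInv (bar)

/-- The symmetry of the pseudo-involution, as an element of the ring. -/
def lam (R : Type*) [Ring R] [PInv R] : R := (PInv.lam : Rˣ)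

/-- A quadratic structure `(A, φ, tr)` on a ring `R` with pseudo-involution. The right action of the
multiplicative monoid of `R` on the abelian group `A` is `act`; the monoid acts on `R` itself by
`r · r' = bar r' * r * r'`. -/
class QuadraticStructure (R A : Type*) [Ring R] [PInv R] [AddCommGroup A] where
  act : A → R → A
  phi : R → A
  tr : A → R
  act_one : ∀ a : A, act a 1 = a
  act_mul : ∀ (a : A) (r r' : R), act a (r * r') = act (act a r) r'
  add_act : ∀ (a a' : A) (r : R), act (a + a') r = act a r + act a' r
  phi_add : ∀ r r' : R, phi (r + r') = phi r + phi r'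
  phi_act : ∀ r r' : R, phi (bar r' * r * r') = act (phi r) r'
  tr_add : ∀ a a' : A, tr (a + a') = tr a + tr a'
  tr_act : ∀ (a : A) (r : R), tr (act a r) = bar r * tr a * r
  phi_bar : ∀ r : R, phi r = phi (bar r * lam R)
  tr_phi : ∀ r : R, tr (phi r) = r + bar r * lam R
  tr_eq_bar : ∀ a : A, tr a = bar (tr a) * lam R
  act_add : ∀ (a : A) (r r' : R), act a (r + r') = act a r + phi (bar r' * tr a * r) + act a r'

open QuadraticStructure (act phi tr)

/-- A quadratic ring `(K, A)`: `K` is commutative, its pseudo-involution is an involution, and `A`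
is a commutative ring. -/
class QuadraticRing (K A : Type*) [CommRing K] [PInv K] [CommRing A] [QuadraticStructure K A] :
    Prop where
  lam_eq_one : lam K = 1
  mul_act : ∀ (a a' : A) (k : K), a * act a' k = act (a * a') k
  mul_phi : ∀ (a : A) (k : K), a * phi k = phi (tr a * k)
  tr_one : (tr (1 : A) : K) = 1
  tr_mul : ∀ a a' : A, (tr (a * a') : K) = tr a * tr a'

/-- A quadratic algebra `(R, AR)` over a quadratic ring `(K, AK)`. -/
class QuadraticAlgebra (K AK R AR : Type*) [CommRing K] [PInv K] [CommRing AK]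
    [QuadraticStructure K AK] [Ring R] [PInv R] [AddCommGroup AR] [QuadraticStructure R AR]
    [Algebra K R] [Module AK AR] : Prop where
  bar_algebraMap : ∀ k : K, algebraMap K R (bar k) = bar (algebraMap K R k)
  smul_act : ∀ (a : AK) (b : AR) (r : R), a • act b r = act (a • b) r
  act_smul : ∀ (a : AK) (k : K) (b : AR), act a k • b = act (a • b) (algebraMap K R k)
  smul_phi : ∀ (a : AK) (r : R), a • (phi r : AR) = phi (algebraMap K R (tr a) * r)
  phi_smul : ∀ (k : K) (b : AR), (phi k : AK) • b = phi (algebraMap K R k * tr b)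
  tr_smul : ∀ (a : AK) (b : AR), (tr (a • b) : R) = algebraMap K R (tr a) * tr b

/-! ### Hermitian and quadratic forms on bimodules

A `T`-`R`-bimodule is a left module over `T` and over `Rᵐᵒᵖ` whose two actions commute. -/

/-- A hermitian form on a `T`-`R`-bimodule. -/
structure HermitianForm (T R P : Type*) [Ring T] [PInv T] [Ring R] [PInv R] [AddCommGroup P]
    [Module T P] [Module Rᵐᵒᵖ P] where
  B : P → P → R
  add_left : ∀ m m' n : P, B (m + m') n = B m n + B m' n
  add_right : ∀ m n n' : P, B m (n + n') = B m n + B m n'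
  smul_smul : ∀ (m m' : P) (r r' : R),
    B (MulOpposite.op r • m) (MulOpposite.op r' • m') = bar r * B m m' * r'
  smul_left : ∀ (t : T) (m m' : P), B (t • m) m' = B m (bar t • m')
  hermitian : ∀ m m' : P, B m (lam T • m') = bar (B m' m) * lam R

/-- Nondegeneracy: `P` is finitely generated projective over `R`, and `m ↦ B(m, -)` is a bijection
of `P` onto `Hom_R(P, R)`. -/
structure HermitianForm.Nondegenerate {T R P : Type*} [Ring T] [PInv T] [Ring R] [PInv R]
    [AddCommGroup P] [Module T P] [Module Rᵐᵒᵖ P] (H : HermitianForm T R P) : Prop where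
  finite : Module.Finite Rᵐᵒᵖ P
  projective : Module.Projective Rᵐᵒᵖ P
  bijective : ∀ f : P →ₗ[Rᵐᵒᵖ] R, ∃! m : P, ∀ m' : P, f m' = H.B m m'

/-- A quadratic space over the quadratic `K`-algebras `(T, AT)` and `(R, AR)`: a bimodule with a
nondegenerate hermitian form `B` and a quadratic form `q`. -/
structure QuadraticSpace (K AK T AT R AR P : Type*)
    [CommRing K] [PInv K] [CommRing AK] [QuadraticStructure K AK] [QuadraticRing K AK]
    [Ring T] [PInv T] [AddCommGroup AT] [QuadraticStructure T AT] [Algebra K T] [Module AK AT]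
    [QuadraticAlgebra K AK T AT]
    [Ring R] [PInv R] [AddCommGroup AR] [QuadraticStructure R AR] [Algebra K R] [Module AK AR]
    [QuadraticAlgebra K AK R AR]
    [AddCommGroup P] [Module K P] [Module T P] [Module Rᵐᵒᵖ P] [SMulCommClass T Rᵐᵒᵖ P]
    [IsScalarTower K T P] [IsScalarTower K Rᵐᵒᵖ P]
    extends HermitianForm T R P where
  nondegenerate : toHermitianForm.Nondegenerate
  q : AT → P → AR
  q_add_left : ∀ (a a' : AT) (m : P), q (a + a') m = q a m + q a' m
  q_act_left : ∀ (a : AT) (t : T) (m : P), q (act a t) m = q a (t • m)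
  q_phi : ∀ (t : T) (m : P), q (phi t) m = phi (B m (t • m))
  q_smul : ∀ (a : AT) (m : P) (r : R), q a (MulOpposite.op r • m) = act (q a m) r
  q_add : ∀ (a : AT) (m m' : P),
    q a (m + m') = q a m + phi (B m ((tr a : T) • m')) + q a m'
  tr_q : ∀ (a : AT) (m : P), tr (q a m) = B m ((tr a : T) • m)
  q_smul_left : ∀ (c : AK) (a : AT) (m : P), q (c • a) m = c • q a m

/-- The `K`-algebra `C` of bimodule endomorphisms of `P`: the centralizer of (the image of) `T` in
`End_R(P)`. -/
def bimoduleEnd (K T R P : Type*) [CommRing K] [Ring T] [Ring R] [Algebra K T] [Algebra K R]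
    [AddCommGroup P] [Module K P] [Module T P] [Module Rᵐᵒᵖ P] [SMulCommClass T Rᵐᵒᵖ P]
    [IsScalarTower K T P] [IsScalarTower K Rᵐᵒᵖ P] : Subalgebra K (Module.End Rᵐᵒᵖ P) :=
  Subalgebra.centralizer K
    (Set.range (Module.toModuleEnd (S := T) Rᵐᵒᵖ P : T → Module.End Rᵐᵒᵖ P))

namespace HermitianForm

variable {T R P : Type*} [Ring T] [PInv T] [Ring R] [PInv R]
    [AddCommGroup P] [Module T P] [Module Rᵐᵒᵖ P] {H : HermitianForm T R P}

theorem B_smul_right (H : HermitianForm T R P) (m m' : P) (r : R) :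
    H.B m (MulOpposite.op r • m') = H.B m m' * r := by
  have := H.smul_smul m m' 1 r
  simpa [PInv.bar_one] using this

theorem bar_zero : bar (0 : R) = 0 := by
  have := PInv.bar_add (0 : R) 0
  simpa using this

theorem lam_smul_surj (x : P) : ∃ y : P, lam T • y = x :=
  ⟨((PInv.lam : Tˣ)⁻¹ : Tˣ).val • x, by simp [lam, ← mul_smul]⟩

theorem B_zero_right (H : HermitianForm T R P) (m : P) : H.B m 0 = 0 := by
  have := H.add_right m 0 0
  simpa using this

theorem B_zero_left (H : HermitianForm T R P) (m : P) : H.B 0 m = 0 := by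
  have := H.add_left 0 0 m
  simpa using this

theorem ext_left (hH : H.Nondegenerate) {x y : P} (h : ∀ p, H.B x p = H.B y p) : x = y := by
  let f : P →ₗ[Rᵐᵒᵖ] R :=
    { toFun := fun p => H.B x p
      map_add' := fun p p' => H.add_right _ _ _
      map_smul' := fun r p => by
        have := H.B_smul_right x p r.unop
        simpa using this }
  exact (hH.bijective f).unique (fun _ => rfl) h

theorem ext_right (hH : H.Nondegenerate) {x y : P} (h : ∀ p, H.B p x = H.B p y) : x = y := by
  refine ext_left hH fun p => ?_
  obtain ⟨z, rfl⟩ := lam_smul_surj (T := T) p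
  rw [H.hermitian, H.hermitian, h]

end HermitianForm

namespace QuadraticSpace

variable {K AK T AT R AR P : Type*}
    [CommRing K] [PInv K] [CommRing AK] [QuadraticStructure K AK] [QuadraticRing K AK]
    [Ring T] [PInv T] [AddCommGroup AT] [QuadraticStructure T AT] [Algebra K T] [Module AK AT]
    [QuadraticAlgebra K AK T AT]
    [Ring R] [PInv R] [AddCommGroup AR] [QuadraticStructure R AR] [Algebra K R] [Module AK AR]
    [QuadraticAlgebra K AK R AR]
    [AddCommGroup P] [Module K P] [Module T P] [Module Rᵐᵒᵖ P] [SMulCommClass T Rᵐᵒᵖ P]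
    [IsScalarTower K T P] [IsScalarTower K Rᵐᵒᵖ P]

/-- The algebra `C = End(P)` of bimodule endomorphisms of a quadratic space. It is a type of its
own because its involution depends on the form; its unit group is the general linear group of
`P`. -/
def C (_Q : QuadraticSpace K AK T AT R AR P) : Type _ := bimoduleEnd K T R P

variable (Q : QuadraticSpace K AK T AT R AR P)

instance : Ring Q.C := inferInstanceAs (Ring (bimoduleEnd K T R P))
instance : Algebra K Q.C := inferInstanceAs (Algebra K (bimoduleEnd K T R P))

variable {Q}

/-- The underlying `R`-linear endomorphism of an element of `C`. -/
def C.toEnd (c : Q.C) : Module.End Rᵐᵒᵖ P := Subtype.val (p := (· ∈ bimoduleEnd K T R P)) c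

theorem C.ext {c d : Q.C} (h : ∀ p, c.toEnd p = d.toEnd p) : c = d :=
  Subtype.ext (LinearMap.ext h)

theorem C.map_T (c : Q.C) (t : T) (p : P) : c.toEnd (t • p) = t • c.toEnd p := by
  have h := (Subalgebra.mem_centralizer_iff K).1 c.2 _ ⟨t, rfl⟩
  have h' := congrArg (fun f : Module.End Rᵐᵒᵖ P => f p) h
  exact h'.symm

/-- An `R`-linear endomorphism that commutes with the action of `T`, as an element of `C`. -/
def C.mk (f : Module.End Rᵐᵒᵖ P) (hf : ∀ (t : T) (p : P), f (t • p) = t • f p) : Q.C :=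
  ⟨f, by
    refine (Subalgebra.mem_centralizer_iff K).2 ?_
    rintro _ ⟨t, rfl⟩
    ext p
    exact (hf t p).symm⟩

theorem C.toEnd_mul (c d : Q.C) (p : P) : (c * d).toEnd p = c.toEnd (d.toEnd p) := rfl
theorem C.toEnd_one (p : P) : (1 : Q.C).toEnd p = p := rfl
theorem C.toEnd_add (c d : Q.C) (p : P) : (c + d).toEnd p = c.toEnd p + d.toEnd p := rfl

theorem exists_adjoint (c : Q.C) :
    ∃ d : Q.C, ∀ p p' : P, Q.B (c.toEnd p) p' = Q.B p (d.toEnd p') := by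
  have hnd := Q.nondegenerate
  have key : ∀ p' : P, ∃ x : P, ∀ p, Q.B p' (c.toEnd p) = Q.B x p := fun p' => by
    let f : P →ₗ[Rᵐᵒᵖ] R :=
      { toFun := fun p => Q.B p' (c.toEnd p)
        map_add' := fun p p'' => by simp [Q.add_right]
        map_smul' := fun r p => by
          have := Q.B_smul_right p' (c.toEnd p) r.unop
          simpa using this }
    exact (hnd.bijective f).exists
  choose d hd using key
  let D : Module.End Rᵐᵒᵖ P :=
    { toFun := d
      map_add' := fun p p' => HermitianForm.ext_left hnd fun x => by
        rw [← hd, Q.add_left, Q.add_left, hd, hd]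
      map_smul' := fun r p => HermitianForm.ext_left hnd fun x => by
        have h1 := Q.smul_smul p (c.toEnd x) r.unop 1
        have h2 := Q.smul_smul (d p) x r.unop 1
        simp only [MulOpposite.op_unop, MulOpposite.op_one, one_smul, mul_one] at h1 h2
        rw [← hd, h1, hd]
        exact h2.symm }
  have hDT : ∀ (t : T) (p : P), D (t • p) = t • D p := fun t p =>
    HermitianForm.ext_left hnd fun x => by
      change Q.B (d (t • p)) x = Q.B (t • d p) x
      rw [← hd, Q.smul_left, Q.smul_left, ← C.map_T, hd]
  refine ⟨C.mk D hDT, fun p p' => ?_⟩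
  obtain ⟨y, rfl⟩ := HermitianForm.lam_smul_surj (T := T) p'
  rw [Q.hermitian, hd, ← Q.hermitian, C.map_T]
  rfl

/-- The adjoint of a bimodule endomorphism with respect to `B`. -/
noncomputable def adjoint (c : Q.C) : Q.C := (exists_adjoint c).choose

theorem B_adjoint (c : Q.C) (p p' : P) :
    Q.B (c.toEnd p) p' = Q.B p ((adjoint c).toEnd p') := (exists_adjoint c).choose_spec p p'

theorem adjoint_unique {c d : Q.C} (h : ∀ p p' : P, Q.B (c.toEnd p) p' = Q.B p (d.toEnd p')) :
    adjoint c = d :=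
  C.ext fun p' => HermitianForm.ext_right Q.nondegenerate fun p => by rw [← B_adjoint, h]

/-- The involution of `C`: `star c` is the unique element with `B(c p, p') = B(p, (star c) p')`. -/
noncomputable instance : StarRing Q.C where
  star := adjoint
  star_involutive c := adjoint_unique fun p p' => by
    obtain ⟨y, rfl⟩ := HermitianForm.lam_smul_surj (T := T) p'
    rw [Q.hermitian, ← B_adjoint, ← Q.hermitian, C.map_T]
  star_mul c d := adjoint_unique fun p p' => by
    rw [C.toEnd_mul, C.toEnd_mul, B_adjoint, B_adjoint]
  star_add c d := adjoint_unique fun p p' => by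
    rw [C.toEnd_add, C.toEnd_add, Q.add_left, Q.add_right, B_adjoint, B_adjoint]

variable (Q)

/-- The unitary group: bimodule automorphisms that preserve `B` and `q`. -/
def unitary : Subgroup Q.Cˣ where
  carrier := {g | (∀ p p' : P, Q.B (g.val.toEnd p) (g.val.toEnd p') = Q.B p p') ∧
    ∀ (a : AT) (p : P), Q.q a (g.val.toEnd p) = Q.q a p}
  one_mem' := ⟨fun _ _ => rfl, fun _ _ => rfl⟩
  mul_mem' := by
    rintro g h ⟨hg, hg'⟩ ⟨hh, hh'⟩
    refine ⟨fun p p' => ?_, fun a p => ?_⟩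
    · simp only [Units.val_mul, C.toEnd_mul, hg, hh]
    · simp only [Units.val_mul, C.toEnd_mul, hg', hh']
  inv_mem' := by
    rintro g ⟨hg, hg'⟩
    have key : ∀ p : P, g.val.toEnd ((g⁻¹).val.toEnd p) = p := fun p => by
      rw [← C.toEnd_mul, Units.mul_inv, C.toEnd_one]
    refine ⟨fun p p' => ?_, fun a p => ?_⟩
    · rw [← hg, key, key]
    · rw [← hg', key]

end QuadraticSpace

/-! ### Level groups

`C` is a ring with involution and `F` a family of idempotents `e_i`, `-l ≤ i ≤ l`, in it. -/

/-- A complete family of pairwise orthogonal idempotents `e_i`, `-l ≤ i ≤ l`, with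
`star e_i = e_{-i}`, extended by `e_i = 0` to `|i| > l`. -/
structure Frame (C : Type*) [Ring C] [StarRing C] (l : ℕ) where
  e : ℤ → C
  e_eq_zero : ∀ i : ℤ, (l : ℤ) < |i| → e i = 0
  idem : ∀ i : ℤ, e i * e i = e i
  orth : ∀ i j : ℤ, i ≠ j → e i * e j = 0
  sum_e : ∑ i ∈ Finset.Icc (-(l : ℤ)) l, e i = 1
  star_e : ∀ i : ℤ, star (e i) = e (-i)

section HeisenbergGroup

variable {C : Type*} [Ring C]

/-- The group `ℋ = e₀C × C × Ce₀`, written additively although it is not commutative. -/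
@[ext]
structure Heis (e₀ : C) where
  x : C
  y : C
  z : C
  x_mem : e₀ * x = x
  z_mem : z * e₀ = z

namespace Heis

variable {e₀ : C}

instance : Zero (Heis e₀) := ⟨⟨0, 0, 0, by simp, by simp⟩⟩
instance : Add (Heis e₀) :=
  ⟨fun h h' => ⟨h.x + h'.x, h.y + h.z * h'.x + h'.y, h.z + h'.z,
    by rw [mul_add, h.x_mem, h'.x_mem], by rw [add_mul, h.z_mem, h'.z_mem]⟩⟩
instance : Neg (Heis e₀) :=
  ⟨fun h => ⟨-h.x, h.z * h.x - h.y, -h.z,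
    by rw [mul_neg, h.x_mem], by rw [neg_mul, h.z_mem]⟩⟩

@[simp] theorem zero_x : (0 : Heis e₀).x = 0 := rfl
@[simp] theorem zero_y : (0 : Heis e₀).y = 0 := rfl
@[simp] theorem zero_z : (0 : Heis e₀).z = 0 := rfl
@[simp] theorem add_x (h h' : Heis e₀) : (h + h').x = h.x + h'.x := rfl
@[simp] theorem add_y (h h' : Heis e₀) : (h + h').y = h.y + h.z * h'.x + h'.y := rfl
@[simp] theorem add_z (h h' : Heis e₀) : (h + h').z = h.z + h'.z := rfl
@[simp] theorem neg_x (h : Heis e₀) : (-h).x = -h.x := rfl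
@[simp] theorem neg_y (h : Heis e₀) : (-h).y = h.z * h.x - h.y := rfl
@[simp] theorem neg_z (h : Heis e₀) : (-h).z = -h.z := rfl

instance : AddGroup (Heis e₀) :=
  AddGroup.ofLeftAxioms
    (fun a b c => by ext <;> simp [mul_add, add_mul] <;> abel)
    (fun a => by ext <;> simp)
    (fun a => by ext <;> simp; abel)

end Heis

end HeisenbergGroup

section Double

variable {C : Type*} [Ring C] [StarRing C]

/-- The involution `(x, y) ↦ (star y, star x)` of the ring `𝒜 = C × C`. -/
def dbar : C × C →+ C × C where
  toFun a := (star a.2, star a.1)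
  map_zero' := by simp
  map_add' a b := by simp

/-- The diagonal embedding of `C` into `𝒜 = C × C`. -/
def diag : C →+* C × C := (RingHom.id C).prod (RingHom.id C)

namespace Heis

variable {e₀ : C}

/-- The right action of the multiplicative monoid of `𝒜` on `ℋ`,
`(x, y, z) · (p, q) = (xp, (star q)yp, (star q)z)`; each element acts by an endomorphism. -/
def actBy (a : C × C) : Heis e₀ →+ Heis e₀ where
  toFun h := ⟨h.x * a.1, star a.2 * h.y * a.1, star a.2 * h.z,
    by rw [← mul_assoc, h.x_mem], by rw [mul_assoc, h.z_mem]⟩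
  map_zero' := by ext <;> simp
  map_add' h h' := by ext <;> simp [mul_add, add_mul, mul_assoc]

/-- `π(x, y, z) = (x, -star z)`. -/
def pi : Heis e₀ →+ C × C where
  toFun h := (h.x, -star h.z)
  map_zero' := by simp
  map_add' h h' := by ext <;> simp [add_comm]

/-- `φ(x, y) = (0, x - star y, 0)`. -/
def phi : C × C →+ Heis e₀ where
  toFun a := ⟨0, a.1 - star a.2, 0, by simp, by simp⟩
  map_zero' := by ext <;> simp
  map_add' a b := by ext <;> simp; abel

/-- `tr(x, y, z) = (y, star (zx - y))`. -/
def tr (h : Heis e₀) : C × C := (h.y, star (h.z * h.x - h.y))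

end Heis

/-- `τ_{i,j}(x, y) = 1 + x - star y`, for `(x, y) ∈ e_i 𝒜 e_j`. -/
def tau₂ (a : C × C) : C := 1 + a.1 - star a.2

/-- `τ_i(x, y, z) = 1 + x + y + z`, for `(x, y, z) ∈ ℋ · e_i`. -/
def tau₁ {e₀ : C} (h : Heis e₀) : C := 1 + h.x + h.y + h.z

/-- `α(g) = (g, star (g⁻¹))`. -/
def alpha (g : Cˣ) : C × C := (g.val, star (g⁻¹).val)

variable {l : ℕ} (F : Frame C l)

/-- The group `EU` generated by those elementary transvections that lie in the group `U`. -/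
def elementaryUnitary (U : Subgroup Cˣ) : Subgroup Cˣ :=
  Subgroup.closure {g | g ∈ U ∧
    ((∃ i j : ℤ, i ≠ 0 ∧ j ≠ 0 ∧ i ≠ j ∧ i ≠ -j ∧
        ∃ b : C × C, g.val = tau₂ (diag (F.e i) * b * diag (F.e j))) ∨
      (∃ i : ℤ, i ≠ 0 ∧ ∃ h : Heis (F.e 0), g.val = tau₁ (Heis.actBy (diag (F.e i)) h)))}

/-- `Λ_i`, the set of those `h ∈ ℋ · e_i` for which `τ_i(h)` lies in the group `U`. -/
def lambdaPart (U : Subgroup Cˣ) (i : ℤ) : Set (Heis (F.e 0)) :=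
  {h | (∃ h' : Heis (F.e 0), h = Heis.actBy (diag (F.e i)) h') ∧ ∃ g ∈ U, g.val = tau₁ h}

/-- `Λ`, the sum of all `Λ_i`, `i ≠ 0`, and of `φ(C) · (1 - e₀)`. -/
def lambda (U : Subgroup Cˣ) : AddSubgroup (Heis (F.e 0)) :=
  AddSubgroup.closure ((⋃ i : {i : ℤ // i ≠ 0}, lambdaPart F U i) ∪
    Set.range fun c : C => Heis.actBy (diag (1 - F.e 0)) (Heis.phi (diag c)))

/-- `(1 - e₀) C (1 - e₀)` inside `𝒜`. -/
def bigCorner : AddSubgroup (C × C) :=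
  AddSubgroup.closure (Set.range fun c : C => diag ((1 - F.e 0) * c * (1 - F.e 0)))

/-- `I + K + (1 - e₀)C(1 - e₀) + π(Λ) + star π(Λ)`. -/
def levelCoeff (K : Type*) [CommRing K] [Algebra K C] (U : Subgroup Cˣ)
    (I : AddSubgroup (C × C)) : AddSubgroup (C × C) :=
  I ⊔ (diag.comp (algebraMap K C)).toAddMonoidHom.range ⊔ bigCorner F ⊔
    (lambda F U).map Heis.pi ⊔ ((lambda F U).map Heis.pi).map dbar

/-- Augmented levels `(I, Γ)`. -/
structure AugmentedLevel (K : Type*) [CommRing K] [Algebra K C] (U : Subgroup Cˣ) where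
  I : AddSubgroup (C × C)
  Γ : AddSubgroup (Heis (F.e 0))
  bar_mem : ∀ a ∈ I, dbar a ∈ I
  mul_mem : ∀ a ∈ I, ∀ b ∈ levelCoeff F K U I, a * b ∈ I
  pi_mem : ∀ h ∈ Γ, Heis.pi h ∈ I
  tr_mem : ∀ h ∈ Γ, Heis.tr h ∈ I
  bar_pi_mul_pi_mem : ∀ h ∈ Γ, ∀ h' ∈ Γ, dbar (Heis.pi h) * Heis.pi h' ∈ I
  act_mem : ∀ h ∈ Γ, ∀ b ∈ levelCoeff F K U I, Heis.actBy b h ∈ Γ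
  lambda_act_mem : ∀ h ∈ lambda F U, ∀ a ∈ I, Heis.actBy a h ∈ Γ
  phi_mem : ∀ a ∈ I, Heis.phi a ∈ Γ
  boundary : (fun a => diag (F.e 0) * a * diag (1 - F.e 0)) '' (I : Set (C × C)) =
    (fun h => Heis.pi (Heis.actBy (diag (1 - F.e 0)) h)) '' (Γ : Set (Heis (F.e 0)))

/-- The data that determine a level, that is, a class of augmented levels: the subgroups
`I(1 - e₀)` and `Γ · (1 - e₀)`. -/
structure Level where
  J : AddSubgroup (C × C)
  Δ : AddSubgroup (Heis (F.e 0))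

/-- `E(L)`: generated by `τ_{i,j}(a)` and `τ_i(h)` for `a ∈ e_i I e_j` and `h ∈ Γ · e_i`. -/
def Level.elementary {F : Frame C l} (L : Level F) : Subgroup Cˣ :=
  Subgroup.closure
    ({g | ∃ i j : ℤ, i ≠ 0 ∧ j ≠ 0 ∧ i ≠ j ∧ i ≠ -j ∧
        ∃ b ∈ L.J, g.val = tau₂ (diag (F.e i) * b * diag (F.e j))} ∪
      {g | ∃ i : ℤ, i ≠ 0 ∧ ∃ h ∈ L.Δ, g.val = tau₁ (Heis.actBy (diag (F.e i)) h)})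

/-- The elementary level group `EU(P, L)`: generated by the conjugates of `E(L)` under `EU(P)`. -/
def Level.EU {F : Frame C l} (L : Level F) (U : Subgroup Cˣ) : Subgroup Cˣ :=
  Subgroup.closure {g | ∃ f ∈ elementaryUnitary F U, ∃ h ∈ L.elementary, g = f * h * f⁻¹}

namespace AugmentedLevel

variable {F} {K : Type*} [CommRing K] [Algebra K C] {U : Subgroup Cˣ}

/-- The level of an augmented level. -/
def level (L : AugmentedLevel F K U) : Level F where
  J := L.I.map (AddMonoidHom.mulRight (diag (1 - F.e 0)))
  Δ := L.Γ.map (Heis.actBy (diag (1 - F.e 0)))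

/-- The enveloping level:
`I(1 - e₀) + (1 - e₀)C(1 - e₀) + π(Λ)` and `Γ · (1 - e₀) + Λ`. -/
def envelope (L : AugmentedLevel F K U) : Level F where
  J := L.level.J ⊔ bigCorner F ⊔ (lambda F U).map Heis.pi
  Δ := L.level.Δ ⊔ lambda F U

end AugmentedLevel

/-- `ε = (e₀, e₊, -e₀)`, where `e₊` is the sum of the `e_i` with `i > 0`. -/
noncomputable def epsilon : Heis (F.e 0) where
  x := F.e 0
  y := ∑ i ∈ Finset.Icc (1 : ℤ) l, F.e i
  z := -F.e 0
  x_mem := F.idem 0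
  z_mem := by rw [neg_mul, F.idem 0]

namespace AugmentedLevel

variable {F} {K : Type*} [CommRing K] [Algebra K C] {U : Subgroup Cˣ}

/-- The principal level group `U(P, L)`. -/
def principal (L : AugmentedLevel F K U) : Set Cˣ :=
  {g | alpha g - 1 ∈ L.I ∧ Heis.actBy (alpha g) (epsilon F) - epsilon F ∈ L.Γ}

/-- The elementary level group `EU(P, L)`. -/
def EU (L : AugmentedLevel F K U) : Subgroup Cˣ := L.level.EU U

/-- The set `GU'(P, L)` of all `g` such that the commutators of `g` and `g⁻¹` with the elements of
`EU(P, L̂)` lie in `U(P, L)`. -/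
def GU' (L : AugmentedLevel F K U) : Set Cˣ :=
  {g | ∀ f ∈ L.envelope.EU U, g * f * g⁻¹ * f⁻¹ ∈ L.principal ∧ g⁻¹ * f * g * f⁻¹ ∈ L.principal}

/-- The set of all `g ∈ GU'(P, L)` with `e_k α(g) = e_k α(g) e_k = α(g) e_k`. -/
def GU'hat (L : AugmentedLevel F K U) (k : ℤ) : Set Cˣ :=
  {g | g ∈ L.GU' ∧
    diag (F.e k) * alpha g = diag (F.e k) * alpha g * diag (F.e k) ∧
    diag (F.e k) * alpha g * diag (F.e k) = alpha g * diag (F.e k)}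

end AugmentedLevel

end Double

/-! ### Decompositions with hyperbolic part -/

/-- An orthogonal decomposition `P = P₀ ⊥ H(P₁) ⊥ ⋯ ⊥ H(P_l)`, `P_i = e_i P`, given by the
projections `e_i` onto the summands `P_i`, `-l ≤ i ≤ l`. The adjoint of `e_i` is `e_{-i}`, so
`B` pairs `P_i` with `P_{-i}` perfectly and `P_i` is orthogonal to `P_j` for `j ≠ -i`; and `q`
vanishes on `P_i` for `i ≠ 0`. Moreover all `P_i` with `i ≠ 0` are direct summands of powers of one
another, where a bimodule homomorphism `P_i → P_j` is an element of `e_j C e_i`. -/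
structure QuadraticSpace.Decomposition {K AK T AT R AR P : Type*}
    [CommRing K] [PInv K] [CommRing AK] [QuadraticStructure K AK] [QuadraticRing K AK]
    [Ring T] [PInv T] [AddCommGroup AT] [QuadraticStructure T AT] [Algebra K T] [Module AK AT]
    [QuadraticAlgebra K AK T AT]
    [Ring R] [PInv R] [AddCommGroup AR] [QuadraticStructure R AR] [Algebra K R] [Module AK AR]
    [QuadraticAlgebra K AK R AR]
    [AddCommGroup P] [Module K P] [Module T P] [Module Rᵐᵒᵖ P] [SMulCommClass T Rᵐᵒᵖ P]
    [IsScalarTower K T P] [IsScalarTower K Rᵐᵒᵖ P]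
    (Q : QuadraticSpace K AK T AT R AR P) (l : ℕ) extends Frame Q.C l where
  q_e : ∀ i : ℤ, i ≠ 0 → ∀ (a : AT) (p : P), Q.q a ((e i).toEnd p) = 0
  summand : ∀ i j : ℤ, i ≠ 0 → |i| ≤ l → j ≠ 0 → |j| ≤ l →
    ∃ (N : ℕ) (u v : Fin N → Q.C), (∀ n, u n = e i * u n * e j) ∧ (∀ n, v n = e j * v n * e i) ∧
      ∑ n, u n * v n = e i

end OddUnitary

/-! One inclusion is formal. `EU(P, L)` lies in `U(P, L)`, and `EU(P, L̂)` normalizes `U(P, L)`,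
because both are controlled by the subring of `𝒜` that normalizes the level; hence left
multiplication by `EU(P, L)` preserves `GU'(P, L)` (`mul_mem_GU'`).

For the other inclusion put `a = α(g)`, which is unitary in `𝒜`: `dbar a = a⁻¹`. Since `l ≥ 3`
leaves room for an auxiliary index, membership in `GU'` implies that `a` commutes modulo `I` with
`(1 - e₀)C(1 - e₀)` (`corner_mem_commutesMod`). The `Γ`-part of the same commutators gives `ε · (a b
a⁻¹) ∈ Γ` for `b ∈ e_k C e_k` (`actBy_epsilon_conj_mem`).

Elimination (`exists_mem_GU'hat`): suppose the corners `e_k a e_k` and `e_{-k} a e_{-k}` are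
invertible, and let `u'` be the inverse of the first. The column `a u'` is congruent to `e_k` modulo
`I`, because `a e_k a⁻¹` is, and because in a finite algebra an inverse of an element congruent to
`1` is again congruent to `1` (`inv_sub_one_mem`). The column is isotropic for the form and for `Γ`,
so `E(L)` can reduce it to `e_k` (`IsotropicColumn.exists_clear`). After the same for column `-k`,
the element `a` has the shape required in `GU'_{\hat k}`.

Invertible corners (`exists_cornerInvertible`): units of `C` are detected by finitely many simple
representations `V` coming from the residue algebra (`exists_simpleReps`), and `𝒜` acts on each `V`
through either of its two projections. Among the `f ∈ E(L)` that fix row `-k`, take one that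
maximizes the total rank of `e_k α(fg) e_k`, and rename `fg` to `g`. Let `v ∈ e_k V` be killed by
`e_k a`. If the level acts by zero there, then `v = 0` directly. Otherwise maximality forces all
components of `a v` outside `e₀V` to vanish and `(1 - e₀)I` to kill `a v`. If `v ≠ 0`, commutation
modulo `I` then shows that `a` maps `(1 - e₀)V` into `e₀V`. This contradicts dimensions: `dim (1 -
e₀)V ≥ 2l`, as it contains `2l` nonzero summands, while `(dim e₀V)²` is at most the number of
generators of `e₀Ce₀`, which is less than `4l²`.

Fixing row `-k` is what allows the corners `k` and `-k` to be treated one after the other. -/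

namespace OddUnitary

/-! ### Arithmetic in `𝒜` and in the Heisenberg group. -/

section Diag

variable {C : Type*} [Ring C]

@[simp] theorem diag_fst (c : C) : (diag c).1 = c := rfl
@[simp] theorem diag_snd (c : C) : (diag c).2 = c := rfl

namespace Heis

variable {e₀ : C}

@[simp] theorem sub_x (h h' : Heis e₀) : (h - h').x = h.x - h'.x := by
  rw [sub_eq_add_neg, add_x, neg_x, sub_eq_add_neg]
@[simp] theorem sub_y (h h' : Heis e₀) :
    (h - h').y = h.y - h'.y + (h'.z - h.z) * h'.x := by
  rw [sub_eq_add_neg, add_y, neg_x, neg_y]; noncomm_ring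
@[simp] theorem sub_z (h h' : Heis e₀) : (h - h').z = h.z - h'.z := by
  rw [sub_eq_add_neg, add_z, neg_z, sub_eq_add_neg]

end Heis

end Diag

section DoubleLemmas

variable {C : Type*} [Ring C] [StarRing C]

@[simp] theorem dbar_fst (a : C × C) : (dbar a).1 = star a.2 := rfl
@[simp] theorem dbar_snd (a : C × C) : (dbar a).2 = star a.1 := rfl

theorem dbar_mul (a b : C × C) : dbar (a * b) = dbar b * dbar a := by
  ext <;> simp

@[simp] theorem dbar_dbar (a : C × C) : dbar (dbar a) = a := by
  ext <;> simp

@[simp] theorem dbar_one : dbar (1 : C × C) = 1 := by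
  ext <;> simp

theorem dbar_diag (c : C) : dbar (diag c) = diag (star c) := rfl

namespace Heis

variable {e₀ : C}

@[simp] theorem actBy_x (a : C × C) (h : Heis e₀) : (actBy a h).x = h.x * a.1 := rfl
@[simp] theorem actBy_y (a : C × C) (h : Heis e₀) : (actBy a h).y = star a.2 * h.y * a.1 := rfl
@[simp] theorem actBy_z (a : C × C) (h : Heis e₀) : (actBy a h).z = star a.2 * h.z := rfl
@[simp] theorem pi_fst (h : Heis e₀) : (pi h).1 = h.x := rfl
@[simp] theorem pi_snd (h : Heis e₀) : (pi h).2 = -star h.z := rfl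
@[simp] theorem phi_x (a : C × C) : (phi a : Heis e₀).x = 0 := rfl
@[simp] theorem phi_y (a : C × C) : (phi a : Heis e₀).y = a.1 - star a.2 := rfl
@[simp] theorem phi_z (a : C × C) : (phi a : Heis e₀).z = 0 := rfl
@[simp] theorem tr_fst (h : Heis e₀) : (tr h).1 = h.y := rfl
@[simp] theorem tr_snd (h : Heis e₀) : (tr h).2 = star (h.z * h.x - h.y) := rfl
theorem actBy_mul (a b : C × C) (h : Heis e₀) : actBy (a * b) h = actBy b (actBy a h) := by
  ext <;> simp [mul_assoc]

@[simp] theorem actBy_one (h : Heis e₀) : actBy 1 h = h := by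
  ext <;> simp

/-- The action of `𝒜` is quadratic in the ring element; the cross term below is why levels require
`tr(Γ) ⊆ I` and `φ(I) ⊆ Γ`. -/
theorem actBy_add (a b : C × C) (h : Heis e₀) :
    actBy (a + b) h = actBy a h + phi (dbar b * tr h * a) + actBy b h := by
  ext <;> simp <;> noncomm_ring

theorem pi_actBy (a : C × C) (h : Heis e₀) : pi (actBy a h) = pi h * a := by
  ext <;> simp

theorem tr_actBy (a : C × C) (h : Heis e₀) : tr (actBy a h) = dbar a * tr h * a := by
  ext <;> simp [mul_assoc, mul_sub, sub_mul]

theorem tr_add (h h' : Heis e₀) : tr (h + h') = tr h + tr h' - dbar (pi h) * pi h' := by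
  ext
  · simp; abel
  · simp; noncomm_ring

theorem tr_neg (h : Heis e₀) : tr (-h) = -tr h - dbar (pi h) * pi h := by
  ext <;> simp [sub_eq_add_neg, add_comm]

@[simp] theorem tr_zero : tr (0 : Heis e₀) = 0 := by
  ext <;> simp

theorem actBy_phi (a b : C × C) : actBy b (phi a : Heis e₀) = phi (dbar b * a * b) := by
  ext <;> simp <;> noncomm_ring

theorem tr_phi (a : C × C) : tr (phi a : Heis e₀) = a - dbar a := by
  ext <;> simp

@[simp] theorem pi_phi (a : C × C) : pi (phi a : Heis e₀) = 0 := by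
  ext <;> simp

theorem phi_add_comm (a : C × C) (h : Heis e₀) : phi a + h = h + phi a := by
  ext <;> simp [add_comm]

/-- The image of `φ` is central, and commutators in the Heisenberg group lie in it; conjugation is
therefore translation by a `φ`-term. -/
theorem conj_eq (h h' : Heis e₀) : h + h' - h = h' + phi (-(dbar (pi h) * pi h')) := by
  ext <;> simp <;> noncomm_ring

end Heis

@[simp] theorem alpha_one : alpha (1 : Cˣ) = 1 := by
  ext <;> simp [alpha]

theorem alpha_mul (g h : Cˣ) : alpha (g * h) = alpha g * alpha h := by
  ext <;> simp [alpha]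

theorem dbar_alpha (g : Cˣ) : dbar (alpha g) = alpha g⁻¹ := by
  ext <;> simp [alpha]

@[simp] theorem alpha_mul_alpha_inv (g : Cˣ) : alpha g * alpha g⁻¹ = 1 := by
  rw [← alpha_mul, mul_inv_cancel, alpha_one]

@[simp] theorem alpha_inv_mul_alpha (g : Cˣ) : alpha g⁻¹ * alpha g = 1 := by
  rw [← alpha_mul, inv_mul_cancel, alpha_one]

@[simp] theorem alpha_inv_mul_cancel (g : Cˣ) (x : C × C) : alpha g⁻¹ * (alpha g * x) = x := by
  rw [← mul_assoc, alpha_inv_mul_alpha, one_mul]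

theorem dbar_alpha_inv (g : Cˣ) : dbar (alpha g⁻¹) = alpha g := by
  rw [dbar_alpha, inv_inv]

/-- A unitary element of `𝒜` is determined by its first coordinate, so `α` of a transvection can be
recognized without computing an inverse. -/
theorem alpha_eq {g : Cˣ} {a : C × C} (h1 : a.1 = g.val) (h2 : dbar a * a = 1) :
    alpha g = a := by
  have h3 : star a.2 * g.val = 1 := by
    have := congrArg Prod.fst h2
    simpa [h1] using this
  ext
  · exact h1.symm
  · simp [alpha, Units.inv_eq_of_mul_eq_one_left h3]

theorem exists_alpha_eq {a : C × C} (h1 : a * dbar a = 1) (h2 : dbar a * a = 1) :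
    ∃ g : Cˣ, g.val = a.1 ∧ alpha g = a :=
  ⟨⟨a.1, star a.2, congrArg Prod.fst h1, congrArg Prod.fst h2⟩, rfl, alpha_eq rfl h2⟩

end DoubleLemmas

/-! ### Frames -/

open Heis

namespace Frame

section NoStar

theorem mul_eq_zero {A : Type*} [Ring A] {p q x y : A} (hx : x * p = x) (hy : q * y = y)
    (hpq : p * q = 0) : x * y = 0 := by
  rw [← hx, ← hy, mul_assoc, ← mul_assoc p, hpq, zero_mul, mul_zero]

end NoStar

variable {C : Type*} [Ring C] [StarRing C] {l : ℕ} (F : Frame C l)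

/-- The idempotent `e_i` on the diagonal of the double. -/
def d (i : ℤ) : C × C := diag (F.e i)

/-- The sum of the `e_i` with `i > 0`. -/
noncomputable def pos : C := ∑ i ∈ Finset.Icc (1 : ℤ) l, F.e i

@[simp] theorem d_fst (i : ℤ) : (F.d i).1 = F.e i := rfl
@[simp] theorem d_snd (i : ℤ) : (F.d i).2 = F.e i := rfl

@[simp] theorem d_mul_self (i : ℤ) : F.d i * F.d i = F.d i := by
  rw [d, ← map_mul, F.idem]

theorem d_mul_of_ne {i j : ℤ} (h : i ≠ j) : F.d i * F.d j = 0 := by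
  rw [d, d, ← map_mul, F.orth _ _ h, map_zero]

@[simp] theorem d_mul_cancel (i : ℤ) (x : C × C) : F.d i * (F.d i * x) = F.d i * x := by
  rw [← mul_assoc, d_mul_self]

theorem dbar_d (i : ℤ) : dbar (F.d i) = F.d (-i) := by
  rw [d, dbar_diag, F.star_e, d]

theorem e_mul (i j : ℤ) : F.e i * F.e j = if i = j then F.e i else 0 := by
  split_ifs with h
  · rw [h, F.idem]
  · exact F.orth _ _ h

theorem pos_mul_e (i : ℤ) : F.pos * F.e i = if 0 < i then F.e i else 0 := by
  rw [pos, Finset.sum_mul]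
  simp_rw [e_mul]
  split_ifs with h
  · by_cases h' : i ≤ l
    · rw [Finset.sum_eq_single i]
      · simp
      · intro b _ hb; simp [hb]
      · intro h''; simp only [Finset.mem_Icc] at h''; omega
    · rw [F.e_eq_zero i (by rw [abs_of_pos h]; omega)]
      refine Finset.sum_eq_zero fun j hj => ?_
      simp only [Finset.mem_Icc] at hj
      rw [if_neg (by omega)]
  · refine Finset.sum_eq_zero fun j hj => ?_
    simp only [Finset.mem_Icc] at hj
    rw [if_neg (by omega)]

theorem e_mul_pos (i : ℤ) : F.e i * F.pos = if 0 < i then F.e i else 0 := by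
  rw [pos, Finset.mul_sum]
  simp_rw [e_mul]
  split_ifs with h
  · by_cases h' : i ≤ l
    · rw [Finset.sum_eq_single i]
      · simp
      · intro b _ hb; simp [hb.symm]
      · intro h''; simp only [Finset.mem_Icc] at h''; omega
    · rw [F.e_eq_zero i (by rw [abs_of_pos h]; omega)]
      simp
  · refine Finset.sum_eq_zero fun j hj => ?_
    simp only [Finset.mem_Icc] at hj
    rw [if_neg (by omega)]

theorem star_pos_eq : star F.pos = ∑ i ∈ Finset.Icc (-(l : ℤ)) (-1), F.e i := by
  rw [pos, star_sum]
  simp_rw [F.star_e]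
  refine Finset.sum_nbij' (fun i => -i) (fun i => -i) ?_ ?_ ?_ ?_ ?_ <;>
    simp only [Finset.mem_Icc] <;> intros <;> first | omega | simp

theorem star_pos_add : star F.pos + F.e 0 + F.pos = 1 := by
  have h : Finset.Icc (-(l : ℤ)) l =
      Finset.Icc (-(l : ℤ)) (-1) ∪ ({0} ∪ Finset.Icc (1 : ℤ) l) := by
    ext i; simp only [Finset.mem_Icc, Finset.mem_union, Finset.mem_singleton]; omega
  rw [← F.sum_e, h, Finset.sum_union, Finset.sum_union, star_pos_eq, pos, Finset.sum_singleton,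
    add_assoc]
  · simp
  · rw [Finset.disjoint_left]; intro i
    simp only [Finset.mem_Icc, Finset.mem_union, Finset.mem_singleton]; omega

theorem epsilon_y : (epsilon F).y = F.pos := rfl
@[simp] theorem epsilon_x : (epsilon F).x = F.e 0 := rfl
@[simp] theorem epsilon_z : (epsilon F).z = -F.e 0 := rfl

theorem pi_epsilon : pi (epsilon F) = F.d 0 := by
  ext <;> simp [F.star_e]

/-- `tr ε = (e₊, e₊) - (0, 1)`. -/
theorem tr_epsilon : tr (epsilon F) = diag F.pos - (0, 1) := by
  have h := F.star_pos_add
  ext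
  · simp [epsilon_y]
  · simp only [tr_snd, epsilon_x, epsilon_z, epsilon_y, neg_mul, F.idem, star_sub, star_neg,
      F.star_e, neg_zero, Prod.snd_sub, diag_snd, ← h]
    abel

end Frame

/-! ### Transvections -/

section Transvections

variable {C : Type*} [Ring C] [StarRing C] {l : ℕ} {F : Frame C l}

/-- `m = b - bar b` for `b ∈ e_i 𝒜 e_j`. -/
theorem sub_dbar_mul_self {i j : ℤ} (hij : i ≠ j) {b : C × C} (hi : i ≠ -i) (hj : j ≠ -j)
    (h1 : F.d i * b = b) (h2 : b * F.d j = b) : (b - dbar b) * (b - dbar b) = 0 := by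
  have h3 : F.d (-j) * dbar b = dbar b := by rw [← F.dbar_d, ← dbar_mul, h2]
  have h4 : dbar b * F.d (-i) = dbar b := by rw [← F.dbar_d, ← dbar_mul, h1]
  have e1 : b * b = 0 := Frame.mul_eq_zero h2 h1 (F.d_mul_of_ne hij.symm)
  have e2 : b * dbar b = 0 := Frame.mul_eq_zero h2 h3 (F.d_mul_of_ne hj)
  have e3 : dbar b * b = 0 := Frame.mul_eq_zero h4 h1 (F.d_mul_of_ne hi.symm)
  have e4 : dbar b * dbar b = 0 := Frame.mul_eq_zero h4 h3 (F.d_mul_of_ne (by omega))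
  simp [mul_sub, sub_mul, e1, e2, e3, e4]

/-- The element `b - dbar b` is anti-selfadjoint with square zero, so `1 + (b - dbar b)` is unitary
with inverse `1 - (b - dbar b)`. -/
theorem alpha_tau₂ {i j : ℤ} (hi : i ≠ 0) (hj : j ≠ 0) (hij : i ≠ j) {b : C × C}
    (h1 : F.d i * b = b) (h2 : b * F.d j = b) :
    (∃ g : Cˣ, g.val = tau₂ b) ∧ ∀ g : Cˣ, g.val = tau₂ b → alpha g = 1 + (b - dbar b) := by
  have h := sub_dbar_mul_self hij (by omega) (by omega) h1 h2
  have h3 : dbar (1 + (b - dbar b)) = 1 - (b - dbar b) := by simp; abel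
  have e1 : (1 + (b - dbar b)) * dbar (1 + (b - dbar b)) = 1 := by
    rw [h3, show ∀ m : C × C, (1 + m) * (1 - m) = 1 - m * m by intro m; noncomm_ring, h, sub_zero]
  have e2 : dbar (1 + (b - dbar b)) * (1 + (b - dbar b)) = 1 := by
    rw [h3, show ∀ m : C × C, (1 - m) * (1 + m) = 1 - m * m by intro m; noncomm_ring, h, sub_zero]
  have e3 : (1 + (b - dbar b)).1 = tau₂ b := by simp [tau₂, add_sub_assoc]
  refine ⟨?_, fun g hg => alpha_eq (by rw [hg, e3]) e2⟩
  obtain ⟨g, hg, -⟩ := exists_alpha_eq e1 e2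
  exact ⟨g, by rw [hg, e3]⟩

/-- Of the nine products of the components `x`, `y`, `z` only `zx` can be nonzero. So the inverse of
`1 + x + y + z` is `1 - x + (zx - y) - z`, and the term `zx` is what `tr` records in its second
coordinate. -/
theorem alpha_tau₁ {i : ℤ} (hi : i ≠ 0) {h : Heis (F.e 0)} (h1 : actBy (F.d i) h = h) :
    (∃ g : Cˣ, g.val = tau₁ h) ∧
      ∀ g : Cˣ, g.val = tau₁ h → alpha g = 1 + (pi h + tr h - dbar (pi h)) := by
  have hx : h.x * F.e i = h.x := congrArg Heis.x h1
  have hz : F.e (-i) * h.z = h.z := by simpa [F.star_e] using congrArg Heis.z h1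
  have hy : F.e (-i) * h.y * F.e i = h.y := by simpa [F.star_e] using congrArg Heis.y h1
  have hy1 : F.e (-i) * h.y = h.y := by rw [← hy]; simp [← mul_assoc, F.idem]
  have hy2 : h.y * F.e i = h.y := by rw [← hy]; simp [mul_assoc, F.idem]
  have xx := Frame.mul_eq_zero hx h.x_mem (F.orth _ _ hi)
  have xy := Frame.mul_eq_zero hx hy1 (F.orth i (-i) (by omega))
  have xz := Frame.mul_eq_zero hx hz (F.orth i (-i) (by omega))
  have yx := Frame.mul_eq_zero hy2 h.x_mem (F.orth _ _ hi)
  have yy := Frame.mul_eq_zero hy2 hy1 (F.orth i (-i) (by omega))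
  have yz := Frame.mul_eq_zero hy2 hz (F.orth i (-i) (by omega))
  have zy := Frame.mul_eq_zero h.z_mem hy1 (F.orth 0 (-i) (by omega))
  have zz := Frame.mul_eq_zero h.z_mem hz (F.orth 0 (-i) (by omega))
  set a := 1 + (pi h + tr h - dbar (pi h)) with ha
  have a1 : a.1 = 1 + h.x + h.y + h.z := by simp [ha]; abel
  have a2 : star a.2 = 1 - h.x + (h.z * h.x - h.y) - h.z := by simp [ha]; abel
  have e1 : a.1 * star a.2 = 1 := by
    rw [a1, a2]
    simp [mul_add, add_mul, mul_sub, ← mul_assoc, xx, xy, xz, yx, yy, yz, zy, zz]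
    abel
  have e2 : star a.2 * a.1 = 1 := by
    rw [a1, a2]
    simp [mul_add, add_mul, sub_mul, mul_assoc, xx, xy, xz, yx, yy, yz, zy, zz]
    abel
  have e3 : dbar a * a = 1 := by
    ext
    · simpa using e2
    · simpa using congrArg star e2
  refine ⟨⟨⟨a.1, star a.2, e1, e2⟩, a1⟩, fun g hg => alpha_eq (by rw [hg, a1]; rfl) e3⟩

end Transvections

end OddUnitary

namespace OddUnitary

open Heis

/-! ### The cocycle of `ε` and its values on transvections. -/

section Cocycle

variable {C : Type*} [Ring C] [StarRing C] {l : ℕ} {F : Frame C l}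

variable (F) in
/-- The cocycle `g ↦ ε · α(g) - ε`. -/
noncomputable def coc (g : Cˣ) : Heis (F.e 0) := actBy (alpha g) (epsilon F) - epsilon F

theorem coc_mul (g h : Cˣ) : coc F (g * h) = actBy (alpha h) (coc F g) + coc F h := by
  rw [coc, coc, coc, alpha_mul, actBy_mul, map_sub, sub_add_sub_cancel]

@[simp] theorem coc_one : coc F 1 = 0 := by
  rw [coc, alpha_one, actBy_one, sub_self]

theorem coc_inv (g : Cˣ) : coc F g⁻¹ = -actBy (alpha g⁻¹) (coc F g) := by
  have h := coc_mul (F := F) g g⁻¹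
  rw [mul_inv_cancel, coc_one] at h
  exact (neg_eq_of_add_eq_zero_right h.symm).symm

theorem coc_conj (f g : Cˣ) : coc F (f * g * f⁻¹) =
    actBy (alpha f⁻¹) (actBy (alpha g) (coc F f) + coc F g - coc F f) := by
  rw [coc_mul, coc_mul, coc_inv, map_sub, sub_eq_add_neg]

/-- With `m = b - dbar b`, the outer components vanish as `m` is orthogonal to `e₀` on both sides.
In the middle one, `m e₊` is a sum of some of `b` and `-dbar b`, and each of these annihilates `m`.
-/
theorem actBy_epsilon_eq_zero {i j : ℤ} (hi : i ≠ 0) (hj : j ≠ 0) (hij : i ≠ j) {b : C × C}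
    (h1 : F.d i * b = b) (h2 : b * F.d j = b) : actBy (b - dbar b) (epsilon F) = 0 := by
  have h3 : F.d (-j) * dbar b = dbar b := by rw [← F.dbar_d, ← dbar_mul, h2]
  have h4 : dbar b * F.d (-i) = dbar b := by rw [← F.dbar_d, ← dbar_mul, h1]
  have e0 : F.d 0 * (b - dbar b) = 0 := by
    rw [mul_sub, ← h3]
    nth_rw 1 [← h1]
    rw [← mul_assoc, ← mul_assoc, F.d_mul_of_ne hi.symm, F.d_mul_of_ne (by omega)]
    simp
  have e0' : (b - dbar b) * F.d 0 = 0 := by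
    rw [sub_mul, ← h4]
    nth_rw 1 [← h2]
    rw [mul_assoc, mul_assoc, F.d_mul_of_ne hj, F.d_mul_of_ne (by omega)]
    simp
  have hb : dbar (b - dbar b) = -(b - dbar b) := by simp
  have hs : star (b - dbar b).2 = -(b - dbar b).1 := congrArg Prod.fst hb
  have hm := sub_dbar_mul_self hij (by omega) (by omega) h1 h2
  have pe (x : C) (k : ℤ) (hx : x * F.e k = x) : x * F.pos = if 0 < k then x else 0 := by
    conv_lhs => rw [← hx, mul_assoc, F.e_mul_pos]
    split_ifs <;> simp [hx]
  have p1 := pe b.1 j (congrArg Prod.fst h2)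
  have p2 := pe (dbar b).1 (-i) (congrArg Prod.fst h4)
  have z1 : b.1 * (b - dbar b).1 = 0 := by
    have e1 : b * b = 0 := Frame.mul_eq_zero h2 h1 (F.d_mul_of_ne hij.symm)
    have e2 : b * dbar b = 0 := Frame.mul_eq_zero h2 h3 (F.d_mul_of_ne (by omega))
    have : b * (b - dbar b) = 0 := by rw [mul_sub, e1, e2, sub_zero]
    exact congrArg Prod.fst this
  have z2 : (dbar b).1 * (b - dbar b).1 = 0 := by
    have e1 : dbar b * b = 0 := Frame.mul_eq_zero h4 h1 (F.d_mul_of_ne (by omega))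
    have e2 : dbar b * dbar b = 0 := Frame.mul_eq_zero h4 h3 (F.d_mul_of_ne (by omega))
    have : dbar b * (b - dbar b) = 0 := by rw [mul_sub, e1, e2, sub_zero]
    exact congrArg Prod.fst this
  ext
  · exact congrArg Prod.fst e0
  · rw [actBy_y, hs, F.epsilon_y, Prod.fst_sub, neg_mul, sub_mul, p1, p2, ← Prod.fst_sub]
    split_ifs <;> simp [-dbar_fst, -Prod.fst_sub, sub_mul, z1, z2]
  · rw [actBy_z, hs, F.epsilon_z]
    rw [neg_mul_neg]
    exact congrArg Prod.fst e0'

/-- Splits `tr ε` into its diagonal part, which normalizes every level, and the part `(0, 1)`, which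
need not and is handled by hand. -/
theorem phi_mul_tr_epsilon {m : C × C} (hm : dbar m = -m) :
    (phi (m * tr (epsilon F)) : Heis (F.e 0)) =
      phi (m * diag F.pos) + ⟨0, -m.1, 0, by simp, by simp⟩ := by
  have hs : star m.2 = -m.1 := congrArg Prod.fst hm
  rw [F.tr_epsilon, mul_sub, map_sub]
  ext <;> simp [hs, sub_eq_add_neg]

/-- Since `ε` sees only `e₊`, the value depends on the signs of `i` and `j`: it is zero for opposite
signs and `±φ(b)` for equal signs. -/
theorem coc_tau₂ {i j : ℤ} (hi : i ≠ 0) (hj : j ≠ 0) (hij : i ≠ j) {b : C × C}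
    (h1 : F.d i * b = b) (h2 : b * F.d j = b) {g : Cˣ} (hg : alpha g = 1 + (b - dbar b)) :
    coc F g = 0 ∨ coc F g = phi b ∨ coc F g = -phi b := by
  have hb : dbar (b - dbar b) = -(b - dbar b) := by simp
  have h0 : coc F g = -phi ((b - dbar b) * tr (epsilon F)) := by
    rw [coc, hg, actBy_add, actBy_one, actBy_epsilon_eq_zero hi hj hij h1 h2, add_zero, hb,
      mul_one, neg_mul, map_neg, ← map_neg, ← phi_add_comm, add_sub_cancel_right]
  rw [h0, phi_mul_tr_epsilon hb]
  have h3 : F.d (-j) * dbar b = dbar b := by rw [← F.dbar_d, ← dbar_mul, h2]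
  have h4 : dbar b * F.d (-i) = dbar b := by rw [← F.dbar_d, ← dbar_mul, h1]
  have pe (x : C × C) (k : ℤ) (hx : x * F.d k = x) :
      x * diag F.pos = if 0 < k then x else 0 := by
    have : F.d k * diag F.pos = if 0 < k then F.d k else 0 := by
      rw [Frame.d, ← map_mul, F.e_mul_pos]; split_ifs <;> simp
    conv_lhs => rw [← hx, mul_assoc, this]
    split_ifs <;> simp [hx]
  rw [sub_mul, pe b j h2, pe _ (-i) h4]
  rcases lt_or_gt_of_ne hi with hi' | hi' <;> rcases lt_or_gt_of_ne hj with hj' | hj'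
  · left
    rw [if_neg (by omega), if_pos (by omega)]
    ext <;> simp
  · right; right
    rw [if_pos (by omega), if_pos (by omega)]
    ext <;> simp
  · right; left
    rw [if_neg (by omega), if_neg (by omega)]
    ext <;> simp
  · left
    rw [if_pos (by omega), if_neg (by omega)]
    ext <;> simp

/-- The first value occurs for `i < 0`, the second for `i > 0`. Either way the cocycle stays in any
group that contains `h` and is closed under the operations involved. -/
theorem coc_tau₁ {i : ℤ} (hi : i ≠ 0) {h : Heis (F.e 0)} (h1 : actBy (F.d i) h = h) {g : Cˣ}
    (hg : alpha g = 1 + (pi h + tr h - dbar (pi h))) :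
    coc F g = h ∨ coc F g = actBy (-1) (-h) - phi (pi h) := by
  have hx : h.x * F.e i = h.x := congrArg Heis.x h1
  have hz : F.e (-i) * h.z = h.z := by simpa [F.star_e] using congrArg Heis.z h1
  have hy : F.e (-i) * h.y * F.e i = h.y := by simpa [F.star_e] using congrArg Heis.y h1
  have hy1 : F.e (-i) * h.y = h.y := by rw [← hy]; simp [← mul_assoc, F.idem]
  have hy2 : h.y * F.e i = h.y := by rw [← hy]; simp [mul_assoc, F.idem]
  have a1 : (alpha g).1 = 1 + h.x + h.y + h.z := by simp [hg]; abel
  have a2 : star (alpha g).2 = 1 - h.x + (h.z * h.x - h.y) - h.z := by simp [hg]; abel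
  have x0 : F.e 0 * h.x = h.x := h.x_mem
  have y0 : F.e 0 * h.y = 0 := by rw [← hy1, ← mul_assoc, F.orth _ _ (by omega), zero_mul]
  have z0 : F.e 0 * h.z = 0 := by rw [← hz, ← mul_assoc, F.orth _ _ (by omega), zero_mul]
  have x0' : h.x * F.e 0 = 0 := by rw [← hx, mul_assoc, F.orth _ _ hi, mul_zero]
  have y0' : h.y * F.e 0 = 0 := by rw [← hy2, mul_assoc, F.orth _ _ hi, mul_zero]
  have z0' : h.z * F.e 0 = h.z := h.z_mem
  have pm (x : C) (k : ℤ) (hx : F.e k * x = x) : F.pos * x = if 0 < k then x else 0 := by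
    conv_lhs => rw [← hx, ← mul_assoc, F.pos_mul_e]
    split_ifs <;> simp [hx]
  have mp (x : C) (k : ℤ) (hx : x * F.e k = x) : x * F.pos = if 0 < k then x else 0 := by
    conv_lhs => rw [← hx, mul_assoc, F.e_mul_pos]
    split_ifs <;> simp [hx]
  have px : F.pos * h.x = 0 := by rw [pm _ 0 x0, if_neg (lt_irrefl _)]
  have zp : h.z * F.pos = 0 := by rw [mp _ 0 z0', if_neg (lt_irrefl _)]
  rcases lt_or_gt_of_ne hi with hi' | hi'
  · left
    have e1 := pm _ _ hy1
    have e2 := pm _ _ hz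
    have e3 := mp _ _ hx
    have e4 := mp _ _ hy2
    rw [if_pos (by omega)] at e1 e2
    rw [if_neg (by omega)] at e3 e4
    ext
    · simp [coc, a1, mul_add, x0, y0, z0]
    · simp only [coc, sub_y, actBy_y, actBy_z, F.epsilon_y, F.epsilon_x, F.epsilon_z, a1, a2]
      simp [mul_add, add_mul, sub_mul, mul_assoc, e1, e2, e3, e4, px, zp, F.idem, x0', y0',
        z0']
      abel
    · simp [coc, a2, sub_mul, add_mul, x0', y0', z0', mul_assoc]
  · right
    have e1 := pm _ _ hy1
    have e2 := pm _ _ hz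
    have e3 := mp _ _ hx
    have e4 := mp _ _ hy2
    rw [if_neg (by omega)] at e1 e2
    rw [if_pos (by omega)] at e3 e4
    have xx := Frame.mul_eq_zero hx x0 (F.orth _ _ hi)
    have xy := Frame.mul_eq_zero hx hy1 (F.orth i (-i) (by omega))
    have xz := Frame.mul_eq_zero hx hz (F.orth i (-i) (by omega))
    have yx := Frame.mul_eq_zero hy2 x0 (F.orth _ _ hi)
    have yy := Frame.mul_eq_zero hy2 hy1 (F.orth i (-i) (by omega))
    have yz := Frame.mul_eq_zero hy2 hz (F.orth i (-i) (by omega))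
    ext
    · simp [coc, a1, mul_add, x0, y0, z0]
    · simp only [coc, sub_y, actBy_y, actBy_z, F.epsilon_y, F.epsilon_x, F.epsilon_z, a1, a2]
      simp [mul_add, add_mul, sub_mul, mul_sub, mul_assoc, e1, e2, e3, e4, px, zp, F.idem, x0', y0',
        z0', xx, xy, xz, yx, yy, yz]
      abel
    · simp [coc, a2, sub_mul, add_mul, x0', y0', z0', mul_assoc]

end Cocycle

/-! ### The normalizer of a level -/

namespace AugmentedLevel

variable {C : Type*} [Ring C] [StarRing C] {l : ℕ} {F : Frame C l} {K : Type*} [CommRing K]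
  [Algebra K C] {U : Subgroup Cˣ} (L : AugmentedLevel F K U)

theorem I_le_coeff : L.I ≤ levelCoeff F K U L.I :=
  le_sup_of_le_left (le_sup_of_le_left (le_sup_of_le_left le_sup_left))

theorem algebraMap_mem_coeff (k : K) : diag (algebraMap K C k) ∈ levelCoeff F K U L.I :=
  (le_sup_of_le_left (le_sup_of_le_left (le_sup_of_le_left le_sup_right)) :
    (diag.comp (algebraMap K C)).toAddMonoidHom.range ≤ _) ⟨k, rfl⟩

theorem bigCorner_le_coeff : bigCorner F ≤ levelCoeff F K U L.I :=
  le_sup_of_le_left (le_sup_of_le_left le_sup_right)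

theorem pi_lambda_mem_coeff {h : Heis (F.e 0)} (hh : h ∈ lambda F U) :
    pi h ∈ levelCoeff F K U L.I :=
  (le_sup_of_le_left le_sup_right : (lambda F U).map pi ≤ _) ⟨h, hh, rfl⟩

theorem dbar_pi_lambda_mem_coeff {h : Heis (F.e 0)} (hh : h ∈ lambda F U) :
    dbar (pi h) ∈ levelCoeff F K U L.I :=
  (le_sup_right : ((lambda F U).map pi).map dbar ≤ _) ⟨_, ⟨h, hh, rfl⟩, rfl⟩

theorem one_mem_coeff : 1 ∈ levelCoeff F K U L.I := by
  simpa using L.algebraMap_mem_coeff 1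

theorem algebraMap_mul_mem (k : K) {a : C × C} (ha : a ∈ L.I) :
    diag (algebraMap K C k) * a ∈ L.I := by
  have : diag (algebraMap K C k) * a = a * diag (algebraMap K C k) := by
    ext <;> simp [Algebra.commutes]
  rw [this]
  exact L.mul_mem _ ha _ (L.algebraMap_mem_coeff k)

/-- The ring of those elements that normalize a level. -/
def normalizer : Subring (C × C) where
  carrier := {m | (∀ a ∈ L.I, a * m ∈ L.I) ∧ (∀ a ∈ L.I, m * a ∈ L.I) ∧
    (∀ h ∈ L.Γ, actBy m h ∈ L.Γ) ∧ ∀ h ∈ L.Γ, actBy (dbar m) h ∈ L.Γ}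
  one_mem' := by simp
  mul_mem' := by
    rintro m n ⟨m1, m2, m3, m4⟩ ⟨n1, n2, n3, n4⟩
    refine ⟨fun a ha => ?_, fun a ha => ?_, fun h hh => ?_, fun h hh => ?_⟩
    · rw [← mul_assoc]; exact n1 _ (m1 _ ha)
    · rw [mul_assoc]; exact m2 _ (n2 _ ha)
    · rw [actBy_mul]; exact n3 _ (m3 _ hh)
    · rw [dbar_mul, actBy_mul]; exact m4 _ (n4 _ hh)
  zero_mem' := by
    refine ⟨fun a _ => ?_, fun a _ => ?_, fun h _ => ?_, fun h _ => ?_⟩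
    · rw [mul_zero]; exact L.I.zero_mem
    · rw [zero_mul]; exact L.I.zero_mem
    all_goals
      rw [show actBy _ h = 0 by ext <;> simp]
      exact L.Γ.zero_mem
  add_mem' := by
    rintro m n ⟨m1, m2, m3, m4⟩ ⟨n1, n2, n3, n4⟩
    have dm (m : C × C) (hm : ∀ a ∈ L.I, a * m ∈ L.I) : ∀ a ∈ L.I, dbar m * a ∈ L.I :=
      fun a ha => by
        have := L.bar_mem _ (hm _ (L.bar_mem _ ha))
        rwa [dbar_mul, dbar_dbar] at this
    have md (m : C × C) (hm : ∀ a ∈ L.I, m * a ∈ L.I) : ∀ a ∈ L.I, a * dbar m ∈ L.I :=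
      fun a ha => by
        have := L.bar_mem _ (hm _ (L.bar_mem _ ha))
        rwa [dbar_mul, dbar_dbar] at this
    refine ⟨fun a ha => ?_, fun a ha => ?_, fun h hh => ?_, fun h hh => ?_⟩
    · rw [mul_add]; exact L.I.add_mem (m1 _ ha) (n1 _ ha)
    · rw [add_mul]; exact L.I.add_mem (m2 _ ha) (n2 _ ha)
    -- The cross term of the quadratic action lies in `φ(I)`, since `tr(h) ∈ I` and `I` is stable
    -- under the normalizer on both sides.
    · rw [actBy_add]
      refine L.Γ.add_mem (L.Γ.add_mem (m3 _ hh) (L.phi_mem _ ?_)) (n3 _ hh)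
      exact m1 _ (dm n n1 _ (L.tr_mem _ hh))
    · rw [map_add, actBy_add]
      refine L.Γ.add_mem (L.Γ.add_mem (m4 _ hh) (L.phi_mem _ ?_)) (n4 _ hh)
      rw [dbar_dbar]
      exact md m m2 _ (n2 _ (L.tr_mem _ hh))
  neg_mem' := by
    rintro m ⟨m1, m2, m3, m4⟩
    have h1 : ∀ h ∈ L.Γ, actBy (-1) h ∈ L.Γ := fun h hh =>
      L.act_mem _ hh _ (neg_mem L.one_mem_coeff)
    have h2 (a : C × C) (h : Heis (F.e 0)) : actBy (-a) h = actBy (-1) (actBy a h) := by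
      rw [← actBy_mul, mul_neg_one]
    refine ⟨fun a ha => ?_, fun a ha => ?_, fun h hh => ?_, fun h hh => ?_⟩
    · rw [mul_neg]; exact L.I.neg_mem (m1 _ ha)
    · rw [neg_mul]; exact L.I.neg_mem (m2 _ ha)
    · rw [h2]; exact h1 _ (m3 _ hh)
    · rw [map_neg, h2]; exact h1 _ (m4 _ hh)

variable {L}

theorem mul_normalizer_mem {a m : C × C} (ha : a ∈ L.I) (hm : m ∈ L.normalizer) :
    a * m ∈ L.I := hm.1 a ha

theorem normalizer_mul_mem {a m : C × C} (hm : m ∈ L.normalizer) (ha : a ∈ L.I) :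
    m * a ∈ L.I := hm.2.1 a ha

theorem actBy_mem {h : Heis (F.e 0)} {m : C × C} (hm : m ∈ L.normalizer) (hh : h ∈ L.Γ) :
    actBy m h ∈ L.Γ := hm.2.2.1 h hh

theorem dbar_mem_normalizer {m : C × C} (hm : m ∈ L.normalizer) : dbar m ∈ L.normalizer := by
  refine ⟨fun a ha => ?_, fun a ha => ?_, hm.2.2.2, by simpa using hm.2.2.1⟩
  · have := L.bar_mem _ (hm.2.1 _ (L.bar_mem _ ha))
    rwa [dbar_mul, dbar_dbar] at this
  · have := L.bar_mem _ (hm.1 _ (L.bar_mem _ ha))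
    rwa [dbar_mul, dbar_dbar] at this

theorem mem_normalizer_of_mem_coeff {m : C × C} (h1 : m ∈ levelCoeff F K U L.I)
    (h2 : dbar m ∈ levelCoeff F K U L.I) : m ∈ L.normalizer := by
  refine ⟨fun a ha => L.mul_mem _ ha _ h1, fun a ha => ?_, fun h hh => L.act_mem _ hh _ h1,
    fun h hh => L.act_mem _ hh _ h2⟩
  have := L.bar_mem _ (L.mul_mem _ (L.bar_mem _ ha) _ h2)
  rwa [dbar_mul, dbar_dbar, dbar_dbar] at this

theorem I_le_normalizer {a : C × C} (ha : a ∈ L.I) : a ∈ L.normalizer :=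
  mem_normalizer_of_mem_coeff (L.I_le_coeff ha) (L.I_le_coeff (L.bar_mem _ ha))

theorem corner_mem_normalizer (c : C) :
    diag ((1 - F.e 0) * c * (1 - F.e 0)) ∈ L.normalizer := by
  refine mem_normalizer_of_mem_coeff (L.bigCorner_le_coeff (AddSubgroup.subset_closure ⟨c, rfl⟩))
    (L.bigCorner_le_coeff (AddSubgroup.subset_closure ⟨star c, ?_⟩))
  ext <;> simp [F.star_e, mul_assoc]

theorem diag_mem_normalizer {i j : ℤ} (hi : i ≠ 0) (hj : j ≠ 0) {c : C} (h1 : F.e i * c = c)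
    (h2 : c * F.e j = c) : diag c ∈ L.normalizer := by
  have h3 : F.e 0 * c = 0 := by rw [← h1, ← mul_assoc, F.orth _ _ hi.symm, zero_mul]
  have h4 : c * F.e 0 = 0 := by rw [← h2, mul_assoc, F.orth _ _ hj, mul_zero]
  have := corner_mem_normalizer (L := L) c
  rwa [sub_mul, h3, mul_sub, sub_zero, one_mul, mul_one, h4, sub_zero] at this

theorem d_mem_normalizer (i : ℤ) : F.d i ∈ L.normalizer := by
  by_cases hi : i = 0
  · have h1 := corner_mem_normalizer (L := L) 1
    have h2 := sub_mem (one_mem L.normalizer) h1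
    convert h2 using 1
    rw [hi, Frame.d, mul_one, sub_mul, mul_sub, mul_sub, F.idem]
    simp
  · exact diag_mem_normalizer hi hi (F.idem i) (F.idem i)

theorem one_sub_d_mem_normalizer (i : ℤ) : 1 - F.d i ∈ L.normalizer :=
  sub_mem (one_mem _) (d_mem_normalizer i)

theorem pi_mem_normalizer {h : Heis (F.e 0)} (hh : h ∈ lambda F U) : pi h ∈ L.normalizer :=
  mem_normalizer_of_mem_coeff (L.pi_lambda_mem_coeff hh) (L.dbar_pi_lambda_mem_coeff hh)

variable (L) in
/-- The group of those `h` that carry `I` to `Γ` and have `π(h)` and `tr(h)` in the normalizer. -/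
def heisNormalizer : AddSubgroup (Heis (F.e 0)) where
  carrier := {h | pi h ∈ L.normalizer ∧ tr h ∈ L.normalizer ∧ ∀ a ∈ L.I, actBy a h ∈ L.Γ}
  zero_mem' := by simp
  add_mem' := by
    rintro h h' ⟨h1, h2, h3⟩ ⟨h1', h2', h3'⟩
    refine ⟨?_, ?_, fun a ha => ?_⟩
    · rw [map_add]; exact add_mem h1 h1'
    · rw [tr_add]
      exact sub_mem (add_mem h2 h2') (L.normalizer.mul_mem (dbar_mem_normalizer h1) h1')
    · rw [map_add]; exact add_mem (h3 a ha) (h3' a ha)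
  neg_mem' := by
    rintro h ⟨h1, h2, h3⟩
    refine ⟨?_, ?_, fun a ha => ?_⟩
    · rw [map_neg]; exact neg_mem h1
    · rw [tr_neg]
      exact sub_mem (neg_mem h2) (L.normalizer.mul_mem (dbar_mem_normalizer h1) h1)
    · rw [map_neg]; exact neg_mem (h3 a ha)

theorem Γ_le_heisNormalizer {h : Heis (F.e 0)} (hh : h ∈ L.Γ) : h ∈ L.heisNormalizer :=
  ⟨I_le_normalizer (L.pi_mem _ hh), I_le_normalizer (L.tr_mem _ hh),
    fun _ ha => L.act_mem _ hh _ (L.I_le_coeff ha)⟩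

theorem phi_mem_heisNormalizer {m : C × C} (hm : m ∈ L.normalizer) :
    phi m ∈ L.heisNormalizer := by
  refine ⟨by simp, ?_, fun a ha => ?_⟩
  · rw [tr_phi]; exact sub_mem hm (dbar_mem_normalizer hm)
  · rw [actBy_phi]
    exact L.phi_mem _ (normalizer_mul_mem
      (L.normalizer.mul_mem (dbar_mem_normalizer (I_le_normalizer ha)) hm) ha)

theorem actBy_mem_heisNormalizer {h : Heis (F.e 0)} {m : C × C} (hm : m ∈ L.normalizer)
    (hh : h ∈ L.heisNormalizer) : actBy m h ∈ L.heisNormalizer := by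
  refine ⟨?_, ?_, fun a ha => ?_⟩
  · rw [pi_actBy]; exact L.normalizer.mul_mem hh.1 hm
  · rw [tr_actBy]; exact L.normalizer.mul_mem (L.normalizer.mul_mem (dbar_mem_normalizer hm) hh.2.1) hm
  · rw [← actBy_mul]; exact hh.2.2 _ (normalizer_mul_mem hm ha)

theorem conj_mem {h h' : Heis (F.e 0)} (hh : pi h ∈ L.normalizer) (hh' : h' ∈ L.Γ) :
    h + h' - h ∈ L.Γ := by
  rw [conj_eq]
  exact add_mem hh' (L.phi_mem _ (neg_mem
    (normalizer_mul_mem (dbar_mem_normalizer hh) (L.pi_mem _ hh'))))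

/-! ### Principal level groups -/

variable (L) in
/-- The principal level group as a subgroup. -/
def principalSubgroup : Subgroup Cˣ where
  carrier := L.principal
  one_mem' := by
    refine ⟨?_, ?_⟩
    · rw [alpha_one, sub_self]; exact L.I.zero_mem
    · rw [alpha_one, actBy_one, sub_self]; exact L.Γ.zero_mem
  mul_mem' := by
    rintro g h ⟨g1, g2⟩ ⟨h1, h2⟩
    have hN : alpha h ∈ L.normalizer := by
      simpa using add_mem (I_le_normalizer h1) (one_mem L.normalizer)
    refine ⟨?_, ?_⟩
    · have : alpha (g * h) - 1 = (alpha g - 1) * alpha h + (alpha h - 1) := by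
        rw [alpha_mul]; noncomm_ring
      rw [this]
      exact add_mem (mul_normalizer_mem g1 hN) h1
    · change coc F (g * h) ∈ L.Γ
      rw [coc_mul]
      exact add_mem (actBy_mem hN g2) h2
  inv_mem' := by
    rintro g ⟨g1, g2⟩
    have h1 : alpha g⁻¹ - 1 ∈ L.I := by
      have := L.bar_mem _ g1
      rwa [map_sub, dbar_alpha, dbar_one] at this
    have hN : alpha g⁻¹ ∈ L.normalizer := by
      simpa using add_mem (I_le_normalizer h1) (one_mem L.normalizer)
    refine ⟨h1, ?_⟩
    change coc F g⁻¹ ∈ L.Γ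
    rw [coc_inv]
    exact neg_mem (actBy_mem hN g2)

variable (L) in
/-- A group that normalizes the principal level group. -/
def ambient : Subgroup Cˣ where
  carrier := {g | alpha g ∈ L.normalizer ∧ coc F g ∈ L.heisNormalizer}
  one_mem' := by
    refine ⟨?_, ?_⟩
    · rw [alpha_one]; exact one_mem _
    · rw [coc_one]; exact zero_mem _
  mul_mem' := by
    rintro g h ⟨g1, g2⟩ ⟨h1, h2⟩
    refine ⟨?_, ?_⟩
    · rw [alpha_mul]; exact L.normalizer.mul_mem g1 h1
    · rw [coc_mul]; exact add_mem (actBy_mem_heisNormalizer h1 g2) h2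
  inv_mem' := by
    rintro g ⟨g1, g2⟩
    have h1 : alpha g⁻¹ ∈ L.normalizer := by
      rw [← dbar_alpha]; exact dbar_mem_normalizer g1
    exact ⟨h1, by rw [coc_inv]; exact neg_mem (actBy_mem_heisNormalizer h1 g2)⟩

/-- The `I`-condition is conjugated by a normalizing element. For the `Γ`-condition, the cocycle of
`f g f⁻¹` is, up to the action of `α(f⁻¹)`, a Heisenberg conjugate of terms produced by `α(g) - 1 ∈
I`; these lie in `Γ` by the definition of `heisNormalizer`. -/
theorem principal_conj_mem {f g : Cˣ} (hf : f ∈ L.ambient) (hg : g ∈ L.principalSubgroup) :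
    f * g * f⁻¹ ∈ L.principalSubgroup := by
  have hf' := inv_mem hf
  refine ⟨?_, ?_⟩
  · have : alpha (f * g * f⁻¹) - 1 = alpha f * (alpha g - 1) * alpha f⁻¹ := by
      rw [alpha_mul, alpha_mul, mul_sub, sub_mul, mul_one, alpha_mul_alpha_inv]
    rw [this]
    exact mul_normalizer_mem (normalizer_mul_mem hf.1 hg.1) hf'.1
  · change coc F _ ∈ L.Γ
    rw [coc_conj]
    refine actBy_mem hf'.1 ?_
    obtain ⟨a, ha⟩ : ∃ a, alpha g = 1 + a := ⟨alpha g - 1, by abel⟩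
    have haI : a ∈ L.I := by
      have := hg.1
      rwa [ha, add_sub_cancel_left] at this
    rw [ha, actBy_add, actBy_one, mul_one, add_assoc, add_assoc]
    refine conj_mem hf.2.1 (add_mem (L.phi_mem _ ?_) (add_mem (hf.2.2.2 _ haI) hg.2))
    exact mul_normalizer_mem (L.bar_mem _ haI) hf.2.2.1

end AugmentedLevel

end OddUnitary

namespace OddUnitary

open Heis

namespace AugmentedLevel

variable {C : Type*} [Ring C] [StarRing C] {l : ℕ} {F : Frame C l} {K : Type*} [CommRing K]
  [Algebra K C] {U : Subgroup Cˣ} {L : AugmentedLevel F K U}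

/-! ### Elementary level groups -/

theorem one_sub_mul_d {i : ℤ} (hi : i ≠ 0) : diag (1 - F.e 0) * F.d i = F.d i := by
  rw [Frame.d, ← map_mul, sub_mul, F.orth _ _ hi.symm, sub_zero, one_mul]

theorem d_mul_one_sub {i : ℤ} (hi : i ≠ 0) : F.d i * diag (1 - F.e 0) = F.d i := by
  rw [Frame.d, ← map_mul, mul_sub, F.orth _ _ hi, sub_zero, mul_one]

theorem level_J_le {b : C × C} (hb : b ∈ L.level.J) : b ∈ L.I := by
  obtain ⟨a, ha, rfl⟩ := hb
  have h : diag (1 - F.e 0) ∈ L.normalizer := by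
    have := L.normalizer.sub_mem (one_mem L.normalizer) (d_mem_normalizer (L := L) 0)
    rwa [Frame.d, ← map_one diag, ← map_sub] at this
  exact mul_normalizer_mem ha h

theorem level_Δ_le {h : Heis (F.e 0)} (hh : h ∈ L.level.Δ) : h ∈ L.Γ := by
  obtain ⟨a, ha, rfl⟩ := hh
  refine actBy_mem ?_ ha
  have := L.normalizer.sub_mem (one_mem L.normalizer) (d_mem_normalizer (L := L) 0)
  rwa [Frame.d, ← map_one diag, ← map_sub] at this

theorem mem_level_J {i : ℤ} (hi : i ≠ 0) {b : C × C} (hb : b ∈ L.I) (h : b * F.d i = b) :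
    b ∈ L.level.J := by
  refine ⟨b, hb, ?_⟩
  change b * diag (1 - F.e 0) = b
  rw [← h, mul_assoc, d_mul_one_sub hi]

theorem mem_level_Δ {i : ℤ} (hi : i ≠ 0) {b : Heis (F.e 0)} (hb : b ∈ L.Γ)
    (h : actBy (F.d i) b = b) : b ∈ L.level.Δ := by
  refine ⟨b, hb, ?_⟩
  rw [← h, ← actBy_mul, d_mul_one_sub hi]

theorem exists_elementary_tau₂ {i j : ℤ} (hi : i ≠ 0) (hj : j ≠ 0) (hij : i ≠ j)
    (hij' : i ≠ -j) {b : C × C} (hb : b ∈ L.I) (h1 : F.d i * b = b) (h2 : b * F.d j = b) :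
    ∃ f ∈ L.level.elementary, alpha f = 1 + (b - dbar b) := by
  obtain ⟨⟨f, hf⟩, h3⟩ := alpha_tau₂ hi hj hij h1 h2
  refine ⟨f, Subgroup.subset_closure (Or.inl ⟨i, j, hi, hj, hij, hij', b, mem_level_J hj hb h2, ?_⟩),
    h3 f hf⟩
  change f.val = tau₂ (F.d i * b * F.d j)
  rw [h1, h2, hf]

theorem exists_elementary_tau₁ {i : ℤ} (hi : i ≠ 0) {h : Heis (F.e 0)} (hh : h ∈ L.Γ)
    (h1 : actBy (F.d i) h = h) :
    ∃ f ∈ L.level.elementary, alpha f = 1 + (pi h + tr h - dbar (pi h)) := by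
  obtain ⟨⟨f, hf⟩, h3⟩ := alpha_tau₁ hi h1
  refine ⟨f, Subgroup.subset_closure (Or.inr ⟨i, hi, h, mem_level_Δ hi hh h1, ?_⟩), h3 f hf⟩
  change f.val = tau₁ (actBy (F.d i) h)
  rw [h1, hf]

theorem tau₂_mem_principal {i j : ℤ} (hi : i ≠ 0) (hj : j ≠ 0) (hij : i ≠ j) {b : C × C}
    (hb : b ∈ L.I) (h1 : F.d i * b = b) (h2 : b * F.d j = b) {g : Cˣ} (hg : g.val = tau₂ b) :
    g ∈ L.principalSubgroup := by
  have h3 := (alpha_tau₂ hi hj hij h1 h2).2 g hg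
  refine ⟨?_, ?_⟩
  · rw [h3, add_sub_cancel_left]
    exact sub_mem hb (L.bar_mem _ hb)
  · change coc F g ∈ L.Γ
    rcases coc_tau₂ hi hj hij h1 h2 h3 with h | h | h <;> rw [h]
    · exact zero_mem _
    · exact L.phi_mem _ hb
    · exact neg_mem (L.phi_mem _ hb)

theorem tau₁_mem_principal {i : ℤ} (hi : i ≠ 0) {h : Heis (F.e 0)} (hh : h ∈ L.Γ)
    (h1 : actBy (F.d i) h = h) {g : Cˣ} (hg : g.val = tau₁ h) : g ∈ L.principalSubgroup := by
  have h3 := (alpha_tau₁ hi h1).2 g hg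
  have hp := L.pi_mem _ hh
  refine ⟨?_, ?_⟩
  · rw [h3, add_sub_cancel_left]
    exact sub_mem (add_mem hp (L.tr_mem _ hh)) (L.bar_mem _ hp)
  · change coc F g ∈ L.Γ
    rcases coc_tau₁ hi h1 h3 with h | h <;> rw [h]
    · exact hh
    · exact sub_mem (actBy_mem (neg_mem (one_mem _)) (neg_mem hh)) (L.phi_mem _ hp)

theorem tau₂_mem_ambient {i j : ℤ} (hi : i ≠ 0) (hj : j ≠ 0) (hij : i ≠ j) {b : C × C}
    (hb : b ∈ L.normalizer) (h1 : F.d i * b = b) (h2 : b * F.d j = b) {g : Cˣ}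
    (hg : g.val = tau₂ b) : g ∈ L.ambient := by
  have h3 := (alpha_tau₂ hi hj hij h1 h2).2 g hg
  refine ⟨?_, ?_⟩
  · rw [h3]
    exact add_mem (one_mem _) (sub_mem hb (dbar_mem_normalizer hb))
  · rcases coc_tau₂ hi hj hij h1 h2 h3 with h | h | h <;> rw [h]
    · exact zero_mem _
    · exact phi_mem_heisNormalizer hb
    · exact neg_mem (phi_mem_heisNormalizer hb)

theorem tau₁_mem_ambient {i : ℤ} (hi : i ≠ 0) {h : Heis (F.e 0)} (hh : h ∈ L.heisNormalizer)
    (h1 : actBy (F.d i) h = h) {g : Cˣ} (hg : g.val = tau₁ h) : g ∈ L.ambient := by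
  have h3 := (alpha_tau₁ hi h1).2 g hg
  refine ⟨?_, ?_⟩
  · rw [h3]
    exact add_mem (one_mem _) (sub_mem (add_mem hh.1 hh.2.1) (dbar_mem_normalizer hh.1))
  · rcases coc_tau₁ hi h1 h3 with h | h <;> rw [h]
    · exact hh
    · exact sub_mem (actBy_mem_heisNormalizer (neg_mem (one_mem _)) (neg_mem hh))
        (phi_mem_heisNormalizer hh.1)

theorem alpha_eq_diag (hU : ∀ g ∈ U, star g.val * g.val = 1) {g : Cˣ} (hg : g ∈ U) :
    alpha g = diag g.val :=
  alpha_eq rfl (by rw [dbar_diag, ← map_mul, hU g hg, map_one])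

/-- An isometry `g` has diagonal `α(g)`, and `tr(h)` is the `(-i, i)` block of `α(τ_i(h))`. This
puts `tr(Λ_i)` into the diagonal corner, hence into the normalizer, which the axioms of a level do
not state directly. -/
theorem lambdaPart_eq_diag (hU : ∀ g ∈ U, star g.val * g.val = 1) {i : ℤ} (hi : i ≠ 0)
    {h : Heis (F.e 0)} (hh : h ∈ lambdaPart F U i) :
    F.e (-i) * h.y * F.e i = h.y ∧ tr h = diag h.y := by
  obtain ⟨⟨h', rfl⟩, g, hg, hg'⟩ := hh
  set h := actBy (diag (F.e i)) h' with hdef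
  have h1 : actBy (F.d i) h = h := by rw [hdef, Frame.d, ← actBy_mul, ← map_mul, F.idem]
  have h3 := (alpha_tau₁ hi h1).2 g hg'
  rw [alpha_eq_diag hU hg] at h3
  have hx : h.x * F.e i = h.x := congrArg Heis.x h1
  have hz : F.e (-i) * h.z = h.z := by simpa [F.star_e] using congrArg Heis.z h1
  have hy : F.e (-i) * h.y * F.e i = h.y := by simpa [F.star_e] using congrArg Heis.y h1
  refine ⟨hy, ?_⟩
  have ht : F.d (-i) * tr h * F.d i = tr h := by
    rw [← h1, tr_actBy, F.dbar_d]
    simp [mul_assoc]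
  have hp : F.d (-i) * pi h = 0 := by
    have e : F.d 0 * pi h = pi h := by
      ext
      · simpa using h.x_mem
      · have := congrArg star h.z_mem
        simpa [F.star_e] using this
    rw [← e, ← mul_assoc, F.d_mul_of_ne (by omega), zero_mul]
  have hp' : dbar (pi h) * F.d i = 0 := by
    have := congrArg dbar hp
    rwa [dbar_mul, F.dbar_d, neg_neg, map_zero] at this
  have h4 := congrArg (fun a => F.d (-i) * a * F.d i) h3
  have h5 : F.d (-i) * (1 + (pi h + tr h - dbar (pi h))) * F.d i = tr h := by
    rw [mul_add, mul_sub, mul_add, hp, add_mul, sub_mul, mul_assoc (F.d (-i)) (dbar (pi h)), hp',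
      mul_one, F.d_mul_of_ne (by omega)]
    simp [ht]
  rw [h5] at h4
  have h6 : tr h = diag (F.e (-i) * g.val * F.e i) := by
    rw [← h4]; simp [Frame.d]
  have h7 : h.y = F.e (-i) * g.val * F.e i := congrArg Prod.fst h6
  rw [h6, h7]

theorem lambda_le_heisNormalizer (hU : ∀ g ∈ U, star g.val * g.val = 1) :
    lambda F U ≤ L.heisNormalizer := by
  rw [lambda, AddSubgroup.closure_le]
  intro h hh
  have hmem : h ∈ lambda F U := AddSubgroup.subset_closure hh
  refine ⟨pi_mem_normalizer hmem, ?_, fun a ha => L.lambda_act_mem _ hmem _ ha⟩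
  rcases hh with hh | ⟨c, rfl⟩
  · obtain ⟨⟨i, hi⟩, hh⟩ := Set.mem_iUnion.1 hh
    obtain ⟨h1, h2⟩ := lambdaPart_eq_diag hU hi hh
    rw [h2]
    refine diag_mem_normalizer (i := -i) (j := i) (by omega) hi ?_ ?_
    · rw [← h1, ← mul_assoc, ← mul_assoc, F.idem]
    · rw [← h1, mul_assoc, F.idem]
  · rw [tr_actBy, tr_phi, dbar_diag, dbar_diag, ← map_sub, ← map_mul, ← map_mul, star_sub, star_one,
      F.star_e, neg_zero]
    exact corner_mem_normalizer _

theorem bigCorner_le_normalizer : bigCorner F ≤ L.normalizer.toAddSubgroup := by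
  rw [bigCorner, AddSubgroup.closure_le]
  rintro _ ⟨c, rfl⟩
  exact corner_mem_normalizer c

theorem envelope_J_le : L.envelope.J ≤ L.normalizer.toAddSubgroup := by
  refine sup_le (sup_le (fun b hb => I_le_normalizer (level_J_le hb)) bigCorner_le_normalizer) ?_
  rintro _ ⟨h, hh, rfl⟩
  exact pi_mem_normalizer hh

theorem envelope_Δ_le (hU : ∀ g ∈ U, star g.val * g.val = 1) :
    L.envelope.Δ ≤ L.heisNormalizer :=
  sup_le (fun _ hh => Γ_le_heisNormalizer (level_Δ_le hh)) (lambda_le_heisNormalizer hU)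

theorem elementary_le_principal : L.level.elementary ≤ L.principalSubgroup := by
  rw [Level.elementary, Subgroup.closure_le]
  rintro g (⟨i, j, hi, hj, hij, -, b, hb, hg⟩ | ⟨i, hi, h, hh, hg⟩)
  · change g.val = tau₂ (F.d i * b * F.d j) at hg
    refine tau₂_mem_principal hi hj hij ?_ ?_ ?_ hg
    · exact mul_normalizer_mem (normalizer_mul_mem (d_mem_normalizer i) (level_J_le hb))
        (d_mem_normalizer j)
    · simp [mul_assoc]
    · simp [mul_assoc]
  · change g.val = tau₁ (actBy (F.d i) h) at hg
    refine tau₁_mem_principal hi (actBy_mem (d_mem_normalizer i) (level_Δ_le hh)) ?_ hg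
    rw [← actBy_mul, F.d_mul_self]

theorem envelope_elementary_le_ambient (hU : ∀ g ∈ U, star g.val * g.val = 1) :
    L.envelope.elementary ≤ L.ambient := by
  rw [Level.elementary, Subgroup.closure_le]
  rintro g (⟨i, j, hi, hj, hij, -, b, hb, hg⟩ | ⟨i, hi, h, hh, hg⟩)
  · change g.val = tau₂ (F.d i * b * F.d j) at hg
    refine tau₂_mem_ambient hi hj hij ?_ ?_ ?_ hg
    · exact L.normalizer.mul_mem (L.normalizer.mul_mem (d_mem_normalizer i) (envelope_J_le hb))
        (d_mem_normalizer j)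
    · simp [mul_assoc]
    · simp [mul_assoc]
  · change g.val = tau₁ (actBy (F.d i) h) at hg
    refine tau₁_mem_ambient hi (actBy_mem_heisNormalizer (d_mem_normalizer i)
      (envelope_Δ_le hU hh)) ?_ hg
    rw [← actBy_mul, F.d_mul_self]

theorem diag_mem_envelope_J {i j : ℤ} (hi : i ≠ 0) (hj : j ≠ 0) {c : C} (h1 : F.e i * c = c)
    (h2 : c * F.e j = c) : diag c ∈ L.envelope.J := by
  have h3 : F.e 0 * c = 0 := by rw [← h1, ← mul_assoc, F.orth _ _ hi.symm, zero_mul]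
  have h4 : c * F.e 0 = 0 := by rw [← h2, mul_assoc, F.orth _ _ hj, mul_zero]
  refine (le_sup_of_le_left le_sup_right : bigCorner F ≤ L.envelope.J)
    (AddSubgroup.subset_closure ⟨c, ?_⟩)
  simp only [sub_mul, h3, mul_sub, sub_zero, one_mul, mul_one, h4]

/-- For a transvection `τ_{i,j}(b)` that is an isometry, `α` is diagonal. Its `(i, j)` block is `b`,
so the parameter is itself diagonal and lies in the corner part of the enveloping level. Isometries
`τ_i(h)` come from `Λ_i`. -/
theorem elementaryUnitary_le (hU : ∀ g ∈ U, star g.val * g.val = 1) :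
    elementaryUnitary F U ≤ L.envelope.elementary := by
  rw [elementaryUnitary, Subgroup.closure_le]
  rintro g ⟨hgU, ⟨i, j, hi, hj, hij, hij', b, hg⟩ | ⟨i, hi, h, hg⟩⟩
  · refine Subgroup.subset_closure (Or.inl ⟨i, j, hi, hj, hij, hij',
      diag (F.e i * g.val * F.e j), diag_mem_envelope_J hi hj (by simp [← mul_assoc, F.idem])
        (by simp [mul_assoc, F.idem]), ?_⟩)
    change g.val = tau₂ (F.d i * b * F.d j) at hg
    have h1 : F.d i * (F.d i * b * F.d j) = F.d i * b * F.d j := by simp [mul_assoc]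
    have h2 : F.d i * b * F.d j * F.d j = F.d i * b * F.d j := by simp [mul_assoc]
    have h3 := (alpha_tau₂ hi hj hij h1 h2).2 g hg
    rw [alpha_eq_diag hU hgU] at h3
    set b' := F.d i * b * F.d j with hb'
    have h4 : dbar b' * F.d j = 0 := by
      rw [← h1, dbar_mul, F.dbar_d, mul_assoc, F.d_mul_of_ne (by omega), mul_zero]
    have h5 := congrArg (fun a => F.d i * a * F.d j) h3
    have h6 : F.d i * (1 + (b' - dbar b')) * F.d j = b' := by
      rw [mul_assoc, add_mul, sub_mul, h4, h2, mul_add, one_mul, F.d_mul_of_ne hij, sub_zero, h1,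
        zero_add]
    rw [h6] at h5
    change g.val = tau₂ (F.d i * diag (F.e i * g.val * F.e j) * F.d j)
    have h7 : diag (F.e i * g.val * F.e j) = b' := by rw [← h5]; simp [Frame.d]
    rw [h7, h1, h2, hg]
  · refine Subgroup.subset_closure (Or.inr ⟨i, hi, actBy (diag (F.e i)) h,
      (le_sup_right : lambda F U ≤ L.envelope.Δ) (AddSubgroup.subset_closure (Or.inl
        (Set.mem_iUnion.2 ⟨⟨i, hi⟩, ⟨⟨h, rfl⟩, g, hgU, hg⟩⟩))), ?_⟩)
    rw [← actBy_mul, ← map_mul, F.idem, hg]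

theorem level_elementary_le : L.level.elementary ≤ L.envelope.elementary := by
  refine Subgroup.closure_mono (Set.union_subset_union ?_ ?_)
  · rintro g ⟨i, j, hi, hj, hij, hij', b, hb, hg⟩
    exact ⟨i, j, hi, hj, hij, hij', b, (le_sup_of_le_left le_sup_left : _ ≤ L.envelope.J) hb, hg⟩
  · rintro g ⟨i, hi, h, hh, hg⟩
    exact ⟨i, hi, h, (le_sup_left : _ ≤ L.envelope.Δ) hh, hg⟩

theorem Level.elementary_le_EU (M : Level F) : M.elementary ≤ M.EU U := fun g hg =>
  Subgroup.subset_closure ⟨1, one_mem _, g, hg, by simp⟩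

theorem EU_le_envelope_EU : L.EU ≤ L.envelope.EU U := by
  refine Subgroup.closure_mono ?_
  rintro g ⟨f, hf, h, hh, rfl⟩
  exact ⟨f, hf, h, level_elementary_le hh, rfl⟩

theorem envelope_EU_le_ambient (hU : ∀ g ∈ U, star g.val * g.val = 1) :
    L.envelope.EU U ≤ L.ambient := by
  rw [Level.EU, Subgroup.closure_le]
  rintro g ⟨f, hf, h, hh, rfl⟩
  have hf' := envelope_elementary_le_ambient hU (elementaryUnitary_le (L := L) hU hf)
  exact L.ambient.mul_mem (L.ambient.mul_mem hf' (envelope_elementary_le_ambient hU hh))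
    (inv_mem hf')

theorem EU_le_principal (hU : ∀ g ∈ U, star g.val * g.val = 1) :
    L.EU ≤ L.principalSubgroup := by
  rw [EU, Level.EU, Subgroup.closure_le]
  rintro g ⟨f, hf, h, hh, rfl⟩
  have hf' := envelope_elementary_le_ambient hU (elementaryUnitary_le (L := L) hU hf)
  exact principal_conj_mem hf' (elementary_le_principal hh)

/-- Here `[fg, h] = f[g, h]f⁻¹ · [f, h]`, and `[(fg)⁻¹, h] = [g⁻¹, h'] · [f⁻¹, h]` with `h' =
f⁻¹hf`. All factors are in `U(P, L)`, because `f` is and `EU(P, L̂)` normalizes it. -/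
theorem mul_mem_GU' (hU : ∀ g ∈ U, star g.val * g.val = 1) {f g : Cˣ} (hf : f ∈ L.EU)
    (hg : g ∈ L.GU') : f * g ∈ L.GU' := by
  intro h hh
  have hf1 := envelope_EU_le_ambient hU (EU_le_envelope_EU hf)
  have hh1 := envelope_EU_le_ambient hU hh
  have hfP := EU_le_principal hU hf
  have key (f : Cˣ) (hf : f ∈ L.principalSubgroup) :
      f * h * f⁻¹ * h⁻¹ ∈ L.principalSubgroup := by
    rw [show f * h * f⁻¹ * h⁻¹ = f * (h * f⁻¹ * h⁻¹) by group]
    exact L.principalSubgroup.mul_mem hf (principal_conj_mem hh1 (inv_mem hf))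
  constructor
  · change _ ∈ L.principalSubgroup
    rw [show f * g * h * (f * g)⁻¹ * h⁻¹ =
      f * (g * h * g⁻¹ * h⁻¹) * f⁻¹ * (f * h * f⁻¹ * h⁻¹) by group]
    exact L.principalSubgroup.mul_mem (principal_conj_mem hf1 (hg h hh).1) (key f hfP)
  · change _ ∈ L.principalSubgroup
    have hh' : f⁻¹ * h * f ∈ L.envelope.EU U := by
      have := EU_le_envelope_EU hf
      exact Subgroup.mul_mem _ (Subgroup.mul_mem _ (inv_mem this) hh) this
    rw [show (f * g)⁻¹ * h * (f * g) * h⁻¹ =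
      g⁻¹ * (f⁻¹ * h * f) * g * (f⁻¹ * h * f)⁻¹ * (f⁻¹ * h * f⁻¹⁻¹ * h⁻¹) by group]
    exact L.principalSubgroup.mul_mem (hg _ hh').2 (key f⁻¹ (inv_mem hfP))

end AugmentedLevel

end OddUnitary

/-! ### Commutation with the hyperbolic part modulo a level. -/

namespace OddUnitary

open Heis

/-- All `P_i` with `i ≠ 0` are direct summands of powers of one another. -/
def Frame.Comparable {C : Type*} [Ring C] [StarRing C] {l : ℕ} (F : Frame C l) : Prop :=
  ∀ i j : ℤ, i ≠ 0 → |i| ≤ l → j ≠ 0 → |j| ≤ l →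
    ∃ (N : ℕ) (u v : Fin N → C), (∀ n, u n = F.e i * u n * F.e j) ∧
      (∀ n, v n = F.e j * v n * F.e i) ∧ ∑ n, u n * v n = F.e i

/-- The assumption `l ≥ 3` enters here: three absolute values are available, and at most two are
excluded. -/
theorem exists_third_index {l : ℕ} (hl : 3 ≤ l) (i j : ℤ) :
    ∃ h : ℤ, h ≠ 0 ∧ |h| ≤ l ∧ h ≠ i ∧ h ≠ -i ∧ h ≠ j ∧ h ≠ -j := by
  by_cases h1 : |i| ≠ 1 ∧ |j| ≠ 1
  · exact ⟨1, by norm_num, by rw [abs_one]; omega, by grind, by grind, by grind, by grind⟩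
  · by_cases h2 : |i| ≠ 2 ∧ |j| ≠ 2
    · exact ⟨2, by norm_num, by rw [abs_two]; omega, by grind, by grind, by grind, by grind⟩
    · exact ⟨3, by norm_num, by rw [abs_of_pos (by norm_num)]; omega, by grind, by grind, by grind,
        by grind⟩

namespace AugmentedLevel

variable {C : Type*} [Ring C] [StarRing C] {l : ℕ} {F : Frame C l} {K : Type*} [CommRing K]
  [Algebra K C] {U : Subgroup Cˣ} {L : AugmentedLevel F K U}

theorem diag_pos_mem_normalizer : diag F.pos ∈ L.normalizer := by
  rw [Frame.pos, map_sum]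
  exact sum_mem fun i _ => d_mem_normalizer i

theorem exists_envelope_tau₂ {i j : ℤ} (hi : i ≠ 0) (hj : j ≠ 0) (hij : i ≠ j)
    (hij' : i ≠ -j) {c : C} (h1 : F.e i * c = c) (h2 : c * F.e j = c) :
    ∃ f ∈ L.envelope.EU U, alpha f = 1 + (diag c - dbar (diag c)) ∧
      (coc F f = 0 ∨ coc F f = phi (diag c) ∨ coc F f = -phi (diag c)) := by
  have h1' : F.d i * diag c = diag c := by rw [Frame.d, ← map_mul, h1]
  have h2' : diag c * F.d j = diag c := by rw [Frame.d, ← map_mul, h2]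
  obtain ⟨⟨f, hf⟩, h3⟩ := alpha_tau₂ hi hj hij h1' h2'
  refine ⟨f, Level.elementary_le_EU _ (Subgroup.subset_closure (Or.inl ⟨i, j, hi, hj, hij, hij',
    diag c, diag_mem_envelope_J hi hj h1 h2, ?_⟩)), h3 f hf, coc_tau₂ hi hj hij h1' h2' (h3 f hf)⟩
  change f.val = tau₂ (F.d i * diag c * F.d j)
  rw [h1', h2', hf]

/-- The elements of the normalizer that commute with `α(g)` modulo `I`. -/
def commutesMod (L : AugmentedLevel F K U) (g : Cˣ) : NonUnitalSubring (C × C) where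
  carrier := {m | m ∈ L.normalizer ∧ alpha g * m * alpha g⁻¹ - m ∈ L.I}
  zero_mem' := by simp
  add_mem' := by
    rintro m n ⟨m1, m2⟩ ⟨n1, n2⟩
    refine ⟨add_mem m1 n1, ?_⟩
    convert add_mem m2 n2 using 1
    noncomm_ring
  neg_mem' := by
    rintro m ⟨m1, m2⟩
    refine ⟨neg_mem m1, ?_⟩
    convert neg_mem m2 using 1
    noncomm_ring
  mul_mem' := by
    rintro m n ⟨m1, m2⟩ ⟨n1, n2⟩
    refine ⟨L.normalizer.mul_mem m1 n1, ?_⟩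
    have h : alpha g * (m * n) * alpha g⁻¹ - m * n = (alpha g * m * alpha g⁻¹ - m) *
        (alpha g * n * alpha g⁻¹ - n) + (alpha g * m * alpha g⁻¹ - m) * n +
        m * (alpha g * n * alpha g⁻¹ - n) := by
      have : alpha g * (m * n) * alpha g⁻¹ =
          (alpha g * m * alpha g⁻¹) * (alpha g * n * alpha g⁻¹) := by
        simp [mul_assoc]
      rw [this]; noncomm_ring
    rw [h]
    exact add_mem (add_mem (mul_normalizer_mem m2 (I_le_normalizer n2)) (mul_normalizer_mem m2 n1))
      (normalizer_mul_mem m1 n2)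

/-- This is the `I`-part of the commutator condition for the transvection with `α(f) = 1 + (c - dbar
c)`. -/
theorem sub_dbar_mem_commutesMod (hU : ∀ g ∈ U, star g.val * g.val = 1) {g : Cˣ}
    (hg : g ∈ L.GU') {i j : ℤ} (hi : i ≠ 0) (hj : j ≠ 0) (hij : i ≠ j) (hij' : i ≠ -j) {c : C}
    (h1 : F.e i * c = c) (h2 : c * F.e j = c) :
    diag c - dbar (diag c) ∈ L.commutesMod g := by
  have hc := diag_mem_normalizer (L := L) hi hj h1 h2
  have hm := sub_mem hc (dbar_mem_normalizer hc)
  obtain ⟨f, hf, hfa, -⟩ := exists_envelope_tau₂ (L := L) (U := U) hi hj hij hij' h1 h2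
  refine ⟨hm, ?_⟩
  have hp := (hg f hf).1.1
  have hfN := (envelope_EU_le_ambient hU hf).1
  have h3 := mul_normalizer_mem hp hfN
  convert h3 using 1
  rw [sub_mul, ← alpha_mul, inv_mul_cancel_right, alpha_mul, alpha_mul, hfa]
  simp [mul_add, add_mul]

/-- Commutators control only `c - dbar c`. Factoring `c` through a third index `h` and multiplying
two such differences removes the conjugate terms, since their indices no longer match. A further
factorization reaches `i = ±j`. -/
theorem diag_mem_commutesMod (hl : 3 ≤ l) (hF : F.Comparable)
    (hU : ∀ g ∈ U, star g.val * g.val = 1) {g : Cˣ} (hg : g ∈ L.GU') {i j : ℤ} (hi : i ≠ 0)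
    (hj : j ≠ 0) {c : C} (h1 : F.e i * c = c) (h2 : c * F.e j = c) :
    diag c ∈ L.commutesMod g := by
  have range (i j : ℤ) (c : C) (h1 : F.e i * c = c) (h2 : c * F.e j = c) (hc : c ≠ 0) :
      |i| ≤ l ∧ |j| ≤ l := by
    constructor
    · by_contra h
      exact hc (by rw [← h1, F.e_eq_zero i (by omega), zero_mul])
    · by_contra h
      exact hc (by rw [← h2, F.e_eq_zero j (by omega), mul_zero])
  have key (i j : ℤ) (hi : i ≠ 0) (hj : j ≠ 0) (hij : i ≠ j) (hij' : i ≠ -j) (c : C)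
      (h1 : F.e i * c = c) (h2 : c * F.e j = c) : diag c ∈ L.commutesMod g := by
    by_cases hc : c = 0
    · rw [hc, map_zero]; exact zero_mem _
    obtain ⟨ri, rj⟩ := range i j c h1 h2 hc
    obtain ⟨h, hh, rh, hi1, hi2, hj1, hj2⟩ := exists_third_index hl i j
    obtain ⟨N, u, v, hu, hv, huv⟩ := hF i h hi ri hh rh
    -- Each of the three products involving a conjugate is zero because its inner idempotents are
    -- orthogonal.
    have : diag c = ∑ n, (diag (u n) - dbar (diag (u n))) *
        (diag (v n * c) - dbar (diag (v n * c))) := by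
      have h0 : c = ∑ n, u n * v n * c := by rw [← Finset.sum_mul, huv, h1]
      conv_lhs => rw [h0, map_sum]
      refine Finset.sum_congr rfl fun n _ => ?_
      have e1 : u n * F.e h = u n := by rw [hu n, mul_assoc, F.idem]
      have e2 : F.e i * u n = u n := by rw [hu n, ← mul_assoc, ← mul_assoc, F.idem]
      have e3 : F.e h * v n = v n := by rw [hv n, ← mul_assoc, ← mul_assoc, F.idem]
      have e3 : F.e h * (v n * c) = v n * c := by rw [← mul_assoc, e3]
      have e4 : v n * c * F.e j = v n * c := by rw [mul_assoc, h2]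
      have e5 : star (u n) * F.e (-i) = star (u n) := by rw [← F.star_e, ← star_mul, e2]
      have e6 : F.e (-j) * star (v n * c) = star (v n * c) := by
        rw [← F.star_e, ← star_mul, e4]
      rw [dbar_diag, dbar_diag, ← map_sub, ← map_sub, ← map_mul]
      congr 1
      rw [sub_mul, mul_sub, mul_sub, Frame.mul_eq_zero e1 e6 (F.orth _ _ hj2),
        Frame.mul_eq_zero e5 e3 (F.orth _ _ (by omega)),
        Frame.mul_eq_zero e5 e6 (F.orth _ _ (by omega)), mul_assoc]
      simp
    rw [this]
    refine sum_mem fun n _ => NonUnitalSubring.mul_mem _ ?_ ?_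
    · refine sub_dbar_mem_commutesMod hU hg (i := i) (j := h) hi hh (by omega) (by omega) ?_ ?_
      · rw [hu n, ← mul_assoc, ← mul_assoc, F.idem]
      · rw [hu n, mul_assoc, F.idem]
    · refine sub_dbar_mem_commutesMod hU hg (i := h) (j := j) hh hj (by omega) (by omega) ?_ ?_
      · rw [hv n, ← mul_assoc, ← mul_assoc, ← mul_assoc, F.idem]
      · rw [mul_assoc, h2]
  by_cases hc : c = 0
  · rw [hc, map_zero]; exact zero_mem _
  obtain ⟨ri, rj⟩ := range i j c h1 h2 hc
  obtain ⟨h, hh, rh, hi1, hi2, hj1, hj2⟩ := exists_third_index hl i j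
  obtain ⟨N, u, v, hu, hv, huv⟩ := hF i h hi ri hh rh
  rw [← h1, ← huv, Finset.sum_mul, map_sum]
  refine sum_mem fun n _ => ?_
  rw [mul_assoc, map_mul]
  refine NonUnitalSubring.mul_mem _ (key i h hi hh (by omega) (by omega) _ ?_ ?_)
    (key h j hh hj (by omega) (by omega) _ ?_ ?_)
  · rw [hu n, ← mul_assoc, ← mul_assoc, F.idem]
  · rw [hu n, mul_assoc, F.idem]
  · rw [hv n, ← mul_assoc, ← mul_assoc, ← mul_assoc, F.idem]
  · rw [mul_assoc, h2]

theorem corner_mem_commutesMod (hl : 3 ≤ l) (hF : F.Comparable)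
    (hU : ∀ g ∈ U, star g.val * g.val = 1) {g : Cˣ} (hg : g ∈ L.GU') {c : C}
    (h1 : F.e 0 * c = 0) (h2 : c * F.e 0 = 0) : diag c ∈ L.commutesMod g := by
  have hc : c = ∑ i ∈ Finset.Icc (-(l : ℤ)) l, ∑ j ∈ Finset.Icc (-(l : ℤ)) l,
      F.e i * c * F.e j := by
    simp_rw [← Finset.mul_sum, F.sum_e, mul_one, ← Finset.sum_mul, F.sum_e, one_mul]
  rw [hc, map_sum]
  refine sum_mem fun i _ => ?_
  rw [map_sum]
  refine sum_mem fun j _ => ?_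
  by_cases hi : i = 0
  · rw [hi, h1, zero_mul, map_zero]; exact zero_mem _
  by_cases hj : j = 0
  · rw [hj, mul_assoc, h2, mul_zero, map_zero]; exact zero_mem _
  refine diag_mem_commutesMod hl hF hU hg hi hj ?_ ?_
  · rw [← mul_assoc, ← mul_assoc, F.idem]
  · rw [mul_assoc, F.idem]

/-- Compares the cocycles of `f` and `g f g⁻¹`. They differ by an element of `Γ`, and since `ε · m =
0`, what remains after discarding `φ`-terms from `I` is a Heisenberg conjugate of `ε · (α(g) m
α(g)⁻¹)`. -/
theorem actBy_epsilon_sub_dbar_mem (hl : 3 ≤ l) (hF : F.Comparable)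
    (hU : ∀ g ∈ U, star g.val * g.val = 1) {g : Cˣ} (hg : g ∈ L.GU') {i j : ℤ} (hi : i ≠ 0)
    (hj : j ≠ 0) (hij : i ≠ j) (hij' : i ≠ -j) {c : C} (h1 : F.e i * c = c)
    (h2 : c * F.e j = c) :
    actBy (alpha g * (diag c - dbar (diag c)) * alpha g⁻¹) (epsilon F) ∈ L.Γ := by
  obtain ⟨f, hf, hfa, -⟩ := exists_envelope_tau₂ (L := L) (U := U) hi hj hij hij' h1 h2
  have h1' : F.d i * diag c = diag c := by rw [Frame.d, ← map_mul, h1]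
  have h2' : diag c * F.d j = diag c := by rw [Frame.d, ← map_mul, h2]
  set m := diag c - dbar (diag c) with hm
  set m' := alpha g * m * alpha g⁻¹ with hm'
  set ι := alpha g * diag c * alpha g⁻¹ - diag c with hι
  have hιI : ι ∈ L.I := (diag_mem_commutesMod hl hF hU hg hi hj h1 h2).2
  have hκ : m' - m = ι - dbar ι := by
    rw [hm', hm, hι, map_sub, dbar_mul, dbar_mul, dbar_alpha_inv, dbar_alpha]
    noncomm_ring
  have hκI : m' - m ∈ L.I := by rw [hκ]; exact sub_mem hιI (L.bar_mem _ hιI)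
  have hmb : dbar m = -m := by rw [hm]; simp
  have hmb' : dbar m' = -m' := by
    rw [hm', dbar_mul, dbar_mul, dbar_alpha_inv, dbar_alpha, hmb]; simp [mul_assoc]
  have hm0 : actBy m (epsilon F) = 0 := actBy_epsilon_eq_zero hi hj hij h1' h2'
  have e1 : coc F f = -phi (m * tr (epsilon F)) := by
    rw [coc, hfa, actBy_add, actBy_one, hm0, add_zero, hmb, mul_one, neg_mul, map_neg, ← map_neg,
      ← phi_add_comm, add_sub_cancel_right]
  have e2 : coc F (g * f * g⁻¹) =
      -phi (m' * tr (epsilon F)) + (epsilon F + actBy m' (epsilon F) - epsilon F) := by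
    have : alpha (g * f * g⁻¹) = 1 + m' := by
      rw [alpha_mul, alpha_mul, hfa, hm']; simp [mul_add, add_mul]
    rw [coc, this, actBy_add, actBy_one, hmb', mul_one, neg_mul, map_neg, ← map_neg,
      ← phi_add_comm, add_assoc, add_sub_assoc]
  have e3 : coc F (g * f * g⁻¹) - coc F f ∈ L.Γ := by
    have h3 : g * f * g⁻¹ = g * f * g⁻¹ * f⁻¹ * f := by group
    rw [h3, coc_mul, add_sub_cancel_right]
    exact actBy_mem (envelope_EU_le_ambient hU hf).1 (hg f hf).1.2
  -- The summand `(0, 1)` of `tr ε` contributes `-φ(ι)`; this is where `m' - m` must have the form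
  -- `ι - dbar ι` with `ι` in `I`.
  have e4 : (phi ((m' - m) * tr (epsilon F)) : Heis (F.e 0)) ∈ L.Γ := by
    rw [phi_mul_tr_epsilon (by rw [map_sub, hmb, hmb']; abel)]
    have h5 : (⟨0, -(m' - m).1, 0, by simp, by simp⟩ : Heis (F.e 0)) = -phi ι := by
      rw [hκ]; ext <;> simp
    rw [h5]
    exact add_mem (L.phi_mem _ (mul_normalizer_mem hκI diag_pos_mem_normalizer))
      (neg_mem (L.phi_mem _ hιI))
  have e5 : epsilon F + actBy m' (epsilon F) - epsilon F ∈ L.Γ := by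
    have h5 := add_mem e4 e3
    rw [e1, e2, ← map_neg, ← map_neg] at h5
    have h6 : epsilon F + actBy m' (epsilon F) - epsilon F =
        phi ((m' - m) * tr (epsilon F)) + (phi (-(m' * tr (epsilon F))) +
        (epsilon F + actBy m' (epsilon F) - epsilon F) - phi (-(m * tr (epsilon F)))) := by
      generalize epsilon F + actBy m' (epsilon F) - epsilon F = h
      have h7 (p q : C × C) : h = phi p + (phi q + h - phi (p + q)) := by
        ext <;> simp
        abel
      convert h7 _ _ using 5
      noncomm_ring
    rw [h6]; exact h5
  rw [conj_eq, F.pi_epsilon, pi_actBy, F.pi_epsilon, F.dbar_d, neg_zero] at e5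
  have e6 : F.d 0 * (F.d 0 * m') ∈ L.I := by
    have h0 : F.d 0 * m = 0 := by
      have := congrArg pi hm0
      rwa [pi_actBy, F.pi_epsilon, map_zero] at this
    rw [F.d_mul_cancel, ← sub_zero (F.d 0 * m'), ← h0, ← mul_sub]
    exact normalizer_mul_mem (d_mem_normalizer 0) hκI
  have := sub_mem e5 (L.phi_mem _ (neg_mem e6))
  rwa [add_sub_cancel_right] at this

/-- Write `b = ∑ u_n v_n b` through an index `j ≠ ±k`. Each `u_n v_n b` equals `(u_n - star u_n) v_n
b`, so the previous case applies. The sum is taken term by term, because the action is only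
quadratic. -/
theorem actBy_epsilon_conj_mem (hl : 3 ≤ l) (hF : F.Comparable)
    (hU : ∀ g ∈ U, star g.val * g.val = 1) {g : Cˣ} (hg : g ∈ L.GU') {k : ℤ} (hk : k ≠ 0) {b : C}
    (h1 : F.e k * b = b) (h2 : b * F.e k = b) :
    actBy (alpha g * diag b * alpha g⁻¹) (epsilon F) ∈ L.Γ := by
  by_cases hkl : |k| ≤ l
  swap
  · have : b = 0 := by rw [← h1, F.e_eq_zero k (by omega), zero_mul]
    rw [this]
    convert zero_mem L.Γ
    ext <;> simp
  obtain ⟨j, hj, rj, hkj, hkj', -⟩ := exists_third_index hl k k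
  obtain ⟨N, u, v, hu, hv, huv⟩ := hF k j hk hkl hj rj
  have one (n : Fin N) : actBy (alpha g * diag (u n * (v n * b)) * alpha g⁻¹) (epsilon F) ∈ L.Γ := by
    have hu1 : F.e k * u n = u n := by rw [hu n, ← mul_assoc, ← mul_assoc, F.idem]
    have hu2 : u n * F.e j = u n := by rw [hu n, mul_assoc, F.idem]
    have hv1 : F.e j * (v n * b) = v n * b := by
      rw [hv n, ← mul_assoc, ← mul_assoc, ← mul_assoc, F.idem]
    have hv2 : v n * b * F.e k = v n * b := by rw [mul_assoc, h2]
    have h3 := actBy_epsilon_sub_dbar_mem hl hF hU hg hk hj (by omega) (by omega) hu1 hu2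
    have h4 := diag_mem_commutesMod hl hF hU hg hj hk hv1 hv2
    have h5 : alpha g * diag (v n * b) * alpha g⁻¹ ∈ L.normalizer := by
      simpa using add_mem (I_le_normalizer h4.2) h4.1
    have h6 := actBy_mem h5 h3
    rw [← actBy_mul] at h6
    convert h6 using 2
    have h7 : star (u n) * (v n * b) = 0 := by
      refine Frame.mul_eq_zero (p := F.e (-k)) (q := F.e j) ?_ hv1 (F.orth _ _ (by omega))
      rw [← F.star_e, ← star_mul, hu1]
    have h8 : diag (u n * (v n * b)) = (diag (u n) - dbar (diag (u n))) * diag (v n * b) := by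
      rw [dbar_diag, sub_mul, ← map_mul, ← map_mul, h7, map_zero, sub_zero]
    rw [h8]
    simp [mul_assoc]
  have conj_mem (b : C) (h1 : F.e k * b = b) (h2 : b * F.e k = b) :
      alpha g * diag b * alpha g⁻¹ - diag b ∈ L.I ∧ diag b ∈ L.normalizer :=
    (diag_mem_commutesMod hl hF hU hg hk hk h1 h2).symm
  have add (b b' : C) (h1 : F.e k * b = b) (h2 : b * F.e k = b) (h1' : F.e k * b' = b')
      (h2' : b' * F.e k = b') (hb : actBy (alpha g * diag b * alpha g⁻¹) (epsilon F) ∈ L.Γ)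
      (hb' : actBy (alpha g * diag b' * alpha g⁻¹) (epsilon F) ∈ L.Γ) :
      actBy (alpha g * diag (b + b') * alpha g⁻¹) (epsilon F) ∈ L.Γ := by
    obtain ⟨hι, hbN⟩ := conj_mem b h1 h2
    obtain ⟨hι', hbN'⟩ := conj_mem b' h1' h2'
    rw [map_add, mul_add, add_mul, actBy_add]
    refine add_mem (add_mem hb (L.phi_mem _ ?_)) hb'
    set x := alpha g * diag b * alpha g⁻¹ with hx
    set x' := alpha g * diag b' * alpha g⁻¹ with hx'
    have e0 : star b' * F.e (-k) = star b' := by rw [← F.star_e, ← star_mul, h1']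
    have e1 : dbar x' * x = 0 := by
      have : star b' * b = 0 := Frame.mul_eq_zero e0 h1 (F.orth _ _ (by omega))
      have : diag (star b') * diag b = 0 := by rw [← map_mul, this, map_zero]
      rw [hx, hx', dbar_mul, dbar_mul, dbar_alpha_inv, dbar_alpha, dbar_diag]
      simp [mul_assoc, ← mul_assoc (diag (star b')), this]
    have e2 : dbar x' * tr (epsilon F) * x = dbar x' * diag F.pos * x := by
      -- The element `(0, 1)` is central in `𝒜`, so this summand of `tr ε` is killed by `dbar x' * x
      -- = 0`.
      have h0 : dbar x' * (0, 1) * x = 0 := by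
        have h9 : dbar x' * (0, 1) = (0, 1) * dbar x' := by ext <;> simp
        rw [h9, mul_assoc, e1, mul_zero]
      rw [F.tr_epsilon, mul_sub, sub_mul, h0, sub_zero]
    rw [e2]
    obtain ⟨y, hy⟩ : ∃ y, x = diag b + y := ⟨x - diag b, by abel⟩
    obtain ⟨y', hy'⟩ : ∃ y', x' = diag b' + y' := ⟨x' - diag b', by abel⟩
    rw [hy, add_sub_cancel_left] at hι
    rw [hy', add_sub_cancel_left] at hι'
    have e3 : dbar (diag b') * diag F.pos * diag b = 0 := by
      rw [dbar_diag, ← map_mul, ← map_mul, mul_assoc]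
      have h9 : star b' * (F.pos * b) = 0 := by
        rw [← h1, ← mul_assoc F.pos, F.pos_mul_e, ← e0]
        split_ifs
        · rw [mul_assoc, ← mul_assoc (F.e (-k)), F.orth _ _ (by omega), zero_mul, mul_zero]
        · simp
      rw [h9, map_zero]
    have hp := diag_pos_mem_normalizer (L := L)
    rw [hy, hy', map_add, mul_add, add_mul, add_mul, add_mul, e3, zero_add]
    refine add_mem ?_ (add_mem ?_ ?_)
    · exact mul_normalizer_mem (mul_normalizer_mem (L.bar_mem _ hι') hp) hbN
    · exact normalizer_mul_mem (L.normalizer.mul_mem (dbar_mem_normalizer hbN') hp) hι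
    · exact mul_normalizer_mem (mul_normalizer_mem (L.bar_mem _ hι') hp) (I_le_normalizer hι)
  have hb : b = ∑ n, u n * (v n * b) := by
    simp_rw [← mul_assoc]
    rw [← Finset.sum_mul, huv, h1]
  rw [hb]
  have hs1 (s : Finset (Fin N)) :
      F.e k * (∑ n ∈ s, u n * (v n * b)) = ∑ n ∈ s, u n * (v n * b) := by
    rw [Finset.mul_sum]
    refine Finset.sum_congr rfl fun n _ => ?_
    rw [← mul_assoc, show F.e k * u n = u n by rw [hu n, ← mul_assoc, ← mul_assoc, F.idem]]
  have hs2 (s : Finset (Fin N)) :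
      (∑ n ∈ s, u n * (v n * b)) * F.e k = ∑ n ∈ s, u n * (v n * b) := by
    rw [Finset.sum_mul]
    refine Finset.sum_congr rfl fun n _ => ?_
    rw [mul_assoc, mul_assoc, h2]
  generalize (Finset.univ : Finset (Fin N)) = s
  induction s using Finset.induction_on with
  | empty =>
    convert zero_mem L.Γ
    ext <;> simp
  | insert n s hn ih =>
    rw [Finset.sum_insert hn]
    refine add _ _ ?_ ?_ (hs1 s) (hs2 s) (one n) ih
    · simpa using hs1 {n}
    · simpa using hs2 {n}

end AugmentedLevel

end OddUnitary

/-! ### Inverses modulo a level, in a finite algebra. -/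

namespace OddUnitary

open Heis

/-- The inverse of a unit that is integral over `K` is a polynomial in the unit. -/
theorem inv_mem_of_isIntegral {K A : Type*} [CommRing K] [Ring A] [Algebra K A]
    {S : Subalgebra K A} {r t : A} (hr : r ∈ S) (hrt : r * t = 1) (htr : t * r = 1)
    (ht : IsIntegral K t) : t ∈ S := by
  obtain ⟨p, hp, hpt⟩ := ht
  rw [← Polynomial.aeval_def, Polynomial.aeval_eq_sum_range, Finset.sum_range_succ,
    hp.coeff_natDegree, one_smul] at hpt
  have hc : Commute t r := htr.trans hrt.symm
  have hpow (n : ℕ) : t ^ n * r ^ n = 1 := by rw [← hc.mul_pow, htr, one_pow]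
  rcases Nat.eq_zero_or_pos p.natDegree with h0 | h0
  · rw [h0] at hpt
    simp only [Finset.range_zero, Finset.sum_empty, pow_zero, zero_add] at hpt
    rw [← one_mul t, hpt, zero_mul]
    exact S.zero_mem
  obtain ⟨n, hn⟩ : ∃ n, p.natDegree = n + 1 := ⟨p.natDegree - 1, by omega⟩
  rw [hn] at hpt
  -- The integral equation of degree `n + 1` for `t`, multiplied by `r ^ n`.
  have h1 : t = -∑ i ∈ Finset.range (n + 1), p.coeff i • r ^ (n - i) := by
    have h2 := congrArg (· * r ^ n) hpt
    simp only [add_mul, Finset.sum_mul, zero_mul] at h2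
    have h3 : t ^ (n + 1) * r ^ n = t := by rw [pow_succ', mul_assoc, hpow, mul_one]
    have h4 : ∀ i ∈ Finset.range (n + 1),
        p.coeff i • t ^ i * r ^ n = p.coeff i • r ^ (n - i) := by
      intro i hi
      have : r ^ n = r ^ i * r ^ (n - i) := by
        rw [← pow_add]; congr 1; have := Finset.mem_range.1 hi; omega
      rw [this, smul_mul_assoc, ← mul_assoc, hpow, one_mul]
    rw [h3, Finset.sum_congr rfl h4] at h2
    exact eq_neg_of_add_eq_zero_right h2
  rw [h1]
  exact S.neg_mem (S.sum_mem fun i _ => S.smul_mem (S.pow_mem hr _) _)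

namespace AugmentedLevel

variable {C : Type*} [Ring C] [StarRing C] {l : ℕ} {F : Frame C l} {K : Type*} [CommRing K]
  [Algebra K C] {U : Subgroup Cˣ} {L : AugmentedLevel F K U}

variable (L) in
/-- The algebra `K + I`. -/
def unitization : Subalgebra K (C × C) where
  carrier := {x | ∃ k : K, x - algebraMap K (C × C) k ∈ L.I}
  algebraMap_mem' k := ⟨k, by simp⟩
  add_mem' := by
    rintro x y ⟨k, hk⟩ ⟨m, hm⟩
    refine ⟨k + m, ?_⟩
    convert add_mem hk hm using 1
    rw [map_add]; abel
  mul_mem' := by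
    rintro x y ⟨k, hk⟩ ⟨m, hm⟩
    refine ⟨k * m, ?_⟩
    have e : x * y - algebraMap K (C × C) (k * m) = (x - algebraMap K (C × C) k) *
        (y - algebraMap K (C × C) m) + (x - algebraMap K (C × C) k) * algebraMap K (C × C) m +
        algebraMap K (C × C) k * (y - algebraMap K (C × C) m) := by
      rw [map_mul]; noncomm_ring
    rw [e]
    refine add_mem (add_mem (mul_normalizer_mem hk (I_le_normalizer hm)) ?_)
      (L.algebraMap_mul_mem k hm)
    exact L.mul_mem _ hk _ (L.algebraMap_mem_coeff m)

/-- Since `I` is not an ideal of `𝒜`, this is not formal. Integrality places `t` in `K + I`, and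
then `t - 1 = -(r - 1)t` lies in `I`. -/
theorem inv_sub_one_mem [Module.Finite K C] {r t : C × C} (hr : r - 1 ∈ L.I) (hrt : r * t = 1)
    (htr : t * r = 1) : t - 1 ∈ L.I := by
  have ht : t ∈ L.unitization :=
    inv_mem_of_isIntegral (K := K) (r := r) ⟨1, by rw [map_one]; exact hr⟩ hrt htr
      (Algebra.IsIntegral.isIntegral t)
  obtain ⟨k, hk⟩ := ht
  have e : t - 1 = -((r - 1) * (t - algebraMap K (C × C) k)) -
      (r - 1) * algebraMap K (C × C) k := by
    have e' : t - r * t = -((r - 1) * (t - algebraMap K (C × C) k)) -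
        (r - 1) * algebraMap K (C × C) k := by noncomm_ring
    rwa [hrt] at e'
  rw [e]
  exact sub_mem (neg_mem (mul_normalizer_mem hr (I_le_normalizer hk)))
    (L.mul_mem _ hr _ (L.algebraMap_mem_coeff k))

/-! ### Elimination of a column -/

variable (L) in
/-- A column `w ∈ 𝒜 e_k`, congruent to `e_k`, that is isotropic modulo `Γ`. -/
structure IsotropicColumn (k : ℤ) (w : C × C) : Prop where
  sub_mem : w - F.d k ∈ L.I
  mul_d : w * F.d k = w
  d_mul : F.d k * w = F.d k
  isotropic : dbar w * w = 0
  actBy_mem : actBy w (epsilon F) ∈ L.Γ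

namespace IsotropicColumn

variable {k : ℤ} {w : C × C}

theorem mem_normalizer (hw : L.IsotropicColumn k w) : w ∈ L.normalizer := by
  simpa using add_mem (I_le_normalizer hw.sub_mem) (d_mem_normalizer k)

theorem d_mul_mem (hw : L.IsotropicColumn k w) {i : ℤ} (hi : i ≠ k) : F.d i * w ∈ L.I := by
  have := normalizer_mul_mem (d_mem_normalizer i) hw.sub_mem
  rwa [mul_sub, F.d_mul_of_ne hi, sub_zero] at this

theorem alpha_mul (hw : L.IsotropicColumn k w) {f : Cˣ} (hf : f ∈ L.principalSubgroup)
    (hfk : F.d k * alpha f = F.d k) : L.IsotropicColumn k (alpha f * w) where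
  sub_mem := by
    have e : alpha f * w - F.d k = (alpha f - 1) * w + (w - F.d k) := by noncomm_ring
    rw [e]
    exact add_mem (mul_normalizer_mem hf.1 hw.mem_normalizer) hw.sub_mem
  mul_d := by rw [mul_assoc, hw.mul_d]
  d_mul := by rw [← mul_assoc, hfk, hw.d_mul]
  isotropic := by
    rw [dbar_mul, dbar_alpha, mul_assoc, alpha_inv_mul_cancel, hw.isotropic]
  actBy_mem := by
    have e : actBy (alpha f) (epsilon F) = coc F f + epsilon F := (sub_add_cancel _ _).symm
    rw [actBy_mul, e, map_add]
    exact add_mem (AugmentedLevel.actBy_mem hw.mem_normalizer hf.2) hw.actBy_mem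

/-- As `e_k w = e_k`, a transvection `τ_{i,k}` with parameter `-e_i w` cancels row `i`. Besides row
`i` it changes only row `-k`, so rows already cleared stay clear. -/
theorem exists_clear_rows (hk : k ≠ 0) (hw : L.IsotropicColumn k w) (S : Finset ℤ)
    (hS : ∀ i ∈ S, i ≠ 0 ∧ i ≠ k ∧ i ≠ -k) :
    ∃ f ∈ L.level.elementary, alpha f * F.d (-k) = F.d (-k) ∧ F.d k * alpha f = F.d k ∧
      ∀ i ∈ S, F.d i * (alpha f * w) = 0 := by
  induction S using Finset.induction_on with
  | empty => exact ⟨1, one_mem _, by simp, by simp, by simp⟩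
  | insert i S hi ih =>
    obtain ⟨f, hf, hf1, hf2, hf3⟩ := ih fun j hj => hS j (Finset.mem_insert_of_mem hj)
    obtain ⟨hi0, hik, hik'⟩ := hS i (Finset.mem_insert_self _ _)
    have hw' := hw.alpha_mul (elementary_le_principal hf) hf2
    set w' := alpha f * w with hw'_def
    set b := -(F.d i * w') with hb
    have hbI : b ∈ L.I := neg_mem (hw'.d_mul_mem hik)
    have hb1 : F.d i * b = b := by rw [hb, mul_neg, F.d_mul_cancel]
    have hb2 : b * F.d k = b := by rw [hb, neg_mul, mul_assoc, hw'.mul_d]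
    have hb3 : F.d (-k) * dbar b = dbar b := by rw [← F.dbar_d, ← dbar_mul, hb2]
    have hb4 : dbar b * F.d (-i) = dbar b := by rw [← F.dbar_d, ← dbar_mul, hb1]
    obtain ⟨f', hf', hf'a⟩ := exists_elementary_tau₂ hi0 hk hik hik' hbI hb1 hb2
    have left (j : ℤ) (hj1 : j ≠ i) (hj2 : j ≠ -k) : F.d j * alpha f' = F.d j := by
      have z1 : F.d j * b = 0 := by rw [← hb1, ← mul_assoc, F.d_mul_of_ne hj1, zero_mul]
      have z2 : F.d j * dbar b = 0 := by rw [← hb3, ← mul_assoc, F.d_mul_of_ne hj2, zero_mul]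
      rw [hf'a, mul_add, mul_sub, z1, z2, mul_one, sub_zero, add_zero]
    have right : alpha f' * F.d (-k) = F.d (-k) := by
      have z1 : b * F.d (-k) = 0 := by
        rw [← hb2, mul_assoc, F.d_mul_of_ne (by omega), mul_zero]
      have z2 : dbar b * F.d (-k) = 0 := by
        rw [← hb4, mul_assoc, F.d_mul_of_ne (by omega), mul_zero]
      rw [hf'a, add_mul, sub_mul, z1, z2, one_mul, sub_zero, add_zero]
    refine ⟨f' * f, Subgroup.mul_mem _ hf' hf, ?_, ?_, fun j hj => ?_⟩
    · rw [OddUnitary.alpha_mul, mul_assoc, hf1, right]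
    · rw [OddUnitary.alpha_mul, ← mul_assoc, left k hik.symm (by omega), hf2]
    · rw [OddUnitary.alpha_mul, mul_assoc, ← hw'_def]
      rcases Finset.mem_insert.1 hj with rfl | hj
      · have e1 : F.d j * dbar b = 0 := by
          rw [← hb3, ← mul_assoc, F.d_mul_of_ne hik', zero_mul]
        have e2 : b * w' = b := by rw [← hb2, mul_assoc, hw'.d_mul]
        rw [← mul_assoc, hf'a, mul_add, mul_sub, e1, hb1, sub_zero, add_mul, e2, mul_one, hb,
          add_neg_cancel]
      · have hjS := hS j (Finset.mem_insert_of_mem hj)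
        rw [← mul_assoc, left j (fun h => hi (h ▸ hj)) hjS.2.2, hf3 j hj]

/-- Row `-k` is altered by every other clearing step and therefore comes last. Then `w = e_k + v`
with `v` in row `-k`; isotropy says `dbar v = -v`, and the condition `ε · w ∈ Γ` says that `-v` is
an admissible parameter of `τ_k`. -/
theorem exists_clear (hk : k ≠ 0) (hw : L.IsotropicColumn k w) :
    ∃ f ∈ L.level.elementary, alpha f * w = F.d k ∧ alpha f * F.d (-k) = F.d (-k) := by
  have sum_d : ∑ i ∈ Finset.Icc (-(l : ℤ)) l, F.d i = 1 := by
    simp_rw [Frame.d]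
    rw [← map_sum, F.sum_e, map_one]
  obtain ⟨f₁, hf₁, hf₁1, hf₁2, hf₁3⟩ := hw.exists_clear_rows hk
    ((Finset.Icc (-(l : ℤ)) l).filter fun i => i ≠ 0 ∧ i ≠ k ∧ i ≠ -k) (by simp)
  have hw₁ := hw.alpha_mul (elementary_le_principal hf₁) hf₁2
  set w₁ := alpha f₁ * w with hw₁_def
  have h0I := hw₁.d_mul_mem hk.symm
  -- Row `0` can be cleared only by elements of `Γ`; the boundary condition of an augmented level
  -- provides one with the required `π`.
  obtain ⟨h, hh, hhp⟩ : ∃ h ∈ L.Γ, pi (actBy (diag (1 - F.e 0)) h) = -(F.d 0 * w₁) := by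
    have : -(F.d 0 * w₁) ∈ (fun a => diag (F.e 0) * a * diag (1 - F.e 0)) '' (L.I : Set (C × C)) := by
      refine ⟨-(F.d 0 * w₁), neg_mem h0I, ?_⟩
      change F.d 0 * (-(F.d 0 * w₁)) * diag (1 - F.e 0) = _
      rw [mul_neg, F.d_mul_cancel, neg_mul, mul_assoc, ← hw₁.mul_d, mul_assoc, d_mul_one_sub hk]
    rw [L.boundary] at this
    exact this
  set h₂ := actBy (F.d k) (actBy (diag (1 - F.e 0)) h) with hh₂
  have h₂Γ : h₂ ∈ L.Γ := by
    rw [hh₂, ← actBy_mul, one_sub_mul_d hk]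
    exact AugmentedLevel.actBy_mem (d_mem_normalizer k) hh
  have h₂d : actBy (F.d k) h₂ = h₂ := by rw [hh₂, ← actBy_mul, F.d_mul_self]
  have h₂p : pi h₂ = -(F.d 0 * w₁) := by
    rw [hh₂, pi_actBy, hhp, neg_mul, mul_assoc, hw₁.mul_d]
  obtain ⟨f₂, hf₂, hf₂a⟩ := exists_elementary_tau₁ hk h₂Γ h₂d
  have p1 : F.d 0 * pi h₂ = pi h₂ := by rw [h₂p, mul_neg, F.d_mul_cancel]
  have p2 : pi h₂ * F.d k = pi h₂ := by rw [← pi_actBy, h₂d]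
  have p3 : F.d (-k) * dbar (pi h₂) = dbar (pi h₂) := by rw [← F.dbar_d, ← dbar_mul, p2]
  have p4 : dbar (pi h₂) * F.d 0 = dbar (pi h₂) := by
    have := congrArg dbar p1
    rwa [dbar_mul, F.dbar_d, neg_zero] at this
  have t0 : tr h₂ = F.d (-k) * tr h₂ * F.d k := by
    conv_lhs => rw [← h₂d, tr_actBy, F.dbar_d]
  have left (j : ℤ) (hj1 : j ≠ 0) (hj2 : j ≠ -k) : F.d j * alpha f₂ = F.d j := by
    have z1 : F.d j * pi h₂ = 0 := by rw [← p1, ← mul_assoc, F.d_mul_of_ne hj1, zero_mul]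
    have z2 : F.d j * dbar (pi h₂) = 0 := by
      rw [← p3, ← mul_assoc, F.d_mul_of_ne hj2, zero_mul]
    have z3 : F.d j * tr h₂ = 0 := by
      rw [t0, ← mul_assoc, ← mul_assoc, F.d_mul_of_ne hj2, zero_mul, zero_mul]
    rw [hf₂a, mul_add, mul_sub, mul_add, z1, z2, z3, mul_one, add_zero, sub_zero, add_zero]
  have right : alpha f₂ * F.d (-k) = F.d (-k) := by
    have z1 : pi h₂ * F.d (-k) = 0 := by
      rw [← p2, mul_assoc, F.d_mul_of_ne (by omega), mul_zero]
    have z2 : dbar (pi h₂) * F.d (-k) = 0 := by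
      rw [← p4, mul_assoc, F.d_mul_of_ne (by omega), mul_zero]
    have z3 : tr h₂ * F.d (-k) = 0 := by
      rw [t0, mul_assoc, F.d_mul_of_ne (by omega), mul_zero]
    rw [hf₂a, add_mul, sub_mul, add_mul, z1, z2, z3, one_mul, add_zero, sub_zero, add_zero]
  have hw₂ := hw₁.alpha_mul (elementary_le_principal hf₂) (left k hk (by omega))
  set w₂ := alpha f₂ * w₁ with hw₂_def
  have z0 : F.d 0 * w₂ = 0 := by
    have e1 : F.d 0 * dbar (pi h₂) = 0 := by
      rw [← p3, ← mul_assoc, F.d_mul_of_ne (by omega), zero_mul]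
    have e2 : F.d 0 * tr h₂ = 0 := by
      rw [t0, ← mul_assoc, ← mul_assoc, F.d_mul_of_ne (by omega), zero_mul, zero_mul]
    have e3 : pi h₂ * w₁ = pi h₂ := by rw [← p2, mul_assoc, hw₁.d_mul]
    rw [hw₂_def, ← mul_assoc, hf₂a, mul_add, mul_sub, mul_add, p1, e1, e2, add_mul, mul_one,
      add_zero, sub_zero, e3, h₂p, add_neg_cancel]
  have zi (i : ℤ) (hi0 : i ≠ 0) (hi1 : i ≠ k) (hi2 : i ≠ -k) : F.d i * w₂ = 0 := by
    rw [hw₂_def, ← mul_assoc, left i hi0 hi2]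
    by_cases hi : i ∈ Finset.Icc (-(l : ℤ)) l
    · exact hf₁3 i (Finset.mem_filter.2 ⟨hi, hi0, hi1, hi2⟩)
    · rw [Frame.d, F.e_eq_zero, map_zero, zero_mul]
      rw [Finset.mem_Icc, ← abs_le] at hi
      omega
  set v := F.d (-k) * w₂ with hv
  have hsum : w₂ = F.d k + v := by
    have e : w₂ - F.d k - v = 0 := by
      rw [← one_mul (w₂ - F.d k - v), ← sum_d, Finset.sum_mul]
      refine Finset.sum_eq_zero fun i _ => ?_
      rw [hv, mul_sub, mul_sub]
      by_cases h1 : i = k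
      · rw [h1, hw₂.d_mul, F.d_mul_self, ← mul_assoc, F.d_mul_of_ne (by omega)]; simp
      by_cases h2 : i = -k
      · rw [h2, F.d_mul_cancel, F.d_mul_of_ne (by omega)]; simp
      rw [F.d_mul_of_ne h1, ← mul_assoc (F.d i) (F.d (-k)), F.d_mul_of_ne h2]
      by_cases h3 : i = 0
      · rw [h3, z0]; simp
      · rw [zi i h3 h1 h2]; simp
    rw [sub_sub, sub_eq_zero] at e
    exact e
  have v1 : F.d (-k) * v = v := by rw [hv, F.d_mul_cancel]
  have v2 : v * F.d k = v := by rw [hv, mul_assoc, hw₂.mul_d]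
  have v3 : dbar v * F.d k = dbar v := by
    have := congrArg dbar v1
    rwa [dbar_mul, F.dbar_d, neg_neg] at this
  have v4 : F.d (-k) * dbar v = dbar v := by rw [← F.dbar_d, ← dbar_mul, v2]
  have hanti : dbar v = -v := by
    have := hw₂.isotropic
    rw [hsum, map_add, F.dbar_d, add_mul, mul_add, mul_add, F.d_mul_of_ne (by omega), v1, v3,
      Frame.mul_eq_zero v3 v1 (F.d_mul_of_ne (by omega)), zero_add, add_zero] at this
    exact eq_neg_of_add_eq_zero_right this
  have hs : star v.2 = -v.1 := congrArg Prod.fst hanti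
  have hs' : star v.1 = -v.2 := congrArg Prod.snd hanti
  have c1 : F.e (-k) * v.1 = v.1 := congrArg Prod.fst v1
  have c2 : v.1 * F.e k = v.1 := congrArg Prod.fst v2
  -- Up to sign this element is `ε · w₂`: here `e₊` keeps `e_k` and kills `v` if `k > 0`, and does
  -- the reverse if `k < 0`.
  have hvΓ : (⟨0, -v.1, 0, by simp, by simp⟩ : Heis (F.e 0)) ∈ L.Γ := by
    have hε := hw₂.actBy_mem
    have c3 : v.1 * v.1 = 0 := Frame.mul_eq_zero c2 c1 (F.orth _ _ (by omega))
    have c4 : F.e 0 * v.1 = 0 := by rw [← c1, ← mul_assoc, F.orth _ _ (by omega), zero_mul]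
    have c5 : v.1 * F.e 0 = 0 := by rw [← c2, mul_assoc, F.orth _ _ hk, mul_zero]
    have c6 : F.e 0 * F.e k = 0 := F.orth _ _ hk.symm
    have c7 : F.e (-k) * F.e 0 = 0 := F.orth _ _ (by omega)
    have c8 : F.e (-k) * F.e k = 0 := F.orth _ _ (by omega)
    rcases lt_or_gt_of_ne hk with hk' | hk'
    · have q1 : F.pos * F.e k = 0 := by rw [F.pos_mul_e, if_neg (by omega)]
      have q2 : F.pos * v.1 = v.1 := by
        rw [← c1, ← mul_assoc, F.pos_mul_e, if_pos (by omega)]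
      have hneg := neg_mem hε
      convert hneg using 1
      rw [hsum]
      ext
      · simp [mul_add, c6, c4]
      · simp [F.epsilon_y, F.star_e, hs, add_mul, mul_add, mul_assoc, q1, q2, c1, c3, c4, c5, c6,
          c7]
      · simp [F.star_e, hs, add_mul, c5, c7]
    · have q1 : F.pos * F.e k = F.e k := by rw [F.pos_mul_e, if_pos (by omega)]
      have q2 : F.pos * v.1 = 0 := by
        rw [← c1, ← mul_assoc, F.pos_mul_e, if_neg (by omega), zero_mul]
      convert hε using 1
      rw [hsum]
      ext
      · simp [mul_add, c6, c4]
      · simp [F.epsilon_y, F.star_e, hs, add_mul, mul_add, mul_assoc, q1, q2, c2, c8]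
      · simp [F.star_e, hs, add_mul, c5, c7]
  have hvd : actBy (F.d k) (⟨0, -v.1, 0, by simp, by simp⟩ : Heis (F.e 0)) =
      ⟨0, -v.1, 0, by simp, by simp⟩ := by
    ext
    · simp
    · simp [F.star_e, c1, c2]
    · simp
  obtain ⟨f₃, hf₃, hf₃a⟩ := exists_elementary_tau₁ hk hvΓ hvd
  have hf₃a' : alpha f₃ = 1 - v := by
    rw [hf₃a]
    ext
    · simp; abel
    · simp [hs']; abel
  refine ⟨f₃ * (f₂ * f₁), Subgroup.mul_mem _ hf₃ (Subgroup.mul_mem _ hf₂ hf₁), ?_, ?_⟩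
  · rw [OddUnitary.alpha_mul, OddUnitary.alpha_mul, mul_assoc, mul_assoc, ← hw₁_def, ← hw₂_def,
      hsum, hf₃a', sub_mul, one_mul, mul_add, v2, Frame.mul_eq_zero v2 v1 (F.d_mul_of_ne (by omega))]
    abel
  · rw [OddUnitary.alpha_mul, OddUnitary.alpha_mul, mul_assoc, mul_assoc, hf₁1, right, hf₃a',
      sub_mul, one_mul, ← v2, mul_assoc, F.d_mul_of_ne (by omega), mul_zero, sub_zero]

end IsotropicColumn

/-- The corner `e_k α(g) e_k` is invertible in `e_k 𝒜 e_k`. -/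
def CornerInvertible (F : Frame C l) (k : ℤ) (a : C × C) : Prop :=
  ∃ u' : C × C, F.d k * u' = u' ∧ u' * F.d k = u' ∧ F.d k * a * u' = F.d k ∧
    u' * a * F.d k = F.d k

/-- Column `k` is normalized by the inverse `u'` of its corner and reduced to `e_k`. Unitarity then
fixes row `-k`, so column `-k` has an invertible corner without further work. It is reduced by a
transformation that does not touch column `k`; finally unitarity turns the two columns into the two
missing rows. -/
theorem exists_mem_GU'hat [Module.Finite K C] (hl : 3 ≤ l) (hF : F.Comparable)
    (hU : ∀ g ∈ U, star g.val * g.val = 1) {g : Cˣ} (hg : g ∈ L.GU') {k : ℤ} (hk : k ≠ 0)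
    (h1 : CornerInvertible F k (alpha g)) (h2 : CornerInvertible F (-k) (alpha g)) :
    ∃ f ∈ L.level.elementary, f * g ∈ L.GU'hat k := by
  obtain ⟨u', u1, u2, u3, u4⟩ := h1
  obtain ⟨x', x1, x2, x3, x4⟩ := h2
  set a := alpha g with ha
  set y' := dbar x' with hy'
  have y1 : F.d k * y' = y' := by
    have := congrArg dbar x2
    rwa [dbar_mul, F.dbar_d, neg_neg] at this
  have y2 : y' * F.d k = y' := by
    have := congrArg dbar x1
    rwa [dbar_mul, F.dbar_d, neg_neg] at this
  have y3 : F.d k * alpha g⁻¹ * y' = F.d k := by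
    have := congrArg dbar x4
    rwa [dbar_mul, dbar_mul, F.dbar_d, neg_neg, dbar_alpha, ← mul_assoc] at this
  have y4 : y' * alpha g⁻¹ * F.d k = F.d k := by
    have := congrArg dbar x3
    rwa [dbar_mul, dbar_mul, F.dbar_d, neg_neg, dbar_alpha, ← mul_assoc] at this
  have conj (m : ℤ) (hm : m ≠ 0) {g : Cˣ} (hg : g ∈ L.GU') :
      alpha g * F.d m * alpha g⁻¹ - F.d m ∈ L.I :=
    (diag_mem_commutesMod hl hF hU hg hm hm (F.idem m) (F.idem m)).2
  have hp := conj k hk hg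
  -- The product `y' u'` is the inverse of `e_k a e_k a⁻¹ e_k`, which is congruent to `e_k`.
  -- Existence of `y'` is where the corner at `-k` is needed: the involution carries it to the
  -- corner `e_k a⁻¹ e_k`.
  have hs : y' * u' - F.d k ∈ L.I := by
    have e1 : F.d k * (a * F.d k * alpha g⁻¹ - F.d k) * F.d k ∈ L.I :=
      mul_normalizer_mem (normalizer_mul_mem (d_mem_normalizer k) hp) (d_mem_normalizer k)
    set s := F.d k * (a * F.d k * alpha g⁻¹) * F.d k with hs
    have e2 : F.d k * (a * F.d k * alpha g⁻¹ - F.d k) * F.d k = s - F.d k := by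
      rw [mul_sub, sub_mul, F.d_mul_self, F.d_mul_self]
    rw [e2] at e1
    have s1 : F.d k * s = s := by rw [hs]; simp [mul_assoc]
    have s2 : s * F.d k = s := by rw [hs]; simp [mul_assoc]
    have s3 : s * (y' * u') = F.d k := by
      calc s * (y' * u') = F.d k * a * (F.d k * alpha g⁻¹ * (F.d k * y')) * u' := by
            rw [hs]; simp only [mul_assoc]
        _ = F.d k * a * u' := by rw [y1, y3, mul_assoc _ _ u', u1]
        _ = F.d k := u3
    have s4 : (y' * u') * s = F.d k := by
      calc (y' * u') * s = y' * (u' * F.d k * a * F.d k) * alpha g⁻¹ * F.d k := by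
            rw [hs]; simp only [mul_assoc]
        _ = y' * F.d k * alpha g⁻¹ * F.d k := by rw [u2, u4]
        _ = F.d k := by rw [y2, y4]
    have t1 : F.d k * (y' * u') = y' * u' := by rw [← mul_assoc, y1]
    have t2 : (y' * u') * F.d k = y' * u' := by rw [mul_assoc, u2]
    -- Adding `1 - e_k` turns inverses in the corner into inverses in `𝒜`.
    have e3 := inv_sub_one_mem (L := L) (r := 1 + (s - F.d k)) (t := 1 + (y' * u' - F.d k))
      (by simpa using e1)
      (by simp only [mul_add, add_mul, mul_sub, sub_mul, s2, s3, t1, F.d_mul_self]; simp; abel)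
      (by simp only [mul_add, add_mul, mul_sub, sub_mul, s1, s4, t2, F.d_mul_self]; simp; abel)
    simpa using e3
  have hsN : y' * u' ∈ L.normalizer := by
    simpa using add_mem (I_le_normalizer hs) (d_mem_normalizer k)
  have hw : a * u' = a * F.d k * alpha g⁻¹ * (y' * u') := by
    calc a * u' = a * (F.d k * alpha g⁻¹ * y') * u' := by rw [y3, mul_assoc, u1]
      _ = _ := by simp only [mul_assoc]
  have hcol : L.IsotropicColumn k (a * u') :=
    { sub_mem := by
        have e : a * u' - F.d k = (a * F.d k * alpha g⁻¹ - F.d k) * (y' * u') +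
            (y' * u' - F.d k) := by
          rw [sub_mul, ← hw, ← mul_assoc (F.d k), y1]; abel
        rw [e]
        exact add_mem (mul_normalizer_mem hp hsN) hs
      mul_d := by rw [mul_assoc, u2]
      d_mul := by rw [← mul_assoc, u3]
      isotropic := by
        have e : dbar u' * F.d (-k) = dbar u' := by rw [← F.dbar_d, ← dbar_mul, u1]
        rw [dbar_mul, ha, dbar_alpha, mul_assoc, alpha_inv_mul_cancel]
        exact Frame.mul_eq_zero e u1 (F.d_mul_of_ne (by omega))
      actBy_mem := by
        rw [hw, actBy_mul]
        exact actBy_mem hsN (actBy_epsilon_conj_mem hl hF hU hg hk (F.idem k) (F.idem k)) }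
  obtain ⟨f₁, hf₁, hf₁w, -⟩ := hcol.exists_clear hk
  set u := F.d k * a * F.d k with hu
  have uu' : u * u' = F.d k := by rw [hu, mul_assoc, u1, u3]
  have u'u : u' * u = F.d k := by rw [hu, ← mul_assoc, ← mul_assoc, u2, u4]
  have ud1 : F.d k * u = u := by rw [hu]; simp [mul_assoc]
  have ud2 : u * F.d k = u := by rw [hu]; simp [mul_assoc]
  have hg₁ : f₁ * g ∈ L.GU' := mul_mem_GU' hU (Level.elementary_le_EU _ hf₁) hg
  set a₁ := alpha (f₁ * g) with ha₁
  have a₁k : a₁ * F.d k = u := by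
    have e : a * F.d k = a * u' * u := by rw [mul_assoc, u'u]
    rw [ha₁, alpha_mul, mul_assoc, ← ha, e, ← mul_assoc, hf₁w, ud1]
  have a₁k' : F.d (-k) * alpha (f₁ * g)⁻¹ = dbar u := by
    rw [← a₁k, dbar_mul, F.dbar_d, dbar_alpha]
  have b1 : dbar u' * dbar u = F.d (-k) := by rw [← dbar_mul, uu', F.dbar_d]
  have b2 : dbar u * dbar u' = F.d (-k) := by rw [← dbar_mul, u'u, F.dbar_d]
  have b3 : dbar u' * F.d (-k) = dbar u' := by rw [← F.dbar_d, ← dbar_mul, u1]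
  have b4 : F.d (-k) * dbar u' = dbar u' := by rw [← F.dbar_d, ← dbar_mul, u2]
  have b5 : dbar u * F.d (-k) = dbar u := by rw [← F.dbar_d, ← dbar_mul, ud1]
  have ka₁ : F.d (-k) * a₁ = dbar u' := by
    rw [← b1, ← a₁k', mul_assoc, mul_assoc, ha₁, alpha_inv_mul_alpha, mul_one, b3]
  -- This column is visibly congruent to `e_{-k}` modulo `I`, so no integrality argument is needed a
  -- second time.
  have hw₂ : a₁ * F.d (-k) * alpha (f₁ * g)⁻¹ * F.d (-k) = a₁ * dbar u := by
    rw [mul_assoc a₁, a₁k', mul_assoc, b5]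
  have hcol₂ : L.IsotropicColumn (-k) (a₁ * dbar u) :=
    { sub_mem := by
        have e : a₁ * dbar u - F.d (-k) =
            (a₁ * F.d (-k) * alpha (f₁ * g)⁻¹ - F.d (-k)) * F.d (-k) := by
          rw [sub_mul, hw₂, F.d_mul_self]
        rw [e]
        exact mul_normalizer_mem (conj (-k) (by omega) hg₁) (d_mem_normalizer _)
      mul_d := by rw [mul_assoc, b5]
      d_mul := by rw [← mul_assoc, ka₁, b1]
      isotropic := by
        have e : F.d (-k) * dbar u = dbar u := by rw [← F.dbar_d, ← dbar_mul, ud2]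
        rw [dbar_mul, dbar_dbar, ha₁, dbar_alpha, mul_assoc, alpha_inv_mul_cancel]
        exact Frame.mul_eq_zero ud2 e (F.d_mul_of_ne (by omega))
      actBy_mem := by
        rw [← hw₂, actBy_mul]
        exact actBy_mem (d_mem_normalizer _) (actBy_epsilon_conj_mem hl hF hU hg₁ (by omega)
          (F.idem _) (F.idem _)) }
  obtain ⟨f₂, hf₂, hf₂w, hf₂k⟩ := hcol₂.exists_clear (by omega)
  rw [neg_neg] at hf₂k
  have hg₂ : f₂ * (f₁ * g) ∈ L.GU' := mul_mem_GU' hU (Level.elementary_le_EU _ hf₂) hg₁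
  set a₂ := alpha (f₂ * (f₁ * g)) with ha₂
  have r1 : a₂ * F.d k = u := by
    rw [ha₂, alpha_mul, mul_assoc, ← ha₁, a₁k, ← ud1, ← mul_assoc, hf₂k]
  have r2 : a₂ * F.d (-k) = dbar u' := by
    rw [ha₂, alpha_mul, mul_assoc, ← ha₁, ← b2, ← mul_assoc a₁, ← mul_assoc, hf₂w, b4]
  have r3 : F.d k * alpha (f₂ * (f₁ * g))⁻¹ = u' := by
    have := congrArg dbar r2
    rwa [dbar_mul, F.dbar_d, neg_neg, dbar_dbar, ha₂, dbar_alpha] at this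
  have r4 : F.d k * a₂ = u := by
    have h : u' * a₂ = F.d k := by rw [← r3, mul_assoc, ha₂, alpha_inv_mul_alpha, mul_one]
    calc F.d k * a₂ = u * (u' * a₂) := by rw [← mul_assoc, uu']
      _ = u := by rw [h, ud2]
  refine ⟨f₂ * f₁, Subgroup.mul_mem _ hf₂ hf₁, ?_⟩
  rw [mul_assoc]
  refine ⟨hg₂, ?_, ?_⟩
  · change F.d k * a₂ = F.d k * a₂ * F.d k
    rw [r4, ud2]
  · change F.d k * a₂ * F.d k = a₂ * F.d k
    rw [r4, r1, ud2]

end AugmentedLevel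

end OddUnitary

namespace OddUnitary

open Heis Module

/-! ### Finite families of simple representations -/

theorem exists_dual_eq_one {E V : Type*} [DivisionRing E] [AddCommGroup V] [Module E V] {v : V}
    (hv : v ≠ 0) : ∃ ξ : V →ₗ[E] E, ξ v = 1 := by
  obtain ⟨f, hf⟩ := Projective.exists_dual_ne_zero E hv
  exact ⟨(LinearMap.toSpanSingleton E E (f v)⁻¹).comp f, by simp [hf]⟩

/-- Every operator is a combination of the `A T B` for a nonzero operator `T`. -/
theorem exists_sum_mul_mul {E V : Type*} [DivisionRing E] [AddCommGroup V] [Module E V]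
    [FiniteDimensional E V] {T : Module.End E V} (hT : T ≠ 0) (ψ : Module.End E V) :
    ∃ (n : ℕ) (A B : Fin n → Module.End E V), ∑ i, A i * T * B i = ψ := by
  obtain ⟨w, hw⟩ : ∃ w, T w ≠ 0 := by
    by_contra! h
    exact hT (LinearMap.ext h)
  obtain ⟨ξ, hξ⟩ := exists_dual_eq_one (E := E) hw
  let b := Module.finBasis E V
  refine ⟨_, fun i => ξ.smulRight (ψ (b i)), fun i => (b.coord i).smulRight w, ?_⟩
  ext v
  conv_rhs => rw [← b.sum_repr v, map_sum]
  simp [hξ]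

/-- Representations of `C` in finite dimensional vector spaces that are jointly surjective and
detect units. -/
structure SimpleReps (C : Type*) [Ring C] {ι : Type*} (E : ι → Type*) [∀ j, DivisionRing (E j)]
    (V : ι → Type*) [∀ j, AddCommGroup (V j)] [∀ j, Module (E j) (V j)] where
  rho : ∀ j, C →+* Module.End (E j) (V j)
  surj : ∀ ψ : ∀ j, Module.End (E j) (V j), ∃ c, ∀ j, rho j c = ψ j
  isUnit : ∀ c, (∀ j, IsUnit (rho j c)) → IsUnit c

namespace SimpleReps

variable {C : Type*} [Ring C] {ι : Type*} {E : ι → Type*} [∀ j, DivisionRing (E j)]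
  {V : ι → Type*} [∀ j, AddCommGroup (V j)] [∀ j, Module (E j) (V j)] (S : SimpleReps C E V)

/-- The representations of `C × C` obtained from the two projections to `C`. -/
def act (j : ι) (c : Bool) : C × C →+* Module.End (E j) (V j) :=
  (S.rho j).comp (if c then RingHom.fst C C else RingHom.snd C C)

@[simp] theorem act_diag (j : ι) (c : Bool) (x : C) : S.act j c (diag x) = S.rho j x := by
  cases c <;> rfl

theorem isUnit_of_act {x : C × C} (h : ∀ j c, IsUnit (S.act j c x)) : IsUnit x :=
  Prod.isUnit_iff.2 ⟨S.isUnit _ fun j => h j true, S.isUnit _ fun j => h j false⟩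

theorem exists_rho_eq (j : ι) (ψ : Module.End (E j) (V j)) :
    ∃ c, S.rho j c = ψ ∧ ∀ i, i ≠ j → S.rho i c = 0 := by
  classical
  obtain ⟨c, hc⟩ := S.surj (Function.update 0 j ψ)
  exact ⟨c, by rw [hc, Function.update_self], fun i hi => by
    rw [hc, Function.update_of_ne hi, Pi.zero_apply]⟩

section Dimension

variable [StarRing C] {l : ℕ} {F : Frame C l}

/-- By comparability, every `e_m` with `m ≠ 0` factors through `e_i`, so one vanishing hyperbolic
idempotent makes all of them vanish. -/
theorem rho_e_ne_zero (hF : F.Comparable) {j : ι} (h : S.rho j (1 - F.e 0) ≠ 0) {i : ℤ}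
    (hi : i ≠ 0) (hil : |i| ≤ l) : S.rho j (F.e i) ≠ 0 := by
  intro h0
  apply h
  have hz : ∀ m ∈ Finset.Icc (-(l : ℤ)) l, m ≠ 0 → S.rho j (F.e m) = 0 := by
    intro m hm hm0
    obtain ⟨N, u, v, hu, hv, huv⟩ := hF m i hm0 (abs_le.2 (Finset.mem_Icc.1 hm)) hi hil
    rw [← huv, map_sum]
    refine Finset.sum_eq_zero fun n _ => ?_
    rw [hu, map_mul, map_mul, h0, mul_zero, zero_mul]
  rw [← F.sum_e, ← Finset.sum_erase_add _ _ (Finset.mem_Icc.2 ⟨by omega, by omega⟩ :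
    (0 : ℤ) ∈ Finset.Icc (-(l : ℤ)) l), add_sub_cancel_right, map_sum]
  exact Finset.sum_eq_zero fun m hm => hz m (Finset.mem_of_mem_erase hm) (Finset.ne_of_mem_erase hm)

variable [∀ j, FiniteDimensional (E j) (V j)]

/-- The `2l` orthogonal idempotents with nonzero index all act nontrivially, and one vector from
each image gives an independent family. -/
theorem two_mul_le_finrank (hF : F.Comparable) {j : ι} (h : S.rho j (1 - F.e 0) ≠ 0) :
    2 * l ≤ finrank (E j) (LinearMap.range (S.rho j (1 - F.e 0))) := by
  let s := (Finset.Icc (-(l : ℤ)) l).erase 0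
  have hs : s.card = 2 * l := by
    rw [Finset.card_erase_of_mem (Finset.mem_Icc.2 ⟨by omega, by omega⟩), Int.card_Icc]
    omega
  have hex : ∀ i : s, ∃ w : V j, S.rho j (F.e i) w ≠ 0 := fun i => by
    by_contra! h'
    have hi := Finset.mem_erase.1 i.2
    exact S.rho_e_ne_zero hF h hi.1 (abs_le.2 (Finset.mem_Icc.1 hi.2)) (LinearMap.ext h')
  choose w hw using hex
  let u : s → V j := fun i => S.rho j (F.e i) (w i)
  have hmul (x y : C) (v : V j) : S.rho j x (S.rho j y v) = S.rho j (x * y) v := by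
    rw [map_mul]; rfl
  have hu : LinearIndependent (E j) u := by
    rw [Fintype.linearIndependent_iff]
    intro a ha i
    have h1 := congrArg (S.rho j (F.e i)) ha
    rw [map_sum, map_zero, Finset.sum_eq_single i] at h1
    · rw [map_smul, hmul, F.idem] at h1
      exact (smul_eq_zero.1 h1).resolve_right (hw i)
    · intro m _ hm
      rw [map_smul, hmul, F.orth _ _ (fun h => hm (Subtype.ext h.symm)), map_zero,
        LinearMap.zero_apply, smul_zero]
    · simp
  have hle : Submodule.span (E j) (Set.range u) ≤ LinearMap.range (S.rho j (1 - F.e 0)) := by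
    rw [Submodule.span_le]
    rintro _ ⟨i, rfl⟩
    refine ⟨u i, ?_⟩
    rw [hmul, sub_mul, one_mul, F.orth _ _ (Finset.mem_erase.1 i.2).1.symm, sub_zero]
  have := Submodule.finrank_mono hle
  rwa [finrank_span_eq_card hu, Fintype.card_coe, hs] at this

/-- An invertible operator does not carry the hyperbolic part into the anisotropic part. -/
theorem rho_one_sub_eq_zero (hF : F.Comparable) {j : ι}
    (hd : finrank (E j) (LinearMap.range (S.rho j (F.e 0))) < 2 * l) {a : Module.End (E j) (V j)}
    (ha : Function.Injective a)
    (h : ∀ v, S.rho j (1 - F.e 0) (a (S.rho j (1 - F.e 0) v)) = 0) :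
    S.rho j (1 - F.e 0) = 0 := by
  by_contra h0
  have h1 := S.two_mul_le_finrank hF h0
  have h2 : (LinearMap.range (S.rho j (1 - F.e 0))).map a ≤ LinearMap.range (S.rho j (F.e 0)) := by
    rintro _ ⟨_, ⟨v, rfl⟩, rfl⟩
    refine ⟨a (S.rho j (1 - F.e 0) v), (sub_eq_zero.1 ?_).symm⟩
    have := h v
    rw [map_sub, map_one] at this ⊢
    exact this
  have h3 := Submodule.finrank_mono h2
  rw [(Submodule.equivMapOfInjective a ha _).symm.finrank_eq] at h3
  omega

end Dimension

end SimpleReps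

/-! ### The level ideal in the simple representations. -/

namespace AugmentedLevel

variable {C : Type*} [Ring C] [StarRing C] {l : ℕ} {F : Frame C l} {K : Type*} [CommRing K]
  [Algebra K C] {U : Subgroup Cˣ} {L : AugmentedLevel F K U}

variable (L) in
/-- The part `(1 - e₀) I (1 - e₀)` of `I`. -/
def inner : AddSubgroup (C × C) where
  carrier := {x | x ∈ L.I ∧ diag (1 - F.e 0) * x = x ∧ x * diag (1 - F.e 0) = x}
  zero_mem' := ⟨zero_mem _, by simp, by simp⟩
  add_mem' := by
    rintro x y ⟨x1, x2, x3⟩ ⟨y1, y2, y3⟩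
    exact ⟨add_mem x1 y1, by rw [mul_add, x2, y2], by rw [add_mul, x3, y3]⟩
  neg_mem' := by
    rintro x ⟨x1, x2, x3⟩
    exact ⟨neg_mem x1, by rw [mul_neg, x2], by rw [neg_mul, x3]⟩

theorem e_one_sub_mul_self : (1 - F.e 0) * (1 - F.e 0) = 1 - F.e 0 := by
  rw [mul_sub, mul_one, sub_mul, one_mul, F.idem, sub_self, sub_zero]

theorem one_sub_e_mul_self : diag (1 - F.e 0) * diag (1 - F.e 0) = diag (1 - F.e 0) := by
  rw [← map_mul, e_one_sub_mul_self]

theorem diag_one_sub_mem_normalizer : diag (1 - F.e 0) ∈ L.normalizer := by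
  rw [map_sub, map_one]
  exact one_sub_d_mem_normalizer 0

theorem mul_mul_mem_inner {x : C × C} (hx : x ∈ L.I) :
    diag (1 - F.e 0) * x * diag (1 - F.e 0) ∈ L.inner :=
  ⟨mul_normalizer_mem (normalizer_mul_mem diag_one_sub_mem_normalizer hx)
    diag_one_sub_mem_normalizer, by rw [← mul_assoc, ← mul_assoc, one_sub_e_mul_self],
    by rw [mul_assoc, one_sub_e_mul_self]⟩

theorem dbar_mem_inner {x : C × C} (hx : x ∈ L.inner) : dbar x ∈ L.inner := by
  obtain ⟨h1, h2, h3⟩ := hx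
  have e : dbar (diag (1 - F.e 0)) = diag (1 - F.e 0) := by
    rw [dbar_diag, star_sub, star_one, F.star_e, neg_zero]
  exact ⟨L.bar_mem _ h1, by rw [← e, ← dbar_mul, h3], by rw [← e, ← dbar_mul, h2]⟩

theorem diag_corner_mul_mem_inner {x : C × C} (hx : x ∈ L.inner) (b c : C) :
    diag ((1 - F.e 0) * b * (1 - F.e 0)) * x * diag ((1 - F.e 0) * c * (1 - F.e 0)) ∈ L.inner := by
  refine ⟨mul_normalizer_mem (normalizer_mul_mem (corner_mem_normalizer b) hx.1)
    (corner_mem_normalizer c), ?_, ?_⟩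
  · simp only [map_mul, ← mul_assoc, one_sub_e_mul_self]
  · simp only [map_mul, mul_assoc, one_sub_e_mul_self]

end AugmentedLevel

namespace SimpleReps

variable {C : Type*} [Ring C] [StarRing C] {l : ℕ} {F : Frame C l} {K : Type*} [CommRing K]
  [Algebra K C] {U : Subgroup Cˣ} {ι : Type*} {E : ι → Type*} [∀ j, DivisionRing (E j)]
  {V : ι → Type*} [∀ j, AddCommGroup (V j)] [∀ j, Module (E j) (V j)] (S : SimpleReps C E V)
  (L : AugmentedLevel F K U)

/-- The ideal of the level acts by zero. -/
def Vanishes (j : ι) (c : Bool) : Prop := ∀ x ∈ L.inner, S.act j c x = 0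

/-- The ideal of the level acts in the same way through both projections. -/
def Linked (j : ι) : Prop := ∀ x ∈ L.inner, ∀ c c', S.act j c x = S.act j c' x

variable {S L}

/-- If the two projections are not linked, the ideal contains elements acting in one of them
only. -/
theorem exists_separating {j : ι} {c : Bool} (h : ¬S.Vanishes L j c) (hl : ¬S.Linked L j) :
    ∃ x ∈ L.inner, S.act j c x ≠ 0 ∧ S.act j (!c) x = 0 := by
  obtain ⟨x, hx, w, hw⟩ : ∃ x ∈ L.inner, ∃ w, S.act j c x w ≠ 0 := by
    by_contra! h'
    exact h fun x hx => LinearMap.ext (h' x hx)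
  obtain ⟨y, hy, u, hu⟩ : ∃ y ∈ L.inner, ∃ u, S.act j c y u - S.act j (!c) y u ≠ 0 := by
    by_contra! h'
    refine hl fun y hy c₁ c₂ => LinearMap.ext fun u => ?_
    have := sub_eq_zero.1 (h' y hy u)
    cases c <;> cases c₁ <;> cases c₂ <;> first | rfl | exact this | exact this.symm
  obtain ⟨ξ, hξ⟩ := exists_dual_eq_one (E := E j) hu
  obtain ⟨b, hb, -⟩ := S.exists_rho_eq j (ξ.smulRight w)
  -- The coordinate of `y` seen by the other projection: `y - diag s` acts there by zero, and
  -- through `c` by the difference of the two actions of `y`.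
  let s : C := if c then y.2 else y.1
  have hs (c' : Bool) : S.act j c' (diag s) = S.act j (!c) y := by
    rw [act_diag]
    cases c <;> rfl
  have hs1 : (1 - F.e 0) * s * (1 - F.e 0) = s := by
    have h1 := hy.2.1
    have h2 := hy.2.2
    cases c
    · change (1 - F.e 0) * y.1 * (1 - F.e 0) = y.1
      rw [show (1 - F.e 0) * y.1 = y.1 from congrArg Prod.fst h1]
      exact congrArg Prod.fst h2
    · change (1 - F.e 0) * y.2 * (1 - F.e 0) = y.2
      rw [show (1 - F.e 0) * y.2 = y.2 from congrArg Prod.snd h1]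
      exact congrArg Prod.snd h2
  have hsN : diag s ∈ L.normalizer := by
    rw [← hs1]; exact AugmentedLevel.corner_mem_normalizer s
  have e1 : x * diag (1 - F.e 0) = x := hx.2.2
  have e2 : diag (1 - F.e 0) * (y - diag s) = y - diag s := by
    rw [mul_sub, hy.2.1, ← map_mul, ← hs1, ← mul_assoc, ← mul_assoc,
      AugmentedLevel.e_one_sub_mul_self]
  have e3 : (y - diag s) * diag (1 - F.e 0) = y - diag s := by
    rw [sub_mul, hy.2.2, ← map_mul, ← hs1, mul_assoc, AugmentedLevel.e_one_sub_mul_self]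
  have hact (c' : Bool) : S.act j c' (x * diag ((1 - F.e 0) * b * (1 - F.e 0)) * (y - diag s)) =
      S.act j c' x * ξ.smulRight w * (S.act j c' y - S.act j (!c) y) := by
    have : x * diag ((1 - F.e 0) * b * (1 - F.e 0)) * (y - diag s) =
        x * diag b * (y - diag s) := by
      rw [map_mul, map_mul, ← mul_assoc, ← mul_assoc, e1, mul_assoc _ (diag (1 - F.e 0)), e2]
    rw [this, map_mul, map_mul, map_sub, hs, act_diag, hb]
  refine ⟨x * diag ((1 - F.e 0) * b * (1 - F.e 0)) * (y - diag s), ⟨?_, ?_, ?_⟩, ?_, ?_⟩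
  · rw [mul_sub]
    have h1 := AugmentedLevel.mul_normalizer_mem hx.1
      (AugmentedLevel.corner_mem_normalizer (L := L) b)
    exact sub_mem (AugmentedLevel.mul_normalizer_mem h1 (AugmentedLevel.I_le_normalizer hy.1))
      (AugmentedLevel.mul_normalizer_mem h1 hsN)
  · rw [← mul_assoc, ← mul_assoc, hx.2.1]
  · rw [mul_assoc _ _ (diag (1 - F.e 0)), e3]
  · intro h0
    rw [hact] at h0
    apply hw
    have := LinearMap.congr_fun h0 u
    simpa [hξ] using this
  · rw [hact, sub_self, mul_zero]

variable [∀ j, FiniteDimensional (E j) (V j)]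

/-- Operators in the corner are realized by elements of the ideal. -/
theorem exists_block {j : ι} {c : Bool} (h : ¬S.Vanishes L j c) {ψ : Module.End (E j) (V j)}
    (h1 : S.rho j (1 - F.e 0) * ψ = ψ) (h2 : ψ * S.rho j (1 - F.e 0) = ψ) :
    ∃ z ∈ L.inner, (∀ c', c' = c ∨ S.Linked L j → S.act j c' z = ψ) ∧
      (∀ c', ¬(c' = c ∨ S.Linked L j) → S.act j c' z = 0) ∧
      ∀ i, i ≠ j → ∀ c', S.act i c' z = 0 := by
  obtain ⟨x, hx, hxc, hx1, hx2⟩ : ∃ x ∈ L.inner, S.act j c x ≠ 0 ∧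
      (∀ c', c' = c ∨ S.Linked L j → S.act j c' x = S.act j c x) ∧
      (∀ c', ¬(c' = c ∨ S.Linked L j) → S.act j c' x = 0) := by
    by_cases hl : S.Linked L j
    · obtain ⟨x, hx, hxc⟩ : ∃ x ∈ L.inner, S.act j c x ≠ 0 := by
        by_contra! h'
        exact h h'
      exact ⟨x, hx, hxc, fun c' _ => hl x hx _ _, fun c' hc' => absurd (Or.inr hl) hc'⟩
    · obtain ⟨x, hx, hxc, hxc'⟩ := exists_separating h hl
      refine ⟨x, hx, hxc, ?_, ?_⟩
      · rintro c' (rfl | h'); exacts [rfl, absurd h' hl]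
      · intro c' hc'
        push Not at hc'
        rw [← hxc', Bool.eq_not.2 hc'.1]
  -- The operators `A i`, `B i` are lifted to elements of `C` that vanish in every other simple
  -- representation, so multiplying by them isolates the block `j`.
  obtain ⟨n, A, B, hAB⟩ := exists_sum_mul_mul hxc ψ
  choose p hp hp' using fun i => S.exists_rho_eq j (A i)
  choose q hq hq' using fun i => S.exists_rho_eq j (B i)
  have hcorner {T : Module.End (E j) (V j)} (c' : Bool) (hT : S.act j c' x = T) :
      S.act j c' (∑ i, diag ((1 - F.e 0) * p i * (1 - F.e 0)) * x *
        diag ((1 - F.e 0) * q i * (1 - F.e 0))) =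
      S.rho j (1 - F.e 0) * (∑ i, A i * T * B i) * S.rho j (1 - F.e 0) := by
    have hT1 : S.rho j (1 - F.e 0) * T = T := by
      rw [← hT, ← S.act_diag j c', ← map_mul, hx.2.1]
    have hT2 : T * S.rho j (1 - F.e 0) = T := by
      rw [← hT, ← S.act_diag j c', ← map_mul, hx.2.2]
    rw [map_sum, Finset.mul_sum, Finset.sum_mul]
    refine Finset.sum_congr rfl fun i _ => ?_
    rw [map_mul, map_mul, act_diag, act_diag, hT, map_mul, map_mul, map_mul, map_mul, hp, hq]
    simp only [mul_assoc]
    rw [← mul_assoc _ T, hT1, ← mul_assoc T, hT2]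
  refine ⟨∑ i, diag ((1 - F.e 0) * p i * (1 - F.e 0)) * x *
    diag ((1 - F.e 0) * q i * (1 - F.e 0)), sum_mem fun i _ => AugmentedLevel.diag_corner_mul_mem_inner hx (p i) (q i),
    fun c' hc' => ?_, fun c' hc' => ?_, fun i hi c' => ?_⟩
  · rw [hcorner c' (hx1 c' hc'), hAB, h1, h2]
  · rw [hcorner c' (hx2 c' hc')]
    simp
  · rw [map_sum]
    refine Finset.sum_eq_zero fun m _ => ?_
    rw [map_mul, map_mul, act_diag, map_mul, map_mul, hp' m i hi, mul_zero, zero_mul, zero_mul,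
      zero_mul]

theorem exists_realization_at (j : ι) {ψ : Bool → Module.End (E j) (V j)}
    (h1 : ∀ c, S.rho j (1 - F.e 0) * ψ c = ψ c) (h2 : ∀ c, ψ c * S.rho j (1 - F.e 0) = ψ c)
    (h0 : ∀ c, S.Vanishes L j c → ψ c = 0) (hl : S.Linked L j → ψ true = ψ false) :
    ∃ z ∈ L.inner, (∀ c, S.act j c z = ψ c) ∧ ∀ i, i ≠ j → ∀ c, S.act i c z = 0 := by
  by_cases hlj : S.Linked L j
  · by_cases hv : S.Vanishes L j true
    · refine ⟨0, zero_mem _, fun c => ?_, fun i _ c => map_zero _⟩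
      have hv' : S.Vanishes L j c := by
        intro x hx
        rw [hlj x hx c true, hv x hx]
      rw [map_zero, h0 c hv']
    · obtain ⟨z, hz, hz1, -, hz3⟩ := exists_block hv (h1 true) (h2 true)
      refine ⟨z, hz, fun c => ?_, hz3⟩
      rw [hz1 c (Or.inr hlj)]
      cases c
      exacts [hl hlj, rfl]
  · have key : ∀ c, ∃ z ∈ L.inner, S.act j c z = ψ c ∧ S.act j (!c) z = 0 ∧
        ∀ i, i ≠ j → ∀ c, S.act i c z = 0 := by
      intro c
      by_cases hv : S.Vanishes L j c
      · exact ⟨0, zero_mem _, by rw [map_zero, h0 c hv], map_zero _, fun i _ c => map_zero _⟩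
      · obtain ⟨z, hz, hz1, hz2, hz3⟩ := exists_block hv (h1 c) (h2 c)
        exact ⟨z, hz, hz1 c (Or.inl rfl), hz2 _ (by simp [hlj]), hz3⟩
    obtain ⟨z, hz, hz1, hz2, hz3⟩ := key true
    obtain ⟨y, hy, hy1, hy2, hy3⟩ := key false
    refine ⟨z + y, add_mem hz hy, fun c => ?_, fun i hi c => ?_⟩
    · rw [map_add]
      cases c
      · rw [hy1, show S.act j false z = 0 from hz2, zero_add]
      · rw [hz1, show S.act j true y = 0 from hy2, add_zero]
    · rw [map_add, hz3 i hi, hy3 i hi, add_zero]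

theorem exists_realization [Fintype ι] {ψ : ∀ j, Bool → Module.End (E j) (V j)}
    (h1 : ∀ j c, S.rho j (1 - F.e 0) * ψ j c = ψ j c)
    (h2 : ∀ j c, ψ j c * S.rho j (1 - F.e 0) = ψ j c)
    (h0 : ∀ j c, S.Vanishes L j c → ψ j c = 0)
    (hl : ∀ j, S.Linked L j → ψ j true = ψ j false) :
    ∃ z ∈ L.inner, ∀ j c, S.act j c z = ψ j c := by
  choose z hz hz1 hz2 using fun j =>
    exists_realization_at (S := S) (L := L) j (h1 j) (h2 j) (h0 j) (hl j)
  refine ⟨∑ j, z j, sum_mem fun j _ => hz j, fun j c => ?_⟩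
  rw [map_sum, Finset.sum_eq_single j (fun i _ hi => hz2 i j hi.symm c) (by simp), hz1]

end SimpleReps

end OddUnitary

namespace OddUnitary

open Heis Module

/-! ### Factorization through a kernel and rank one perturbations. -/

section LinearAlgebra

variable {E V : Type*} [DivisionRing E] [AddCommGroup V] [Module E V]

theorem exists_mul_eq_of_ker_le {X Y : Module.End E V} (h : ∀ v, X v = 0 → Y v = 0) :
    ∃ ψ : Module.End E V, ψ * X = Y := by
  have hle : LinearMap.ker X ≤ LinearMap.ker Y := fun v hv => h v hv
  obtain ⟨ψ, hψ⟩ := LinearMap.exists_extend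
    (((LinearMap.ker X).liftQ Y hle).comp X.quotKerEquivRange.symm.toLinearMap)
  refine ⟨ψ, LinearMap.ext fun v => ?_⟩
  have h1 := LinearMap.congr_fun hψ ⟨X v, v, rfl⟩
  have h2 : X.quotKerEquivRange.symm ⟨X v, v, rfl⟩ = Submodule.Quotient.mk v := by
    rw [LinearEquiv.symm_apply_eq]; rfl
  simp only [LinearMap.comp_apply, Submodule.subtype_apply, LinearEquiv.coe_coe, h2] at h1
  exact h1

variable [FiniteDimensional E V]

/-- An operator on the finite dimensional space `QV` that is not injective is not surjective. -/
theorem exists_notMem_range {X Q : Module.End E V} (h1 : Q * X = X) (h2 : X * Q = X)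
    (hQ : Q * Q = Q) {v : V} (hv : Q v = v) (hv0 : v ≠ 0) (hX : X v = 0) :
    ∃ y, Q y = y ∧ y ∉ LinearMap.range X := by
  by_contra! h
  have e1 : LinearMap.range X = LinearMap.range Q := by
    apply le_antisymm
    · rintro _ ⟨w, rfl⟩
      exact ⟨X w, LinearMap.congr_fun h1 w⟩
    · rintro _ ⟨w, rfl⟩
      exact h _ (LinearMap.congr_fun hQ w)
  have e2 : LinearMap.ker Q ≤ LinearMap.ker X := by
    intro w hw
    rw [LinearMap.mem_ker] at hw ⊢
    rw [← h2, Module.End.mul_apply, hw, map_zero]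
  have e3 : LinearMap.ker Q = LinearMap.ker X := by
    apply Submodule.eq_of_le_of_finrank_eq e2
    have := LinearMap.finrank_range_add_finrank_ker X
    have := LinearMap.finrank_range_add_finrank_ker Q
    rw [e1] at *
    omega
  have : v ∈ LinearMap.ker Q := by rw [e3]; exact hX
  exact hv0 (by rw [← hv]; exact this)

/-- Correcting vectors by multiples of the kernel vector `v` shows that the new range contains the
old one; it contains `y` as well. -/
theorem finrank_range_lt {X : Module.End E V} {y v : V} {η : V →ₗ[E] E}
    (hy : y ∉ LinearMap.range X) (hv : X v = 0) (hη : η v ≠ 0) :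
    finrank E (LinearMap.range X) < finrank E (LinearMap.range (X + η.smulRight y)) := by
  apply Submodule.finrank_lt_finrank_of_lt
  refine lt_of_le_of_ne ?_ fun h => hy ?_
  · rintro _ ⟨w, rfl⟩
    refine ⟨w - (η w * (η v)⁻¹) • v, ?_⟩
    simp [hv, hη]
  · rw [h]
    exact ⟨(η v)⁻¹ • v, by simp [hv, hη]⟩

theorem isUnit_one_sub_of_mul_self_eq_zero {R : Type*} [Ring R] {N : R} (h : N * N = 0) :
    IsUnit (1 - N) :=
  ⟨⟨1 - N, 1 + N, by simp [sub_mul, mul_add, h], by simp [mul_sub, add_mul, h]⟩, rfl⟩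

end LinearAlgebra

namespace AugmentedLevel

variable {C : Type*} [Ring C] [StarRing C] {l : ℕ} {F : Frame C l} {K : Type*} [CommRing K]
  [Algebra K C] {U : Subgroup Cˣ} {L : AugmentedLevel F K U}

theorem inv_mem_GU' {g : Cˣ} (hg : g ∈ L.GU') : g⁻¹ ∈ L.GU' := fun f hf => by
  rw [inv_inv]
  exact ⟨(hg f hf).2, (hg f hf).1⟩

end AugmentedLevel

/-! ### Corners of maximal rank: the rows other than `0` and `±k`. -/

namespace SimpleReps

open AugmentedLevel

variable {C : Type*} [Ring C] [StarRing C] {l : ℕ} {F : Frame C l} {K : Type*} [CommRing K]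
  [Algebra K C] {U : Subgroup Cˣ} {ι : Type*} {E : ι → Type*} [∀ j, DivisionRing (E j)]
  {V : ι → Type*} [∀ j, AddCommGroup (V j)] [∀ j, Module (E j) (V j)] {S : SimpleReps C E V}
  {L : AugmentedLevel F K U}

theorem act_mul_apply (j : ι) (c : Bool) (x y : C × C) (v : V j) :
    S.act j c (x * y) v = S.act j c x (S.act j c y v) := by
  rw [map_mul]; rfl

theorem act_injective (j : ι) (c : Bool) (g : Cˣ) : Function.Injective (S.act j c (alpha g)) :=
  Function.LeftInverse.injective (g := S.act j c (alpha g⁻¹)) fun v => by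
    rw [← act_mul_apply, alpha_inv_mul_alpha, map_one, Module.End.one_apply]

theorem act_eq_of_block {j : ι} {c c' : Bool} (h : c' = c ∨ S.Linked L j) {x : C × C}
    (hx : x ∈ L.inner) : S.act j c' x = S.act j c x := by
  rcases h with rfl | h
  exacts [rfl, h x hx _ _]

variable [∀ j, FiniteDimensional (E j) (V j)]

/-- Through linked projections, the hyperbolic part of `α(g)` acts in the same way up to a
scalar. -/
theorem exists_scalar (hl : 3 ≤ l) (hF : F.Comparable)
    (hU : ∀ g ∈ U, star g.val * g.val = 1)
    (hd : ∀ j, finrank (E j) (LinearMap.range (S.rho j (F.e 0))) < 2 * l) {g : Cˣ}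
    (hg : g ∈ L.GU') {j : ι} (hne : S.rho j (1 - F.e 0) ≠ 0) {c c' : Bool}
    (h : c' = c ∨ S.Linked L j) :
    ∃ r : E j, r ≠ 0 ∧ ∀ v, S.act j c' (diag (1 - F.e 0) * alpha g * diag (1 - F.e 0)) v =
      r • S.act j c (diag (1 - F.e 0) * alpha g * diag (1 - F.e 0)) v := by
  rcases h with rfl | h
  · exact ⟨1, one_ne_zero, fun v => (one_smul _ _).symm⟩
  have hnz (g : Cˣ) (c : Bool) :
      ∃ v, S.act j c (diag (1 - F.e 0) * alpha g * diag (1 - F.e 0)) v ≠ 0 := by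
    by_contra! h0
    refine hne (S.rho_one_sub_eq_zero hF (hd j) (S.act_injective j c g) fun v => ?_)
    have := h0 v
    rwa [act_mul_apply, act_mul_apply, act_diag] at this
  obtain ⟨v₀, hv₀⟩ := hnz g⁻¹ c'
  obtain ⟨ξ, hξ⟩ := exists_dual_eq_one (E := E j) hv₀
  have key (v : V j) : S.act j c' (diag (1 - F.e 0) * alpha g * diag (1 - F.e 0)) v =
      ξ (S.act j c (diag (1 - F.e 0) * alpha g⁻¹ * diag (1 - F.e 0)) v₀) •
        S.act j c (diag (1 - F.e 0) * alpha g * diag (1 - F.e 0)) v := by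
    -- With `b` acting as a rank one operator, the corner of `α(g) b α(g)⁻¹` sends `v₀` to a scalar
    -- multiple of the hyperbolic part of `α(g)` at `v`. Commutation modulo `I` and linkage equate
    -- this vector for the two projections.
    obtain ⟨b, hb, -⟩ := S.exists_rho_eq j (ξ.smulRight v)
    have h1 := (corner_mem_commutesMod hl hF hU hg (c := (1 - F.e 0) * b * (1 - F.e 0))
      (by rw [← mul_assoc, ← mul_assoc, mul_sub (F.e 0), mul_one, F.idem, sub_self, zero_mul,
        zero_mul])
      (by rw [mul_assoc, sub_mul 1 (F.e 0) (F.e 0), one_mul, F.idem, sub_self, mul_zero])).2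
    have h2 := h _ (mul_mul_mem_inner h1) c' c
    rw [mul_sub (diag (1 - F.e 0)), sub_mul _ _ (diag (1 - F.e 0)), map_sub (S.act j c'),
      map_sub (S.act j c), ← map_mul diag, ← map_mul diag, act_diag, act_diag,
      sub_left_inj] at h2
    have e (c : Bool) : S.act j c (diag (1 - F.e 0) * (alpha g *
        diag ((1 - F.e 0) * b * (1 - F.e 0)) * alpha g⁻¹) * diag (1 - F.e 0)) v₀ =
        ξ (S.act j c (diag (1 - F.e 0) * alpha g⁻¹ * diag (1 - F.e 0)) v₀) •
        S.act j c (diag (1 - F.e 0) * alpha g * diag (1 - F.e 0)) v := by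
      rw [map_mul diag, map_mul diag, show diag (1 - F.e 0) * (alpha g *
        (diag (1 - F.e 0) * diag b * diag (1 - F.e 0)) * alpha g⁻¹) * diag (1 - F.e 0) =
        (diag (1 - F.e 0) * alpha g * diag (1 - F.e 0)) * (diag b *
          (diag (1 - F.e 0) * alpha g⁻¹ * diag (1 - F.e 0))) by simp only [mul_assoc],
        act_mul_apply, act_mul_apply j c (diag b), act_diag, hb, LinearMap.smulRight_apply, map_smul]
    have h3 := LinearMap.congr_fun h2 v₀
    rw [e, e, hξ, one_smul] at h3
    exact h3
  refine ⟨_, fun h0 => ?_, key⟩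
  obtain ⟨v, hv⟩ := hnz g c'
  exact hv (by rw [key, h0, zero_smul])

/-- Where the level acts by zero, `e_k α(g)⁻¹ e_k α(g) e_k` acts as `e_k`, so the corner is
injective on `e_k V`. -/
theorem eq_zero_of_vanishes (hl : 3 ≤ l) (hF : F.Comparable)
    (hU : ∀ g ∈ U, star g.val * g.val = 1) {g : Cˣ} (hg : g ∈ L.GU') {k : ℤ} (hk : k ≠ 0)
    {j : ι} {c : Bool} (h : S.Vanishes L j c) {v : V j} (hv : S.act j c (F.d k) v = v)
    (hX : S.act j c (F.d k * alpha g) v = 0) : v = 0 := by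
  have h1 := (diag_mem_commutesMod hl hF hU (inv_mem_GU' hg) hk hk (F.idem k) (F.idem k)).2
  rw [inv_inv] at h1
  have h2 := h _ (mul_mul_mem_inner h1)
  have h3 : S.act j c (F.d k * (diag (1 - F.e 0) * (alpha g⁻¹ * F.d k * alpha g - F.d k) *
      diag (1 - F.e 0)) * F.d k) = 0 := by
    rw [map_mul, map_mul, Frame.d, h2, mul_zero, zero_mul]
  have e : F.d k * (diag (1 - F.e 0) * (alpha g⁻¹ * F.d k * alpha g - F.d k) *
      diag (1 - F.e 0)) * F.d k = F.d k * alpha g⁻¹ * (F.d k * alpha g) * F.d k - F.d k := by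
    rw [mul_assoc (F.d k), mul_assoc _ _ (F.d k), one_sub_mul_d hk, ← mul_assoc, ← mul_assoc,
      d_mul_one_sub hk, mul_sub, sub_mul, F.d_mul_self, F.d_mul_self]
    simp only [mul_assoc]
  rw [e, map_sub, sub_eq_zero] at h3
  have h4 := LinearMap.congr_fun h3 v
  rw [act_mul_apply, act_mul_apply, hv, hX, map_zero] at h4
  exact h4.symm

section Rank

variable [Fintype ι]

variable (S F) in
/-- The total rank of the corner `e_k a e_k`. -/
noncomputable def rank (k : ℤ) (a : C × C) : ℕ :=
  ∑ p : ι × Bool, finrank (E p.1) (LinearMap.range (S.act p.1 p.2 (F.d k * a * F.d k)))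

variable (S L) in
/-- No elementary transformation that fixes the row `-k` increases the rank of the corner. -/
def Maximal (k : ℤ) (g : Cˣ) : Prop :=
  ∀ f ∈ L.level.elementary, F.d (-k) * alpha f = F.d (-k) →
    S.rank F k (alpha (f * g)) ≤ S.rank F k (alpha g)

theorem Maximal.mul {k : ℤ} {f g : Cˣ} (h : S.Maximal L k g) (hf : f ∈ L.level.elementary)
    (hf' : F.d (-k) * alpha f = F.d (-k))
    (hr : S.rank F k (alpha (f * g)) = S.rank F k (alpha g)) : S.Maximal L k (f * g) := by
  intro f' hf'' hf'''
  rw [hr, ← mul_assoc]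
  exact h _ (Subgroup.mul_mem _ hf'' hf) (by rw [alpha_mul, ← mul_assoc, hf''', hf'])

theorem exists_maximal (k : ℤ) (g : Cˣ) : ∃ f ∈ L.level.elementary,
    F.d (-k) * alpha f = F.d (-k) ∧ S.Maximal L k (f * g) := by
  classical
  let P : ℕ → Prop := fun n => ∃ f ∈ L.level.elementary, F.d (-k) * alpha f = F.d (-k) ∧
    S.rank F k (alpha (f * g)) = n
  have hb : ∀ n, P n → n ≤ ∑ p : ι × Bool, finrank (E p.1) (V p.1) := by
    rintro _ ⟨f, -, -, rfl⟩
    exact Finset.sum_le_sum fun p _ => Submodule.finrank_le _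
  have h0 : P (S.rank F k (alpha g)) := ⟨1, one_mem _, by simp, by rw [one_mul]⟩
  obtain ⟨f, hf, hf', hr⟩ := Nat.findGreatest_spec (hb _ h0) h0
  refine ⟨f, hf, hf', fun f' h1 h2 => ?_⟩
  rw [hr]
  have : P (S.rank F k (alpha (f' * (f * g)))) := ⟨f' * f, Subgroup.mul_mem _ h1 hf,
    by rw [alpha_mul, ← mul_assoc, h2, hf'], by rw [mul_assoc]⟩
  exact Nat.le_findGreatest (hb _ this) this

variable {g : Cˣ} {k : ℤ}

/-- If row `n` did not kill `v`, a transvection in position `(k, n)` could add to the corner a rank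
one operator sending `v` to a vector `y` outside its image, which raises the rank. In a linked block
the same change happens through the other projection, where the relevant rows are proportional by
`exists_scalar`, so the rank rises there too; all other blocks are unchanged. -/
theorem Maximal.act_d_eq_zero (hm : S.Maximal L k g) (hl : 3 ≤ l) (hF : F.Comparable)
    (hU : ∀ g ∈ U, star g.val * g.val = 1)
    (hd : ∀ j, finrank (E j) (LinearMap.range (S.rho j (F.e 0))) < 2 * l)
    (hg : g ∈ L.GU') (hk : k ≠ 0) {j : ι} {c : Bool} {v : V j} (hv : S.act j c (F.d k) v = v)
    (hX : S.act j c (F.d k * alpha g) v = 0) {n : ℤ} (hn0 : n ≠ 0) (hn1 : n ≠ k) (hn2 : n ≠ -k) :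
    S.act j c (F.d n * alpha g) v = 0 := by
  by_contra hu
  have hv0 : v ≠ 0 := fun h => hu (by rw [h, map_zero])
  have hnv : ¬S.Vanishes L j c := fun h => hv0 (eq_zero_of_vanishes hl hF hU hg hk h hv hX)
  have hne : S.rho j (1 - F.e 0) ≠ 0 := by
    intro h
    apply hv0
    rw [← hv, ← one_sub_mul_d hk, act_mul_apply, act_diag, h, LinearMap.zero_apply]
  obtain ⟨y, hy, hyX⟩ := exists_notMem_range (X := S.act j c (F.d k * alpha g * F.d k))
    (Q := S.act j c (F.d k)) (v := v)
    (by rw [← map_mul, ← mul_assoc, ← mul_assoc, F.d_mul_self])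
    (by rw [← map_mul, mul_assoc, F.d_mul_self]) (by rw [← map_mul, F.d_mul_self]) hv hv0
    (by rw [act_mul_apply, hv, hX])
  obtain ⟨ξ, hξ⟩ := exists_dual_eq_one (E := E j) hu
  set ψ : Module.End (E j) (V j) := (ξ.comp (S.act j c (F.d n))).smulRight y with hψ
  have hψk : S.act j c (F.d k) * ψ = ψ := by
    ext w; simp [hψ, hy]
  have hψn : ψ * S.act j c (F.d n) = ψ := by
    ext w; simp [hψ, ← act_mul_apply]
  obtain ⟨z, hz, hz1, hz2, hz3⟩ := exists_block hnv (ψ := ψ)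
    (by rw [← hψk, ← mul_assoc, ← S.act_diag j c, ← map_mul, one_sub_mul_d hk])
    (by rw [← hψn, mul_assoc, ← S.act_diag j c, ← map_mul, d_mul_one_sub hn0])
  set x := F.d k * z * F.d n with hx
  have hxI : x ∈ L.I := mul_normalizer_mem (normalizer_mul_mem (d_mem_normalizer k) hz.1)
    (d_mem_normalizer n)
  have hx1 : F.d k * x = x := by rw [hx, ← mul_assoc, ← mul_assoc, F.d_mul_self]
  have hx2 : x * F.d n = x := by rw [hx, mul_assoc, F.d_mul_self]
  have hx3 : F.d (-n) * dbar x = dbar x := by rw [← F.dbar_d, ← dbar_mul, hx2]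
  obtain ⟨f, hf, hfa⟩ := exists_elementary_tau₂ hk hn0 hn1.symm (by omega) hxI hx1 hx2
  have hrow (m : ℤ) (h1 : m ≠ -n) : F.d m * alpha f = F.d m + F.d m * x := by
    have : F.d m * dbar x = 0 := by rw [← hx3, ← mul_assoc, F.d_mul_of_ne h1, zero_mul]
    rw [hfa, mul_add, mul_sub, this, sub_zero, mul_one]
  have hle := hm f hf (by
    rw [hrow _ (by omega), ← hx1, ← mul_assoc, F.d_mul_of_ne (by omega), zero_mul, add_zero])
  have hnew (i : ι) (c' : Bool) : S.act i c' (F.d k * alpha (f * g) * F.d k) =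
      S.act i c' (F.d k * alpha g * F.d k) + S.act i c' x * S.act i c' (alpha g * F.d k) := by
    rw [← map_mul, ← map_add, alpha_mul, ← mul_assoc (F.d k), hrow _ (by omega), hx1, add_mul,
      add_mul, mul_assoc x]
  have hzero (i : ι) (c' : Bool) (h : S.act i c' z = 0) : S.act i c' x = 0 := by
    rw [hx, map_mul, map_mul, h, mul_zero, zero_mul]
  have hblock (c' : Bool) (hc' : c' = c ∨ S.Linked L j) :
      finrank (E j) (LinearMap.range (S.act j c' (F.d k * alpha g * F.d k))) <
        finrank (E j) (LinearMap.range (S.act j c' (F.d k * alpha (f * g) * F.d k))) := by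
    -- The scalar transfers `X v = 0`, `y ∉ range X` and the nonvanishing of row `n` at `v` from the
    -- projection `c` to `c'`.
    obtain ⟨r, hr, hrv⟩ := exists_scalar hl hF hU hd hg hne hc'
    have hrow' (m : ℤ) (h0 : m ≠ 0) (w : V j) : S.act j c' (F.d m * alpha g * F.d k) w =
        r • S.act j c (F.d m * alpha g * F.d k) w := by
      have e : F.d m * alpha g * F.d k =
          F.d m * (diag (1 - F.e 0) * alpha g * diag (1 - F.e 0)) * F.d k := by
        conv_lhs => rw [← d_mul_one_sub h0, ← one_sub_mul_d hk]
        simp only [mul_assoc]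
      generalize diag (1 - F.e 0) * alpha g * diag (1 - F.e 0) = b at e hrv
      rw [e, act_mul_apply, act_mul_apply, act_mul_apply, act_mul_apply, Frame.d, Frame.d,
        act_diag, act_diag, act_diag, act_diag, hrv, map_smul]
    have hxc : S.act j c' x = ψ := by
      rw [hx, map_mul, map_mul, hz1 c' hc', Frame.d, Frame.d, act_diag, act_diag,
        ← S.act_diag j c, ← S.act_diag j c (F.e n)]
      exact (congrArg (· * S.act j c (F.d n)) hψk).trans hψn
    have hη : S.act j c' x * S.act j c' (alpha g * F.d k) =
        (ξ.comp (S.act j c' (F.d n * alpha g * F.d k))).smulRight y := by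
      rw [hxc]
      ext w
      simp only [hψ, Module.End.mul_apply, LinearMap.smulRight_apply, LinearMap.comp_apply]
      rw [mul_assoc, act_mul_apply j c' (F.d n), Frame.d, act_diag, act_diag]
    rw [hnew, hη]
    apply finrank_range_lt (v := v)
    · rintro ⟨w, hw⟩
      exact hyX ⟨r • w, by rw [map_smul, ← hrow' k hk, hw]⟩
    · rw [hrow' k hk, act_mul_apply, hv, hX, smul_zero]
    · rw [LinearMap.comp_apply, hrow' n hn0, act_mul_apply, hv, map_smul, hξ]
      simpa using hr
  refine absurd hle (not_le.2 (Finset.sum_lt_sum ?_ ⟨(j, c), Finset.mem_univ _,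
    hblock c (Or.inl rfl)⟩))
  rintro ⟨i, c'⟩ -
  by_cases hi : i = j
  · subst hi
    by_cases hc' : c' = c ∨ S.Linked L i
    · exact (hblock c' hc').le
    · rw [hnew, hzero _ _ (hz2 c' hc'), zero_mul, add_zero]
  · rw [hnew, hzero _ _ (hz3 i hi c'), zero_mul, add_zero]

end Rank

end SimpleReps

end OddUnitary

namespace OddUnitary

open Heis Module

theorem isUnit_dbar {C : Type*} [Ring C] [StarRing C] {a : C × C} (h : IsUnit a) :
    IsUnit (dbar a) := by
  obtain ⟨u, rfl⟩ := h
  refine ⟨⟨dbar u, dbar (u⁻¹).val, ?_, ?_⟩, rfl⟩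
  · rw [← dbar_mul, u.inv_mul, dbar_one]
  · rw [← dbar_mul, u.mul_inv, dbar_one]

theorem finrank_range_unit_mul {E V : Type*} [DivisionRing E] [AddCommGroup V] [Module E V]
    {u : Module.End E V} (hu : IsUnit u) (X : Module.End E V) :
    finrank E (LinearMap.range (u * X)) = finrank E (LinearMap.range X) := by
  have hinj : Function.Injective u := ((Module.End.isUnit_iff u).1 hu).1
  rw [show LinearMap.range (u * X) = (LinearMap.range X).map u from LinearMap.range_comp _ _]
  exact (Submodule.equivMapOfInjective u hinj _).symm.finrank_eq

/-! ### Corners of maximal rank: the rows `-k` and `0`, and injectivity. -/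

namespace SimpleReps

open AugmentedLevel

variable {C : Type*} [Ring C] [StarRing C] {l : ℕ} {F : Frame C l} {K : Type*} [CommRing K]
  [Algebra K C] {U : Subgroup Cˣ} {ι : Type*} {E : ι → Type*} [∀ j, DivisionRing (E j)]
  {V : ι → Type*} [∀ j, AddCommGroup (V j)] [∀ j, Module (E j) (V j)] {S : SimpleReps C E V}
  {L : AugmentedLevel F K U} [∀ j, FiniteDimensional (E j) (V j)] [Fintype ι] {g : Cˣ} {k : ℤ}

theorem exists_act_d_ne_zero (hF : F.Comparable) {j : ι} (h : S.rho j (1 - F.e 0) ≠ 0) (c : Bool)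
    {i : ℤ} (hi : i ≠ 0) (hil : |i| ≤ l) : ∃ y : V j, S.act j c (F.d i) y = y ∧ y ≠ 0 := by
  obtain ⟨w, hw⟩ : ∃ w, S.act j c (F.d i) w ≠ 0 := by
    by_contra! h'
    exact S.rho_e_ne_zero hF h hi hil (by rw [← S.act_diag j c]; exact LinearMap.ext h')
  exact ⟨_, by rw [← act_mul_apply, F.d_mul_self], hw⟩

/-- Elements of the ideal that express the rows `m ≠ 0, ±k` of `α(g)` through the row `k`. -/
theorem exists_row_mul (hl : 3 ≤ l) (hF : F.Comparable)
    (hU : ∀ g ∈ U, star g.val * g.val = 1)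
    (hd : ∀ j, finrank (E j) (LinearMap.range (S.rho j (F.e 0))) < 2 * l)
    (hg : g ∈ L.GU') (hk : k ≠ 0) {p : C × C} (hp1 : p * p = p)
    (hp2 : diag (1 - F.e 0) * p = p) (hp2' : p * diag (1 - F.e 0) = p)
    (hp3 : ∀ j c v, S.act j c (F.d k) v = v → S.act j c (F.d k * alpha g) v = 0 →
      S.act j c (p * alpha g) v = 0)
    (hp4 : ∀ j c c', S.act j c p = S.act j c' p) :
    ∃ t ∈ L.inner, ∀ j c, ¬S.Vanishes L j c →
      S.act j c (t * (F.d k * alpha g * F.d k)) = S.act j c (p * alpha g * F.d k) := by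
  have hex (j : ι) (c : Bool) : ∃ ψ : Module.End (E j) (V j),
      S.rho j (1 - F.e 0) * ψ = ψ ∧ ψ * S.rho j (1 - F.e 0) = ψ ∧
      ψ * S.act j c (F.d k * alpha g * F.d k) = S.act j c (p * alpha g * F.d k) := by
    -- The rows in `p` vanish on the kernel of the corner, so they factor through it.
    obtain ⟨ψ, hψ⟩ := exists_mul_eq_of_ker_le (X := S.act j c (F.d k * alpha g * F.d k))
      (Y := S.act j c (p * alpha g * F.d k)) fun v hv => by
        rw [act_mul_apply] at hv ⊢
        exact hp3 j c _ (by rw [← act_mul_apply, F.d_mul_self]) hv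
    refine ⟨S.act j c p * ψ * S.act j c (F.d k), ?_, ?_, ?_⟩
    · rw [← mul_assoc, ← mul_assoc, ← S.act_diag j c, ← map_mul, hp2]
    · rw [mul_assoc, ← S.act_diag j c, ← map_mul (S.act j c) (F.d k), d_mul_one_sub hk]
    · rw [mul_assoc, ← map_mul, ← mul_assoc (F.d k), ← mul_assoc (F.d k), F.d_mul_self, mul_assoc,
        hψ, ← map_mul, ← mul_assoc, ← mul_assoc, hp1]
  have hex' (j : ι) : ∃ φ : Bool → Module.End (E j) (V j),
      (∀ c, S.rho j (1 - F.e 0) * φ c = φ c) ∧ (∀ c, φ c * S.rho j (1 - F.e 0) = φ c) ∧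
      (∀ c, S.Vanishes L j c → φ c = 0) ∧ (S.Linked L j → φ true = φ false) ∧
      ∀ c, ¬S.Vanishes L j c → φ c * S.act j c (F.d k * alpha g * F.d k) =
        S.act j c (p * alpha g * F.d k) := by
    classical
    choose ψ h1 h2 h3 using hex j
    by_cases hv : ∃ c, S.Linked L j ∧ S.Vanishes L j c
    · obtain ⟨c, hlk, hv⟩ := hv
      refine ⟨0, fun c => mul_zero _, fun c => zero_mul _, fun _ _ => rfl, fun _ => rfl,
        fun c' hc' => absurd (fun x hx => ?_) hc'⟩
      rw [hlk x hx c' c, hv x hx]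
    push Not at hv
    by_cases hlk : S.Linked L j
    · by_cases hne : S.rho j (1 - F.e 0) = 0
      · refine absurd (fun x hx => ?_) (hv true hlk)
        rw [← hx.2.1, map_mul, act_diag, hne, zero_mul]
      -- The ideal can realize only equal operators on linked projections. The factor found for one
      -- of them serves both, because both sides of the equation change by the same scalar.
      refine ⟨fun _ => ψ true, fun _ => h1 _, fun _ => h2 _, fun c hc => absurd hc (hv c hlk),
        fun _ => rfl, fun c _ => LinearMap.ext fun v => ?_⟩
      obtain ⟨r, -, hr⟩ := exists_scalar hl hF hU hd hg hne (c := true) (c' := c) (Or.inr hlk)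
      have e (q : C × C) (hq : q * diag (1 - F.e 0) = q) : q * alpha g * F.d k =
          q * (diag (1 - F.e 0) * alpha g * diag (1 - F.e 0)) * F.d k := by
        conv_lhs => rw [← hq, ← one_sub_mul_d hk]
        simp only [mul_assoc]
      have e' (q : C × C) (hq : q * diag (1 - F.e 0) = q) (hq' : S.act j c q = S.act j true q) :
          S.act j c (q * alpha g * F.d k) v = r • S.act j true (q * alpha g * F.d k) v := by
        rw [e q hq]
        generalize diag (1 - F.e 0) * alpha g * diag (1 - F.e 0) = b at hr
        rw [act_mul_apply, act_mul_apply, act_mul_apply, act_mul_apply, hr, map_smul, hq', Frame.d,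
          act_diag, act_diag]
      rw [e' p hp2' (hp4 j _ _), Module.End.mul_apply, e' (F.d k) (d_mul_one_sub hk)
        (by rw [Frame.d, act_diag, act_diag]), map_smul, ← h3 true, Module.End.mul_apply]
    · refine ⟨fun c => if S.Vanishes L j c then 0 else ψ c, fun c => ?_, fun c => ?_,
        fun c hc => if_pos hc, fun h => absurd h hlk, fun c hc => ?_⟩
      · beta_reduce; split_ifs; exacts [mul_zero _, h1 c]
      · beta_reduce; split_ifs; exacts [zero_mul _, h2 c]
      · beta_reduce; rw [if_neg hc, h3]
  choose φ h1 h2 h3 h4 h5 using hex'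
  obtain ⟨t, ht, htφ⟩ := exists_realization (S := S) (L := L) h1 h2 h3 h4
  exact ⟨t, ht, fun j c hc => by rw [map_mul, htφ, h5 j c hc]⟩

/-- Transvections that fix row `-k` move that row into rows `i` and `m`, at the price of changing
row `k` by `-dbar x` times rows `-i` and `-m`. Those rows are `t` times row `k` after restriction to
column `k`, so the corner is only multiplied by `1 - dbar x * t`. If that is a unit, the rank is
unchanged, the new element is again maximal, and its rows `i`, `m` must kill `v`; but they now
contain a nonzero multiple of row `-k` at `v`. -/
theorem Maximal.act_d_neg_eq_zero (hm : S.Maximal L k g) (hl : 3 ≤ l) (hF : F.Comparable)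
    (hU : ∀ g ∈ U, star g.val * g.val = 1)
    (hd : ∀ j, finrank (E j) (LinearMap.range (S.rho j (F.e 0))) < 2 * l)
    (hg : g ∈ L.GU') (hk : k ≠ 0) {j : ι} {c : Bool} {v : V j} (hv : S.act j c (F.d k) v = v)
    (hX : S.act j c (F.d k * alpha g) v = 0) : S.act j c (F.d (-k) * alpha g) v = 0 := by
  by_contra hu
  have hv0 : v ≠ 0 := fun h => hu (by rw [h, map_zero])
  have hnv : ¬S.Vanishes L j c := fun h => hv0 (eq_zero_of_vanishes hl hF hU hg hk h hv hX)
  have hne : S.rho j (1 - F.e 0) ≠ 0 := by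
    intro h
    apply hv0
    rw [← hv, ← one_sub_mul_d hk, act_mul_apply, act_diag, h, LinearMap.zero_apply]
  obtain ⟨i, hi0, hil, hik, hik', -, -⟩ := exists_third_index hl k k
  obtain ⟨m, hm0, hml, hmk, hmk', hmi, hmi'⟩ := exists_third_index hl k i
  set p := F.d (-i) + F.d (-m) with hp
  set p' := F.d i + F.d m with hp'
  have hpp : dbar p' = p := by rw [hp', map_add, F.dbar_d, F.dbar_d]
  have hp'p' : p' * p' = p' := by
    rw [hp', add_mul, mul_add, mul_add, F.d_mul_self, F.d_mul_self, F.d_mul_of_ne hmi,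
      F.d_mul_of_ne hmi.symm, add_zero, zero_add]
  obtain ⟨t, ht, htX⟩ := exists_row_mul (S := S) (L := L) hl hF hU hd hg hk (p := p)
    (by rw [← hpp, ← dbar_mul, hp'p'])
    (by rw [hp, mul_add, one_sub_mul_d (by omega), one_sub_mul_d (by omega)])
    (by rw [hp, add_mul, d_mul_one_sub (by omega), d_mul_one_sub (by omega)])
    (fun j c v hv hX => by
      rw [hp, add_mul, map_add, LinearMap.add_apply,
        hm.act_d_eq_zero hl hF hU hd hg hk hv hX (by omega) (by omega) (by omega),
        hm.act_d_eq_zero hl hF hU hd hg hk hv hX (by omega) (by omega) (by omega), add_zero])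
    (fun j c c' => by rw [hp, Frame.d, Frame.d, ← map_add, act_diag, act_diag])
  have ht' := dbar_mem_inner ht
  obtain ⟨ξ, hξ⟩ := exists_dual_eq_one (E := E j) hu
  -- Two auxiliary indices give two independent candidates for `y`, and one linear condition always
  -- has a nonzero solution in their span. The condition makes `dbar t * x` act with square zero.
  obtain ⟨y, hy, hy0, hyt⟩ : ∃ y : V j, S.act j c p' y = y ∧ y ≠ 0 ∧
      ξ (S.act j c (F.d (-k)) (S.act j c (dbar t) y)) = 0 := by
    obtain ⟨yi, hyi, hyi0⟩ := exists_act_d_ne_zero hF hne c hi0 hil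
    obtain ⟨ym, hym, hym0⟩ := exists_act_d_ne_zero hF hne c hm0 hml
    have him : S.act j c (F.d i) ym = 0 := by
      rw [← hym, ← act_mul_apply, F.d_mul_of_ne hmi.symm, map_zero, LinearMap.zero_apply]
    have hmi : S.act j c (F.d m) yi = 0 := by
      rw [← hyi, ← act_mul_apply, F.d_mul_of_ne hmi, map_zero, LinearMap.zero_apply]
    by_cases h0 : ξ (S.act j c (F.d (-k)) (S.act j c (dbar t) yi)) = 0
    · exact ⟨yi, by rw [hp', map_add, LinearMap.add_apply, hyi, hmi, add_zero], hyi0, h0⟩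
    · refine ⟨ym - (ξ (S.act j c (F.d (-k)) (S.act j c (dbar t) ym)) *
        (ξ (S.act j c (F.d (-k)) (S.act j c (dbar t) yi)))⁻¹) • yi, ?_, fun h => hym0 ?_, ?_⟩
      · rw [hp', map_add, LinearMap.add_apply, map_sub, map_sub, map_smul, map_smul, hyi, hym, him,
          hmi, smul_zero, sub_zero, zero_sub]
        abel
      · have := congrArg (S.act j c (F.d m)) h
        rwa [map_sub, map_smul, hym, hmi, smul_zero, sub_zero, map_zero] at this
      · rw [map_sub, map_sub, map_sub, map_smul, map_smul, map_smul, smul_eq_mul,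
          inv_mul_cancel_right₀ h0, sub_self]
  set ψ : Module.End (E j) (V j) := (ξ.comp (S.act j c (F.d (-k)))).smulRight y with hψ
  have hψp : S.act j c p' * ψ = ψ := by
    ext w; simp [hψ, hy]
  have hψk : ψ * S.act j c (F.d (-k)) = ψ := by
    ext w; simp [hψ, ← act_mul_apply]
  have hp'o : diag (1 - F.e 0) * p' = p' := by
    rw [hp', mul_add, one_sub_mul_d hi0, one_sub_mul_d hm0]
  have hp'd (j : ι) (c c' : Bool) : S.act j c p' = S.act j c' p' := by
    rw [hp', Frame.d, Frame.d, ← map_add, act_diag, act_diag]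
  obtain ⟨z, hz, hz1, hz2, hz3⟩ := exists_block hnv (ψ := ψ)
    (by rw [← hψp, ← mul_assoc, ← S.act_diag j c, ← map_mul, hp'o])
    (by rw [← hψk, mul_assoc, ← S.act_diag j c, ← map_mul, d_mul_one_sub (by omega)])
  set x := p' * z * F.d (-k) with hx
  have hp'N : p' ∈ L.normalizer := add_mem (d_mem_normalizer i) (d_mem_normalizer m)
  have hxI : x ∈ L.I := mul_normalizer_mem (normalizer_mul_mem hp'N hz.1) (d_mem_normalizer _)
  have hx1 : p' * x = x := by rw [hx, ← mul_assoc, ← mul_assoc, hp'p']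
  have hx2 : x * F.d (-k) = x := by rw [hx, mul_assoc, F.d_mul_self]
  have hxi : x ∈ L.inner := ⟨hxI, by rw [← hx1, ← mul_assoc, hp'o], by
    rw [← hx2, mul_assoc, d_mul_one_sub (by omega)]⟩
  have hx3 : F.d k * dbar x = dbar x := by
    have := congrArg dbar hx2
    rwa [dbar_mul, F.dbar_d, neg_neg] at this
  have hx4 : dbar x * p = dbar x := by rw [← hpp, ← dbar_mul, hx1]
  have hxc (c' : Bool) (hc' : c' = c ∨ S.Linked L j) : S.act j c' x = ψ := by
    rw [hx, map_mul, map_mul, hz1 c' hc', hp'd j c' c, Frame.d, act_diag, ← S.act_diag j c]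
    exact (congrArg (· * S.act j c (F.d (-k))) hψp).trans hψk
  have hxc' (c' : Bool) (hc' : ¬(c' = c ∨ S.Linked L j)) : S.act j c' x = 0 := by
    rw [hx, map_mul, map_mul, hz2 c' hc', mul_zero, zero_mul]
  have hxn (n : ι) (hn : n ≠ j) (c' : Bool) : S.act n c' x = 0 := by
    rw [hx, map_mul, map_mul, hz3 n hn c', mul_zero, zero_mul]
  have hunit : IsUnit (1 - dbar x * t) := by
    -- The action of `x` is known in every representation, whereas that of `dbar x` is not, as
    -- `star` is not tracked there. The unit is therefore found for the adjoint element.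
    have h1 : IsUnit (1 - dbar t * x) := by
      refine S.isUnit_of_act fun n c' => ?_
      rw [map_sub, map_one]
      apply isUnit_one_sub_of_mul_self_eq_zero
      rw [map_mul]
      by_cases hn : n = j
      · subst hn
        by_cases hc' : c' = c ∨ S.Linked L n
        · rw [hxc c' hc', act_eq_of_block hc' ht']
          ext w
          simp [hψ, hyt]
        · rw [hxc' c' hc', mul_zero, mul_zero]
      · rw [hxn n hn, mul_zero, mul_zero]
    have h2 := isUnit_dbar h1
    rwa [map_sub, dbar_one, dbar_mul, dbar_dbar] at h2
  have mk (n : ℤ) (hn0 : n ≠ 0) (hnk : n ≠ k) (hnk' : n ≠ -k) :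
      ∃ f ∈ L.level.elementary, alpha f = 1 + (F.d n * x - dbar x * F.d (-n)) := by
    obtain ⟨f, hf, hfa⟩ := exists_elementary_tau₂ (L := L) hn0 (neg_ne_zero.2 hk) hnk'
      (by rwa [neg_neg]) (b := F.d n * x) (normalizer_mul_mem (d_mem_normalizer n) hxI)
      (F.d_mul_cancel n x) (by rw [mul_assoc, hx2])
    exact ⟨f, hf, by rw [hfa, dbar_mul, F.dbar_d]⟩
  obtain ⟨f₁, hf₁, hf₁a⟩ := mk i hi0 hik hik'
  obtain ⟨f₂, hf₂, hf₂a⟩ := mk m hm0 hmk hmk'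
  have z1 (n : ℤ) (hn : n ≠ -k) : x * F.d n = 0 := by
    rw [← hx2, mul_assoc, F.d_mul_of_ne hn.symm, mul_zero]
  have z2 (n : ℤ) (hn : n ≠ k) : F.d n * dbar x = 0 := by
    rw [← hx3, ← mul_assoc, F.d_mul_of_ne hn, zero_mul]
  have z3 : x * dbar x = 0 := by
    calc x * dbar x = x * F.d (-k) * dbar x := by rw [hx2]
      _ = 0 := by rw [mul_assoc, z2 _ (by omega), mul_zero]
  have hfa : alpha (f₁ * f₂) = 1 + (x - dbar x) := by
    have e1 : F.d i * x + F.d m * x = x := by rw [← add_mul, ← hp', hx1]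
    have e2 : dbar x * F.d (-i) + dbar x * F.d (-m) = dbar x := by rw [← mul_add, ← hp, hx4]
    have e3 : (F.d i * x - dbar x * F.d (-i)) * (F.d m * x - dbar x * F.d (-m)) = 0 := by
      have a1 : F.d i * x * (F.d m * x) = 0 := by
        rw [mul_assoc, ← mul_assoc x, z1 m hmk', zero_mul, mul_zero]
      have a2 : F.d i * x * (dbar x * F.d (-m)) = 0 := by
        rw [mul_assoc, ← mul_assoc x, z3, zero_mul, mul_zero]
      have a3 : dbar x * F.d (-i) * (F.d m * x) = 0 := by
        rw [mul_assoc, ← mul_assoc (F.d (-i)), F.d_mul_of_ne hmi'.symm, zero_mul, mul_zero]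
      have a4 : dbar x * F.d (-i) * (dbar x * F.d (-m)) = 0 := by
        rw [mul_assoc, ← mul_assoc (F.d (-i)), z2 _ (by omega), zero_mul, mul_zero]
      rw [sub_mul, mul_sub, mul_sub, a1, a2, a3, a4]; simp
    have e4 : x - dbar x = F.d i * x + F.d m * x - (dbar x * F.d (-i) + dbar x * F.d (-m)) := by
      rw [e1, e2]
    rw [alpha_mul, hf₁a, hf₂a, add_mul, one_mul, mul_add, mul_one, e3, add_zero, e4]
    abel
  have hf := Subgroup.mul_mem _ hf₁ hf₂
  set f := f₁ * f₂ with hf_def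
  have hrow (n : ℤ) (h1 : n ≠ i) (h2 : n ≠ m) (h3 : n ≠ k) : F.d n * alpha f = F.d n := by
    have e : F.d n * x = 0 := by
      rw [← hx1, ← mul_assoc, hp', mul_add, F.d_mul_of_ne h1, F.d_mul_of_ne h2, add_zero, zero_mul]
    rw [hfa, mul_add, mul_sub, e, z2 n h3, sub_self, mul_one, add_zero]
  have hkx : F.d k * x = 0 := by
    rw [← hx1, ← mul_assoc, hp', mul_add, F.d_mul_of_ne hik.symm, F.d_mul_of_ne hmk.symm, add_zero,
      zero_mul]
  have hfk := hrow (-k) (by omega) (by omega) (by omega)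
  have hnew (n : ι) (c' : Bool) : S.act n c' (F.d k * alpha (f * g) * F.d k) =
      S.act n c' (1 - dbar x * t) * S.act n c' (F.d k * alpha g * F.d k) := by
    have e : F.d k * alpha (f * g) * F.d k =
        F.d k * alpha g * F.d k - dbar x * (p * alpha g * F.d k) := by
      rw [alpha_mul, hfa, ← mul_assoc (F.d k), mul_add, mul_sub, hkx, hx3, zero_sub, mul_one,
        ← sub_eq_add_neg, sub_mul, sub_mul]
      conv_lhs => rw [← hx4]
      simp only [mul_assoc]
    rw [e, map_sub, map_sub (S.act n c') 1, map_mul (S.act n c') (dbar x) (p * _ * _),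
      map_mul (S.act n c') (dbar x) t, map_one, sub_mul, one_mul]
    congr 1
    by_cases h : S.Vanishes L n c'
    · rw [h _ (dbar_mem_inner hxi), zero_mul, zero_mul, zero_mul]
    · rw [← htX n c' h, map_mul (S.act n c') t, ← mul_assoc (S.act n c' (dbar x))]
  have hr : S.rank F k (alpha (f * g)) = S.rank F k (alpha g) := by
    refine Finset.sum_congr rfl fun q _ => ?_
    rw [hnew, finrank_range_unit_mul (hunit.map (S.act q.1 q.2))]
  have hm' := hm.mul hf hfk hr
  have hg' := mul_mem_GU' hU (Level.elementary_le_EU _ hf) hg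
  have hX' : S.act j c (F.d k * alpha (f * g)) v = 0 := by
    have := LinearMap.congr_fun (hnew j c) v
    rwa [act_mul_apply, hv, Module.End.mul_apply, act_mul_apply j c (F.d k * alpha g), hv, hX,
      map_zero] at this
  have hzero (g : Cˣ) (hm : S.Maximal L k g) (hg : g ∈ L.GU')
      (hX : S.act j c (F.d k * alpha g) v = 0) : S.act j c (p' * alpha g) v = 0 := by
    rw [hp', add_mul, map_add, LinearMap.add_apply,
      hm.act_d_eq_zero hl hF hU hd hg hk hv hX hi0 hik hik',
      hm.act_d_eq_zero hl hF hU hd hg hk hv hX hm0 hmk hmk', add_zero]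
  have e1 : p' * alpha (f * g) = p' * alpha g + x * alpha g := by
    have : p' * dbar x = 0 := by rw [hp', add_mul, z2 i hik, z2 m hmk, add_zero]
    rw [alpha_mul, hfa, ← mul_assoc, mul_add, mul_sub, hx1, this, sub_zero, mul_one, add_mul]
  have e2 := hzero _ hm' hg' hX'
  rw [e1, map_add, LinearMap.add_apply, hzero g hm hg hX, zero_add, act_mul_apply,
    hxc c (Or.inl rfl)] at e2
  apply hy0
  have e3 : ξ (S.act j c (F.d (-k)) (S.act j c (alpha g) v)) • y = 0 := e2
  rwa [← act_mul_apply, hξ, one_smul] at e3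

theorem Maximal.act_eq_act_d_zero (hm : S.Maximal L k g) (hl : 3 ≤ l) (hF : F.Comparable)
    (hU : ∀ g ∈ U, star g.val * g.val = 1)
    (hd : ∀ j, finrank (E j) (LinearMap.range (S.rho j (F.e 0))) < 2 * l)
    (hg : g ∈ L.GU') (hk : k ≠ 0) {j : ι} {c : Bool} {v : V j} (hv : S.act j c (F.d k) v = v)
    (hX : S.act j c (F.d k * alpha g) v = 0) :
    S.act j c (diag (1 - F.e 0) * alpha g) v = 0 := by
  have e : diag (1 - F.e 0) = ∑ i ∈ (Finset.Icc (-(l : ℤ)) l).erase 0, F.d i := by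
    rw [← F.sum_e, ← Finset.sum_erase_add _ _ (Finset.mem_Icc.2 ⟨by omega, by omega⟩ :
      (0 : ℤ) ∈ Finset.Icc (-(l : ℤ)) l), add_sub_cancel_right, map_sum]
    rfl
  rw [e, Finset.sum_mul, map_sum, LinearMap.sum_apply]
  refine Finset.sum_eq_zero fun n hn => ?_
  by_cases h1 : n = k
  · rw [h1, hX]
  by_cases h2 : n = -k
  · rw [h2, hm.act_d_neg_eq_zero hl hF hU hd hg hk hv hX]
  exact hm.act_d_eq_zero hl hF hU hd hg hk hv hX (Finset.ne_of_mem_erase hn) h1 h2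

/-- Since `α(g) v` already lies in `e₀V`, a nonzero value gives some `w ∈ e_n I e₀` with `w α(g) v ≠
0`. A transvection `τ_{-n}(h)` with `π(h) = dbar w` leaves row `k` alone, so maximality persists,
but it would make row `n` nonzero at `v`. -/
theorem Maximal.act_ideal_eq_zero (hm : S.Maximal L k g) (hl : 3 ≤ l) (hF : F.Comparable)
    (hU : ∀ g ∈ U, star g.val * g.val = 1)
    (hd : ∀ j, finrank (E j) (LinearMap.range (S.rho j (F.e 0))) < 2 * l)
    (hg : g ∈ L.GU') (hk : k ≠ 0) {j : ι} {c : Bool} {v : V j} (hv : S.act j c (F.d k) v = v)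
    (hX : S.act j c (F.d k * alpha g) v = 0) {x : C × C} (hx : x ∈ L.I) :
    S.act j c (diag (1 - F.e 0) * x * alpha g) v = 0 := by
  by_contra hu
  have hne : S.rho j (1 - F.e 0) ≠ 0 := by
    intro h
    apply hu
    rw [mul_assoc, act_mul_apply, act_diag, h, LinearMap.zero_apply]
  obtain ⟨n, hn0, hnl, hnk, hnk', -, -⟩ := exists_third_index hl k k
  obtain ⟨y, hy, hy0⟩ := exists_act_d_ne_zero hF hne c hn0 hnl
  obtain ⟨ξ, hξ⟩ := exists_dual_eq_one (E := E j) hu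
  obtain ⟨b, hb, -⟩ := S.exists_rho_eq j (ξ.smulRight y)
  set w := F.d n * diag ((1 - F.e 0) * b * (1 - F.e 0)) * x * F.d 0 with hw
  have hwI : w ∈ L.I := mul_normalizer_mem (normalizer_mul_mem
    (L.normalizer.mul_mem (d_mem_normalizer n) (corner_mem_normalizer b)) hx) (d_mem_normalizer 0)
  have hw1 : F.d n * w = w := by simp only [hw, ← mul_assoc, F.d_mul_self]
  have hw2 : w * F.d 0 = w := by rw [hw, mul_assoc, F.d_mul_self]
  have hwv : S.act j c (w * alpha g) v = y := by
    have e0 : S.act j c (F.d 0 * alpha g) v = S.act j c (alpha g) v := by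
      have := hm.act_eq_act_d_zero hl hF hU hd hg hk hv hX
      rw [map_sub, map_one, sub_mul, one_mul, map_sub, LinearMap.sub_apply, sub_eq_zero] at this
      exact this.symm
    have e1 : w * alpha g = F.d n * (diag b * (diag (1 - F.e 0) * x)) * (F.d 0 * alpha g) := by
      rw [hw, map_mul, map_mul, ← mul_assoc (F.d n), ← mul_assoc (F.d n), d_mul_one_sub hn0]
      simp only [mul_assoc]
    rw [e1, act_mul_apply, e0, act_mul_apply, act_mul_apply, act_diag, hb, ← act_mul_apply,
      LinearMap.smulRight_apply, hξ, one_smul, hy]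
  have hw3 : F.d 0 * dbar w = dbar w := by
    have := congrArg dbar hw2
    rwa [dbar_mul, F.dbar_d, neg_zero] at this
  have hw4 : dbar w * F.d (-n) = dbar w := by rw [← F.dbar_d, ← dbar_mul, hw1]
  -- The boundary condition lifts `dbar w ∈ e₀ I (1 - e₀)` to `Γ`.
  obtain ⟨h, hh, hhp⟩ : ∃ h ∈ L.Γ, pi (actBy (diag (1 - F.e 0)) h) = dbar w := by
    have : dbar w ∈ (fun a => diag (F.e 0) * a * diag (1 - F.e 0)) '' (L.I : Set (C × C)) := by
      refine ⟨dbar w, L.bar_mem _ hwI, ?_⟩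
      change F.d 0 * dbar w * diag (1 - F.e 0) = _
      rw [hw3, ← hw4, mul_assoc, d_mul_one_sub (by omega)]
    rw [L.boundary] at this
    exact this
  set h₂ := actBy (F.d (-n)) (actBy (diag (1 - F.e 0)) h) with hh₂
  have h₂Γ : h₂ ∈ L.Γ := by
    rw [hh₂, ← actBy_mul, one_sub_mul_d (by omega)]
    exact AugmentedLevel.actBy_mem (d_mem_normalizer _) hh
  have h₂d : actBy (F.d (-n)) h₂ = h₂ := by rw [hh₂, ← actBy_mul, F.d_mul_self]
  have h₂p : pi h₂ = dbar w := by rw [hh₂, pi_actBy, hhp, hw4]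
  obtain ⟨f, hf, hfa⟩ := exists_elementary_tau₁ (neg_ne_zero.2 hn0) h₂Γ h₂d
  rw [h₂p, dbar_dbar] at hfa
  have t0 : tr h₂ = F.d n * tr h₂ * F.d (-n) := by
    conv_lhs => rw [← h₂d, tr_actBy, F.dbar_d, neg_neg]
  have hrow (m : ℤ) (hm0 : m ≠ 0) (hmn : m ≠ n) : F.d m * alpha f = F.d m := by
    have z1 : F.d m * dbar w = 0 := by rw [← hw3, ← mul_assoc, F.d_mul_of_ne hm0, zero_mul]
    have z2 : F.d m * w = 0 := by rw [← hw1, ← mul_assoc, F.d_mul_of_ne hmn, zero_mul]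
    have z3 : F.d m * tr h₂ = 0 := by
      rw [t0, ← mul_assoc, ← mul_assoc, F.d_mul_of_ne hmn, zero_mul, zero_mul]
    rw [hfa, mul_add, mul_sub, mul_add, z1, z2, z3, mul_one, add_zero, sub_zero, add_zero]
  have hrk : F.d k * alpha (f * g) = F.d k * alpha g := by
    rw [alpha_mul, ← mul_assoc, hrow k hk hnk.symm]
  have hm' := hm.mul hf (hrow _ (by omega) (by omega)) (by rw [rank, rank, hrk])
  have hg' := mul_mem_GU' hU (Level.elementary_le_EU _ hf) hg
  have h1 := hm'.act_d_eq_zero hl hF hU hd hg' hk hv (by rw [hrk, hX]) hn0 hnk hnk'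
  have h2 : F.d n * alpha (f * g) = F.d n * alpha g + F.d n * tr h₂ * (F.d (-n) * alpha g) -
      w * alpha g := by
    have z1 : F.d n * dbar w = 0 := by rw [← hw3, ← mul_assoc, F.d_mul_of_ne hn0, zero_mul]
    have z3 : F.d n * tr h₂ = F.d n * tr h₂ * F.d (-n) := by
      rw [t0]; simp only [← mul_assoc, F.d_mul_self]; simp only [mul_assoc, F.d_mul_self]
    rw [alpha_mul, hfa, ← mul_assoc, mul_add, mul_sub, mul_add, z1, hw1, zero_add, mul_one,
      add_mul, sub_mul, z3, add_sub_assoc, ← mul_assoc, mul_assoc _ (F.d (-n)) (F.d (-n)),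
      F.d_mul_self]
  rw [h2, map_sub, map_add, LinearMap.sub_apply, LinearMap.add_apply, hwv,
    hm.act_d_eq_zero hl hF hU hd hg hk hv hX hn0 hnk hnk', act_mul_apply,
    hm.act_d_eq_zero hl hF hU hd hg hk hv hX (n := -n) (by omega) (by omega) (by omega), map_zero,
    zero_add, zero_sub, neg_eq_zero] at h1
  exact hy0 h1

/-- For `b` in the corner `(1 - e₀)C(1 - e₀)`, the element `α(g) b α(g)⁻¹ - b` is in `I`, so `(1 -
e₀) α(g) b v = (1 - e₀) b α(g) v = 0`. If `v ≠ 0`, the vectors `b v` fill `(1 - e₀)V`, and `α(g)`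
would embed this space into the smaller `e₀V`. -/
theorem Maximal.eq_zero (hm : S.Maximal L k g) (hl : 3 ≤ l) (hF : F.Comparable)
    (hU : ∀ g ∈ U, star g.val * g.val = 1)
    (hd : ∀ j, finrank (E j) (LinearMap.range (S.rho j (F.e 0))) < 2 * l)
    (hg : g ∈ L.GU') (hk : k ≠ 0) {j : ι} {c : Bool} {v : V j} (hv : S.act j c (F.d k) v = v)
    (hX : S.act j c (F.d k * alpha g) v = 0) : v = 0 := by
  by_contra hv0
  have hov : S.rho j (1 - F.e 0) v = v := by
    rw [← S.act_diag j c, ← hv, ← act_mul_apply, one_sub_mul_d hk]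
  have hne : S.rho j (1 - F.e 0) = 0 := by
    refine S.rho_one_sub_eq_zero hF (hd j) (S.act_injective j c g) fun u => ?_
    obtain ⟨ξ, hξ⟩ := exists_dual_eq_one (E := E j) hv0
    obtain ⟨b, hb, -⟩ := S.exists_rho_eq j (ξ.smulRight u)
    have hbv : S.act j c (diag ((1 - F.e 0) * b * (1 - F.e 0))) v = S.rho j (1 - F.e 0) u := by
      rw [act_diag, map_mul, map_mul, Module.End.mul_apply, Module.End.mul_apply, hov, hb,
        LinearMap.smulRight_apply, hξ, one_smul]
    have h1 := (corner_mem_commutesMod hl hF hU hg (c := (1 - F.e 0) * b * (1 - F.e 0))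
      (by rw [← mul_assoc, ← mul_assoc, mul_sub (F.e 0), mul_one, F.idem, sub_self, zero_mul,
        zero_mul])
      (by rw [mul_assoc, sub_mul 1 (F.e 0) (F.e 0), one_mul, F.idem, sub_self, mul_zero])).2
    have h2 := hm.act_ideal_eq_zero hl hF hU hd hg hk hv hX h1
    have h3 : diag (1 - F.e 0) * (alpha g * diag ((1 - F.e 0) * b * (1 - F.e 0)) * alpha g⁻¹ -
        diag ((1 - F.e 0) * b * (1 - F.e 0))) * alpha g =
        diag (1 - F.e 0) * (alpha g * diag ((1 - F.e 0) * b * (1 - F.e 0))) -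
          diag (1 - F.e 0) * diag ((1 - F.e 0) * b) * (diag (1 - F.e 0) * alpha g) := by
      rw [mul_assoc, sub_mul, mul_assoc _ (alpha g⁻¹), alpha_inv_mul_alpha, mul_one, mul_sub,
        map_mul diag ((1 - F.e 0) * b)]
      simp only [mul_assoc]
    rw [h3, map_sub, LinearMap.sub_apply, act_mul_apply _ _ (_ * _) (_ * alpha g),
      hm.act_eq_act_d_zero hl hF hU hd hg hk hv hX, map_zero, sub_zero, act_mul_apply,
      act_mul_apply, hbv, act_diag] at h2
    exact h2
  exact hv0 (by rw [← hov, hne, LinearMap.zero_apply])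

end SimpleReps

/-- After an elementary transformation, the corner `e_k α(g) e_k` becomes invertible. -/
theorem exists_cornerInvertible {C : Type*} [Ring C] [StarRing C] {l : ℕ} {F : Frame C l}
    {K : Type*} [CommRing K] [Algebra K C] {U : Subgroup Cˣ} {ι : Type*} {E : ι → Type*}
    [∀ j, DivisionRing (E j)] {V : ι → Type*} [∀ j, AddCommGroup (V j)] [∀ j, Module (E j) (V j)]
    (S : SimpleReps C E V) (L : AugmentedLevel F K U) [∀ j, FiniteDimensional (E j) (V j)]
    [Fintype ι] (hl : 3 ≤ l) (hF : F.Comparable) (hU : ∀ g ∈ U, star g.val * g.val = 1)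
    (hd : ∀ j, finrank (E j) (LinearMap.range (S.rho j (F.e 0))) < 2 * l) {g : Cˣ}
    (hg : g ∈ L.GU') {k : ℤ} (hk : k ≠ 0) :
    ∃ f ∈ L.level.elementary, F.d (-k) * alpha f = F.d (-k) ∧
      AugmentedLevel.CornerInvertible F k (alpha (f * g)) := by
  obtain ⟨f, hf, hfk, hm⟩ := SimpleReps.exists_maximal (S := S) (L := L) k g
  refine ⟨f, hf, hfk, ?_⟩
  have hg' := AugmentedLevel.mul_mem_GU' hU (AugmentedLevel.Level.elementary_le_EU _ hf) hg
  set a := alpha (f * g) with ha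
  -- Padding by `1 - e_k` lets unit detection in `𝒜` decide invertibility in the corner; a kernel
  -- vector must lie in `e_k V`.
  have hunit : IsUnit (F.d k * a * F.d k + (1 - F.d k)) := by
    refine S.isUnit_of_act fun j c => ?_
    rw [LinearMap.isUnit_iff_ker_eq_bot, LinearMap.ker_eq_bot']
    intro v hv
    have h1 := congrArg (S.act j c (F.d k)) hv
    have h2 := congrArg (S.act j c (1 - F.d k)) hv
    rw [← SimpleReps.act_mul_apply, map_zero] at h1 h2
    have e1 : F.d k * (F.d k * a * F.d k + (1 - F.d k)) = F.d k * a * F.d k := by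
      rw [mul_add, mul_sub, mul_one, F.d_mul_self, sub_self, add_zero, ← mul_assoc, ← mul_assoc,
        F.d_mul_self]
    have e2 : (1 - F.d k) * (F.d k * a * F.d k + (1 - F.d k)) = 1 - F.d k := by
      rw [sub_mul, e1, one_mul, add_sub_cancel_left]
    rw [e1, SimpleReps.act_mul_apply] at h1
    rw [e2, map_sub, map_one, LinearMap.sub_apply, Module.End.one_apply, sub_eq_zero] at h2
    exact hm.eq_zero hl hF hU hd hg' hk h2.symm (by rwa [← h2] at h1)
  obtain ⟨⟨u, w, huw, hwu⟩, rfl : u = _⟩ := hunit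
  have e1 : F.d k * (F.d k * a * F.d k + (1 - F.d k)) = F.d k * a * F.d k := by
    rw [mul_add, mul_sub, mul_one, F.d_mul_self, sub_self, add_zero, ← mul_assoc, ← mul_assoc,
      F.d_mul_self]
  have e2 : (F.d k * a * F.d k + (1 - F.d k)) * F.d k = F.d k * a * F.d k := by
    rw [add_mul, sub_mul, one_mul, F.d_mul_self, sub_self, add_zero, mul_assoc _ (F.d k),
      F.d_mul_self]
  refine ⟨F.d k * w * F.d k, by rw [← mul_assoc, ← mul_assoc, F.d_mul_self],
    by rw [mul_assoc _ (F.d k), F.d_mul_self], ?_, ?_⟩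
  · calc F.d k * a * (F.d k * w * F.d k) = F.d k * a * F.d k * w * F.d k := by
          simp only [mul_assoc]
      _ = F.d k := by rw [← e1, mul_assoc (F.d k), huw, mul_one, F.d_mul_self]
  · calc F.d k * w * F.d k * a * F.d k = F.d k * w * (F.d k * a * F.d k) := by
          simp only [mul_assoc]
      _ = F.d k := by rw [← e2, mul_assoc, ← mul_assoc w, hwu, one_mul, F.d_mul_self]

end OddUnitary

/-! ### The dimension bound for the anisotropic part. -/

namespace OddUnitary

open Module

namespace SimpleReps

variable {C : Type*} [Ring C] {ι : Type*} {E : ι → Type*} [∀ j, DivisionRing (E j)]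
  {V : ι → Type*} [∀ j, AddCommGroup (V j)] [∀ j, Module (E j) (V j)] {S : SimpleReps C E V}

/-- Central elements act by scalars. -/
theorem exists_smul_of_central {z : C} (hz : ∀ c, z * c = c * z) (j : ι) :
    ∃ r : E j, ∀ v, S.rho j z v = r • v := by
  by_cases h : ∀ v : V j, v = 0
  · exact ⟨0, fun v => by rw [h v, map_zero, smul_zero]⟩
  push Not at h
  obtain ⟨v₀, hv₀⟩ := h
  obtain ⟨ξ, hξ⟩ := exists_dual_eq_one (E := E j) hv₀
  refine ⟨ξ (S.rho j z v₀), fun v => ?_⟩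
  obtain ⟨b, hb, -⟩ := S.exists_rho_eq j (ξ.smulRight v)
  have h1 := LinearMap.congr_fun (congrArg (S.rho j) (hz b)) v₀
  simpa [hb, hξ] using h1

/-- If the corner `e C e` is spanned by `s`, the square of the rank of `e` is at most `#s`. -/
theorem finrank_mul_finrank_le {K : Type*} [CommRing K] [Algebra K C] (j : ι)
    [FiniteDimensional (E j) (V j)] {e : C} (s : Finset C)
    (hs : (Submodule.span K (s : Set C) : Set C) = Set.range fun c => e * c * e)
    (he : e * e = e) :
    finrank (E j) (LinearMap.range (S.rho j e)) * finrank (E j) (LinearMap.range (S.rho j e)) ≤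
      s.card := by
  classical
  set W := LinearMap.range (S.rho j e) with hW
  have hWe (w : W) : S.rho j e w = w := by
    obtain ⟨_, v, rfl⟩ := w
    change (S.rho j e * S.rho j e) v = _
    rw [← map_mul, he]
  let b := finBasis (E j) W
  -- Evaluation on a basis of `W = eV`. Elements of `K` act by scalars of `E j`, so `eCe` lands in
  -- the span of the images of `s`. By joint surjectivity that span contains all of `W ^ dim W`.
  let ev : C →+ (Fin (finrank (E j) W) → V j) :=
    { toFun := fun c i => S.rho j c (b i)
      map_zero' := by ext; simp
      map_add' := fun x y => by ext; simp }
  have hev : ∀ c ∈ Submodule.span K (s : Set C),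
      ev c ∈ Submodule.span (E j) ((s.image ev : Finset _) : Set (Fin (finrank (E j) W) → V j)) := by
    intro c hc
    induction hc using Submodule.span_induction with
    | mem x hx => exact Submodule.subset_span (Finset.mem_coe.2 (Finset.mem_image_of_mem ev hx))
    | zero => rw [map_zero]; exact zero_mem _
    | add x y _ _ hx hy => rw [map_add]; exact add_mem hx hy
    | smul k x _ hx =>
      obtain ⟨r, hr⟩ := S.exists_smul_of_central (Algebra.commutes k) j
      have : ev (k • x) = r • ev x := by
        ext i
        change S.rho j (k • x) (b i) = r • S.rho j x (b i)
        rw [Algebra.smul_def, map_mul, Module.End.mul_apply, hr]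
      rw [this]
      exact Submodule.smul_mem _ _ hx
  let incl : (Fin (finrank (E j) W) → W) →ₗ[E j] (Fin (finrank (E j) W) → V j) :=
    LinearMap.compLeft W.subtype _
  have hincl (f : Fin (finrank (E j) W) → W) : incl f ∈
      Submodule.span (E j) ((s.image ev : Finset _) : Set (Fin (finrank (E j) W) → V j)) := by
    obtain ⟨ψ, hψ⟩ := LinearMap.exists_extend (W.subtype.comp (b.constr ℕ f))
    obtain ⟨c, hc, -⟩ := S.exists_rho_eq j ψ
    have : incl f = ev (e * c * e) := by
      ext i
      have h1 := LinearMap.congr_fun hψ (b i)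
      simp only [LinearMap.comp_apply, Submodule.subtype_apply, Basis.constr_basis] at h1
      change (f i : V j) = S.rho j (e * c * e) (b i)
      rw [map_mul, map_mul, Module.End.mul_apply, Module.End.mul_apply, hWe, hc, h1, hWe]
    rw [this]
    refine hev _ ?_
    rw [← SetLike.mem_coe, hs]
    exact ⟨c, rfl⟩
  have hinj : Function.Injective (incl.codRestrict _ hincl) := by
    intro f f' h
    have h' : incl f = incl f' := congrArg Subtype.val h
    funext i
    exact Subtype.ext (congrFun h' i)
  have h1 := LinearMap.finrank_le_finrank_of_injective hinj
  rw [finrank_pi_fintype, Finset.sum_const, Finset.card_univ, Fintype.card_fin, smul_eq_mul] at h1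
  exact h1.trans ((finrank_span_finset_le_card _).trans Finset.card_image_le)

end SimpleReps

/-! ### Simple representations of a finite algebra over a local ring. -/

section Existence

/-- Units are detected in the residue algebra of a finite algebra over a local ring. -/
theorem isUnit_of_isUnit_one_tmul {K C : Type*} [CommRing K] [IsLocalRing K] [Ring C] [Algebra K C]
    [Module.Finite K C] {c : C}
    (h : IsUnit ((1 : IsLocalRing.ResidueField K) ⊗ₜ[K] c)) : IsUnit c := by
  obtain ⟨u, hu⟩ := h
  -- By Nakayama, surjectivity of left multiplication can be checked over the residue field.
  have hsurj : Function.Surjective (LinearMap.mulLeft K c) := by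
    rw [← LinearMap.range_eq_top, ← IsLocalRing.map_tensorProduct_mk_eq_top, eq_top_iff]
    rintro b -
    have hb : (u⁻¹).val * b ∈ (⊤ : Submodule K C).map
        (TensorProduct.mk K (IsLocalRing.ResidueField K) C 1) := by
      rw [IsLocalRing.map_tensorProduct_mk_eq_top.2 rfl]
      trivial
    obtain ⟨x, -, hx⟩ := hb
    refine ⟨c * x, ⟨x, rfl⟩, ?_⟩
    change (1 : IsLocalRing.ResidueField K) ⊗ₜ[K] (c * x) = b
    change (1 : IsLocalRing.ResidueField K) ⊗ₜ[K] x = (u⁻¹).val * b at hx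
    rw [← u.mul_inv_cancel_left b, ← hx, hu, Algebra.TensorProduct.tmul_mul_tmul, one_mul]
  have hinj := OrzechProperty.injective_of_surjective_endomorphism _ hsurj
  obtain ⟨x, hx⟩ := hsurj 1
  change c * x = 1 at hx
  refine ⟨⟨c, x, hx, hinj ?_⟩, rfl⟩
  change c * (x * c) = c * 1
  rw [← mul_assoc, hx, one_mul, mul_one]

/-- Units are detected modulo a nilpotent two-sided ideal. -/
theorem isUnit_of_isUnit_mk {B : Type*} [Ring B] {J : Ideal B} [J.IsTwoSided]
    (hJ : IsNilpotent J) {b : B} (h : IsUnit (Ideal.Quotient.mk J b)) : IsUnit b := by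
  have key {x : B} (hx : Ideal.Quotient.mk J x = 1) : IsUnit x := by
    have hxJ : x - 1 ∈ J := by
      rw [← Ideal.Quotient.eq_zero_iff_mem, map_sub, hx, map_one, sub_self]
    obtain ⟨n, hn⟩ := hJ
    have : IsNilpotent (x - 1) := ⟨n, by
      have := Ideal.pow_mem_pow hxJ n
      rw [hn] at this
      exact this⟩
    simpa using this.isUnit_one_add
  obtain ⟨⟨u, w, huw, hwu⟩, rfl : u = _⟩ := h
  obtain ⟨y, rfl⟩ := Ideal.Quotient.mk_surjective w
  rw [← map_mul] at huw hwu
  obtain ⟨p, hp⟩ := key huw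
  obtain ⟨q, hq⟩ := key hwu
  have h1 : b * (y * (p⁻¹).val) = 1 := by rw [← mul_assoc, ← hp, p.mul_inv]
  have h2 : (q⁻¹).val * y * b = 1 := by rw [mul_assoc, ← hq, q.inv_mul]
  exact ⟨⟨b, y * (p⁻¹).val, h1, by rw [← left_inv_eq_right_inv h2 h1, h2]⟩, rfl⟩

/-- The residue algebra is Artinian, so modulo its nilpotent radical it is a finite product of
matrix rings over division rings. Units lift along both reductions. Matrices over `D j` are the
endomorphisms of column vectors for the right structure, hence the opposite division ring. -/
theorem exists_simpleReps.{u, v} (K : Type u) (C : Type v) [CommRing K] [IsLocalRing K] [Ring C]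
    [Algebra K C] [Module.Finite K C] :
    ∃ (n : ℕ) (D : Fin n → Type (max u v)) (d : Fin n → ℕ) (_ : ∀ j, DivisionRing (D j)),
      Nonempty (SimpleReps C (fun j => (D j)ᵐᵒᵖ) (fun j => Fin (d j) → D j)) := by
  let B := TensorProduct K (IsLocalRing.ResidueField K) C
  have : IsArtinianRing B := IsArtinianRing.of_finite (IsLocalRing.ResidueField K) B
  obtain ⟨n, D, d, hD, -, ⟨e⟩⟩ :=
    IsSemisimpleRing.exists_ringEquiv_pi_matrix_divisionRing (B ⧸ Ring.jacobson B)
  refine ⟨n, D, d, hD, ⟨?_⟩⟩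
  let Φ (j : Fin n) : Matrix (Fin (d j)) (Fin (d j)) (D j) ≃+*
      Module.End (D j)ᵐᵒᵖ (Fin (d j) → D j) :=
    (RingEquiv.mapMatrix (RingEquiv.moduleEndSelfOp (D j))).trans
      (endVecRingEquivMatrixEnd (Fin (d j)) (D j)ᵐᵒᵖ (D j)).symm
  let p : C →+* B ⧸ Ring.jacobson B :=
    (Ideal.Quotient.mk (Ring.jacobson B)).comp
      (Algebra.TensorProduct.includeRight : C →ₐ[K] B).toRingHom
  have hp : Function.Surjective p := by
    refine Ideal.Quotient.mk_surjective.comp fun b => ?_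
    have hb : b ∈ (⊤ : Submodule K C).map
        (TensorProduct.mk K (IsLocalRing.ResidueField K) C 1) := by
      rw [IsLocalRing.map_tensorProduct_mk_eq_top.2 rfl]
      trivial
    obtain ⟨x, -, hx⟩ := hb
    exact ⟨x, hx⟩
  refine
    { rho := fun j => (Φ j).toRingHom.comp ((Pi.evalRingHom _ j).comp (e.toRingHom.comp p))
      surj := fun ψ => ?_
      isUnit := fun c hc => ?_ }
  · obtain ⟨c, hc⟩ := hp (e.symm fun j => (Φ j).symm (ψ j))
    refine ⟨c, fun j => ?_⟩
    change Φ j (e (p c) j) = ψ j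
    rw [hc, e.apply_symm_apply, RingEquiv.apply_symm_apply]
  · have h1 : IsUnit (e (p c)) := by
      rw [Pi.isUnit_iff]
      intro j
      exact (MulEquiv.isUnit_map (Φ j)).1 (hc j)
    have h2 : IsUnit (p c) := (MulEquiv.isUnit_map e).1 h1
    exact isUnit_of_isUnit_one_tmul (isUnit_of_isUnit_mk IsSemiprimaryRing.isNilpotent h2)

end Existence

end OddUnitary

/-! ### Assembly of the decomposition. -/

namespace OddUnitary

open Module

theorem module_finite_mulOpposite (D : Type*) [DivisionRing D] : Module.Finite Dᵐᵒᵖ D :=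
  ⟨⟨{1}, by
    rw [Finset.coe_singleton, eq_top_iff]
    rintro x -
    exact Submodule.mem_span_singleton.2 ⟨MulOpposite.op x, by simp⟩⟩⟩

/-- The ring-theoretic form of the theorem, in terms of `C` with its involution and frame. -/
theorem AugmentedLevel.GU'_eq {K C : Type*} [CommRing K] [IsLocalRing K] [Ring C] [StarRing C]
    [Algebra K C] [Module.Finite K C] {l : ℕ} (hl : 3 ≤ l) {F : Frame C l} (hF : F.Comparable)
    {U : Subgroup Cˣ} (hU : ∀ g ∈ U, star g.val * g.val = 1)
    (h₀ : ∃ s : Finset C, s.card < 4 * l ^ 2 ∧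
      (Submodule.span K (s : Set C) : Set C) = Set.range fun c : C => F.e 0 * c * F.e 0)
    (L : AugmentedLevel F K U) {k : ℤ} (hk : k ≠ 0) :
    L.GU' = (L.EU : Set Cˣ) * L.GU'hat k := by
  refine Set.Subset.antisymm (fun g hg => ?_) ?_
  · obtain ⟨n, D, d, _, ⟨S⟩⟩ := exists_simpleReps K C
    have (j : Fin n) : Module.Finite (D j)ᵐᵒᵖ (D j) := module_finite_mulOpposite (D j)
    obtain ⟨s, hs, hspan⟩ := h₀
    have hd (j : Fin n) :
        finrank (D j)ᵐᵒᵖ (LinearMap.range (S.rho j (F.e 0))) < 2 * l := by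
      have := S.finrank_mul_finrank_le (K := K) j s hspan (F.idem 0)
      by_contra! h
      have := Nat.mul_le_mul h h
      nlinarith
    obtain ⟨f₁, hf₁, -, h1⟩ := exists_cornerInvertible S L hl hF hU hd hg hk
    have hg₁ := mul_mem_GU' hU (Level.elementary_le_EU _ hf₁) hg
    obtain ⟨f₂, hf₂, hf₂k, h2⟩ := exists_cornerInvertible S L hl hF hU hd hg₁ (neg_ne_zero.2 hk)
    have hg₂ := mul_mem_GU' hU (Level.elementary_le_EU _ hf₂) hg₁
    rw [neg_neg] at hf₂k
    -- Because `f₂` fixes row `k`, making the corner at `-k` invertible leaves the corner at `k` as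
    -- it was.
    have h1' : CornerInvertible F k (alpha (f₂ * (f₁ * g))) := by
      obtain ⟨u, u1, u2, u3, u4⟩ := h1
      have e : F.d k * alpha (f₂ * (f₁ * g)) = F.d k * alpha (f₁ * g) := by
        rw [alpha_mul, ← mul_assoc, hf₂k]
      refine ⟨u, u1, u2, by rw [e, u3], ?_⟩
      rw [← u2, mul_assoc u, e, ← mul_assoc, u2, u4]
    obtain ⟨f₃, hf₃, h3⟩ := exists_mem_GU'hat hl hF hU hg₂ hk h1' h2
    refine ⟨(f₃ * (f₂ * f₁))⁻¹, ?_, _, h3, by group⟩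
    exact inv_mem (Level.elementary_le_EU _
      (Subgroup.mul_mem _ hf₃ (Subgroup.mul_mem _ hf₂ hf₁)))
  · rintro _ ⟨f, hf, g, hg, rfl⟩
    exact mul_mem_GU' hU hf hg.1

end OddUnitary

theorem mainTheorem4 {K AK T AT R AR P : Type*}
    [CommRing K] [OddUnitary.PInv K] [CommRing AK] [OddUnitary.QuadraticStructure K AK]
    [OddUnitary.QuadraticRing K AK]
    [Ring T] [OddUnitary.PInv T] [AddCommGroup AT] [OddUnitary.QuadraticStructure T AT]
    [Algebra K T] [Module AK AT] [OddUnitary.QuadraticAlgebra K AK T AT]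
    [Ring R] [OddUnitary.PInv R] [AddCommGroup AR] [OddUnitary.QuadraticStructure R AR]
    [Algebra K R] [Module AK AR] [OddUnitary.QuadraticAlgebra K AK R AR]
    [AddCommGroup P] [Module K P] [Module T P] [Module Rᵐᵒᵖ P] [SMulCommClass T Rᵐᵒᵖ P]
    [IsScalarTower K T P] [IsScalarTower K Rᵐᵒᵖ P]
    (Q : OddUnitary.QuadraticSpace K AK T AT R AR P)
    (l : ℕ) (hl : 3 ≤ l) (D : Q.Decomposition l)
    (hK : IsLocalRing K) (hC : Module.Finite K Q.C)
    (h₀ : ∃ s : Finset Q.C, s.card < 4 * l ^ 2 ∧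
      (Submodule.span K (s : Set Q.C) : Set Q.C) = Set.range fun c : Q.C => D.e 0 * c * D.e 0)
    (L : OddUnitary.AugmentedLevel D.toFrame K Q.unitary)
    (k : ℤ) (hk : k ≠ 0) (hkl : |k| ≤ l) :
    L.GU' = (L.EU : Set Q.Cˣ) * L.GU'hat k := by

  refine OddUnitary.AugmentedLevel.GU'_eq hl D.summand (fun g hg => ?_) h₀ L hk
  -- An isometry satisfies `star g * g = 1` because `B` is nondegenerate.
  refine OddUnitary.QuadraticSpace.C.ext fun p' =>
    OddUnitary.HermitianForm.ext_right Q.nondegenerate fun p => ?_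
  rw [OddUnitary.QuadraticSpace.C.toEnd_mul, OddUnitary.QuadraticSpace.C.toEnd_one]
  exact (OddUnitary.QuadraticSpace.B_adjoint g.val p _).symm.trans (hg.1 p p')
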